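/- Let $a>b>0$, $\lambda\in\mathbb R\setminus\{0\}$, $p^2=a^2+b^2$, $r^2=a^2-b^2$. In $\mathbb R^9(\boldsymbol\omega,\boldsymbol\alpha,\boldsymbol\beta)$ let $\mathcal P^6$ be given by $\boldsymbol\alpha\cdot\boldsymbol\alpha=a^2$, $\boldsymbol\beta\cdot\boldsymbol\beta=b^2$, $\boldsymbol\alpha\cdot\boldsymbol\beta=0$, put $\mathbf M=(2\omega_1,2\omega_2,\omega_3+\lambda)$, and consider the first integrals of the Kowalevski gyrostat in a double field $$H=\omega_1^2+\omega_2^2+\tfrac12\omega_3^2-\alpha_1-\beta_2,$$ $$K=(\omega_1^2-\omega_2^2+\alpha_1-\beta_2)^2+(2\omega_1\omega_2+\alpha_2+\beta_1)^2+2\lambda[(\omega_3-\lambda)(\omega_1^2+\omega_2^2)+2\omega_1\alpha_3+2\omega_2\beta_3],$$ $$G=\tfrac14\big[(\mathbf M\cdot\boldsymbol\alpha)^2+(\mathbf M\cdot\boldsymbol\beta)^2\big]+\tfrac12(\omega_3-\lambda)\,\mathbf M\cdot(\boldsymbol\alpha\times\boldsymbol\beta)-b^2\alpha_1-a^2\beta_2,$$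 and the integral map $J=(H,K,G):\mathcal P^6\to\mathbb R^3(h,k,g)$. For a function $F$ let $\operatorname{sgrad}F$ be the Hamiltonian field $\dot{\mathbf M}=\mathbf M\times F_{\mathbf M}+\boldsymbol\alpha\times F_{\boldsymbol\alpha}+\boldsymbol\beta\times F_{\boldsymbol\beta}$, $\dot{\boldsymbol\alpha}=\boldsymbol\alpha\times F_{\mathbf M}$, $\dot{\boldsymbol\beta}=\boldsymbol\beta\times F_{\mathbf M}$. Types. Let $x$ be a point of rank 2, i.e. $\operatorname{rank}dJ(x)=2$ on $T_x\mathcal P^6$. If $F=c_0H+c_1K+c_2G$ with $(c_0,c_1,c_2)\ne0$ satisfies $dF(x)=0$ on $T_x\mathcal P^6$, let $A_F$ be the linearization of $\operatorname{sgrad}F$ on $T_x\mathcal P^6$; if its characteristic polynomial is $\mu^4(\mu^2-C)$, then $C$ is called the square of the characteristic exponent of $F$ at $x$. The point $x$ is a center (a saddle) if some such $F$ has $C<0$ (resp. $C>0$), and is degenerate if no such $F$ has $C\neq0$. Surfaces. Let $\Pi_1,\Pi_2\subset\mathbb R^3(h,k,g)$ be the surfaces parametrized by $(h,s)$, $s\ne0$: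 $$\Pi_1:\ k=p^2+\big(h-\tfrac{\lambda^2}2\big)^2-4\big(h-\tfrac{\lambda^2}2\big)s+3s^2-\tfrac{p^4-r^4}{4s^2},\quad g=\big(h-\tfrac{\lambda^2}2-s\big)s^2+\tfrac{p^4-r^4}{4s};$$ $$\Pi_2:\ k=-2\lambda^2\big(h-\tfrac{\lambda^2}2-2s\big)-\lambda^4+\tfrac{r^4}{4s^2},\quad g=\tfrac12p^2\big(h+\tfrac{\lambda^2}2\big)-\lambda^2s^2-\tfrac{r^4}{4s}.$$ The cuspidal edge of $\Pi_2$ is the set of its points at which the germ of the parametrization is equivalent, under smooth changes of coordinates in source and target, to $(u,v)\mapsto(u,v^2,v^3)$. The curve of tangency of $\Pi_1,\Pi_2$ is the closure of the set of their common points at which both parametrizations are immersive and have the same tangent plane. The subsystem $\mathcal M_2$. Put $x_1=(\alpha_1-\beta_2)+i(\alpha_2+\beta_1)$, $y_1=(\alpha_1+\beta_2)+i(\alpha_2-\beta_1)$, $z_1=\alpha_3+i\beta_3$, $w_1=\omega_1+i\omega_2$, $w_3=\omega_3$, and let $x_2,y_2,z_2,w_2$ be the complex conjugates of $x_1,y_1,z_1,w_1$.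 The critical subsystem $\mathcal M_2$ is the closure of the set of points of $\mathcal P^6$ at which $w_1w_2+\lambda w_3\ne0$, $w_2x_1+\lambda z_1\neq0$ and $$y_1=\frac{1}{(w_1w_2+\lambda w_3)(w_2x_1+\lambda z_1)\lambda}\big[w_2(w_1^2+x_1)(x_2z_1w_1+x_1z_2w_2-x_1x_2w_3+2z_1z_2\lambda)+x_2(w_1w_3+z_1)(w_1z_1-x_1w_3)\lambda-(x_1w_3^2-2z_1w_1w_3-z_1^2)z_2\lambda^2\big]$$ (together with the conjugate equation for $y_2$). Theorem. Every $x\in\mathcal M_2$ is a critical point of $J$ (of rank at most 2) with $J(x)\in\Pi_2$, and the value $s\ne 0$ of the parameter with which $J(x)$ is the point $(h,s)$ of $\Pi_2$, $h=H(x)$, is unique. If $x\in\mathcal M_2$ has rank 2, then with this $s$ the number $$\mu^2=-\frac1s\big[8\lambda^2s^3-r^4\big]\Big[2s^2-2\big(h+\tfrac{\lambda^2}2\big)s+p^2\Big]$$ is the square of the characteristic exponent at $x$ of the integral $L=2G-(p^2-2\lambda^2s)H+sK$ (with the constant $s$; in particular $dL(x)=0$), and $x$ is a center if and only if $\mu^2<0$,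 a saddle if and only if $\mu^2>0$, and degenerate if and only if $\mu=0$. Moreover, a rank-2 point $x\in\mathcal M_2$ is degenerate if and only if $J(x)$ lies on the cuspidal edge of $\Pi_2$ or on the curve of tangency of $\Pi_2$ with $\Pi_1$, and the set of points of $\Pi_2$ with $\mu^2=0$ is exactly the union of this cuspidal edge and this curve of tangency. -/

import Mathlib

open scoped ContDiff Topology Matrix

noncomputable section

namespace KowalevskiGyrostat

/-- The space `ℝ⁹(ω, α, β)`; the point is written as `(ω, α, β)`. -/
abbrev Phase : Type := (Fin 3 → ℝ) × (Fin 3 → ℝ) × (Fin 3 → ℝ)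

/-- The space `ℝ³(h, k, g)` of constants of the first integrals. -/
abbrev Val : Type := ℝ × ℝ × ℝ

/-! ### Phase space and first integrals -/

/-- The geometric integrals `(α·α, β·β, α·β)`. -/
def geom (x : Phase) : ℝ × ℝ × ℝ :=
  (x.2.1 ⬝ᵥ x.2.1, x.2.2 ⬝ᵥ x.2.2, x.2.1 ⬝ᵥ x.2.2)

/-- The six-dimensional phase space `𝒫⁶`. -/
def phaseSpace (a b : ℝ) : Set Phase := {x | geom x = (a ^ 2, b ^ 2, 0)}

/-- The tangent space to `𝒫⁶` at its point `x`, as a subspace of `ℝ⁹`. -/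
def tangent (x : Phase) : Submodule ℝ Phase :=
  LinearMap.ker (fderiv ℝ geom x).toLinearMap

/-- The kinetic momentum `(2ω₁, 2ω₂, ω₃ + λ)`. -/
def momentum (lam : ℝ) (x : Phase) : Fin 3 → ℝ :=
  ![2 * x.1 0, 2 * x.1 1, x.1 2 + lam]

def intH (x : Phase) : ℝ :=
  (x.1 0) ^ 2 + (x.1 1) ^ 2 + (1 / 2) * (x.1 2) ^ 2 - x.2.1 0 - x.2.2 1

def intK (lam : ℝ) (x : Phase) : ℝ :=
  ((x.1 0) ^ 2 - (x.1 1) ^ 2 + x.2.1 0 - x.2.2 1) ^ 2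
    + (2 * x.1 0 * x.1 1 + x.2.1 1 + x.2.2 0) ^ 2
    + 2 * lam * ((x.1 2 - lam) * ((x.1 0) ^ 2 + (x.1 1) ^ 2)
        + 2 * x.1 0 * x.2.1 2 + 2 * x.1 1 * x.2.2 2)

def intG (a b lam : ℝ) (x : Phase) : ℝ :=
  (1 / 4) * ((momentum lam x ⬝ᵥ x.2.1) ^ 2 + (momentum lam x ⬝ᵥ x.2.2) ^ 2)
    + (1 / 2) * (x.1 2 - lam) * (momentum lam x ⬝ᵥ (x.2.1 ⨯₃ x.2.2))
    - b ^ 2 * x.2.1 0 - a ^ 2 * x.2.2 1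

/-- The integral map `J = H × K × G`. -/
def intJ (a b lam : ℝ) (x : Phase) : Val := (intH x, intK lam x, intG a b lam x)

/-- The rank of `J : 𝒫⁶ → ℝ³` at `x`: the dimension of the image of the tangent space. -/
def rankJ (a b lam : ℝ) (x : Phase) : ℕ :=
  Module.finrank ℝ ((tangent x).map (fderiv ℝ (intJ a b lam) x).toLinearMap)

/-! ### Hamiltonian fields -/

/-- Partial gradients of `F` in `ω`, `α`, `β`. -/
def gradω (F : Phase → ℝ) (x : Phase) : Fin 3 → ℝ :=
  fun i => fderiv ℝ F x (Pi.single i 1, 0, 0)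

def gradα (F : Phase → ℝ) (x : Phase) : Fin 3 → ℝ :=
  fun i => fderiv ℝ F x (0, Pi.single i 1, 0)

def gradβ (F : Phase → ℝ) (x : Phase) : Fin 3 → ℝ :=
  fun i => fderiv ℝ F x (0, 0, Pi.single i 1)

/-- Gradient of `F` in the kinetic momentum `M = (2ω₁, 2ω₂, ω₃ + λ)`. -/
def gradM (F : Phase → ℝ) (x : Phase) : Fin 3 → ℝ :=
  ![gradω F x 0 / 2, gradω F x 1 / 2, gradω F x 2]

/-- The time derivative of `M` along the Hamiltonian field of `F`. -/
def momentumDot (lam : ℝ) (F : Phase → ℝ) (x : Phase) : Fin 3 → ℝ :=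
  momentum lam x ⨯₃ gradM F x + x.2.1 ⨯₃ gradα F x + x.2.2 ⨯₃ gradβ F x

/-- The Hamiltonian field `sgrad F` on `ℝ⁹` for the Lie-Poisson bracket
`{Mᵢ,Mⱼ} = εᵢⱼₖ Mₖ`, `{Mᵢ,αⱼ} = εᵢⱼₖ αₖ`, `{Mᵢ,βⱼ} = εᵢⱼₖ βₖ`, `{α,α} = {α,β} = {β,β} = 0`
(up to the common sign), that is,
`Ṁ = M × F_M + α × F_α + β × F_β`, `α̇ = α × F_M`, `β̇ = β × F_M`,
written in the coordinates `(ω, α, β)`. The functions in `geom` are its Casimir functions, and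
for `F = H` these are the Euler-Poisson equations of the gyrostat. -/
def sgrad (lam : ℝ) (F : Phase → ℝ) (x : Phase) : Phase :=
  (![momentumDot lam F x 0 / 2, momentumDot lam F x 1 / 2, momentumDot lam F x 2],
    x.2.1 ⨯₃ gradM F x, x.2.2 ⨯₃ gradM F x)

/-- The linearization at `x` of the field `sgrad F` on `ℝ⁹`. -/
def linField (lam : ℝ) (F : Phase → ℝ) (x : Phase) : Phase →ₗ[ℝ] Phase :=
  (fderiv ℝ (sgrad lam F) x).toLinearMap

/-! ### Types of critical points of rank 2 -/

/-- The first integral `c₀ H + c₁ K + c₂ G`. -/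
def combo (a b lam : ℝ) (c : Fin 3 → ℝ) (x : Phase) : ℝ :=
  c 0 * intH x + c 1 * intK lam x + c 2 * intG a b lam x

/-- The differential of `F` on `𝒫⁶` vanishes at `x`. -/
def CriticalAt (F : Phase → ℝ) (x : Phase) : Prop :=
  ∀ v ∈ tangent x, fderiv ℝ F x v = 0

/-- `C` is the square of the characteristic exponent of `F` at `x`: `x` is a critical point of
`F` on `𝒫⁶`, and the operator `A_F`, the linearization of `sgrad F` on the six-dimensional tangent
space to `𝒫⁶`, has characteristic polynomial `μ⁴ (μ² - C)`. -/
def HasExponentSq (lam : ℝ) (F : Phase → ℝ) (x : Phase) (C : ℝ) : Prop :=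
  CriticalAt F x ∧
    ∃ hA : ∀ v ∈ tangent x, linField lam F x v ∈ tangent x,
      ((linField lam F x).restrict hA).charpoly =
        Polynomial.X ^ 4 * (Polynomial.X ^ 2 - Polynomial.C C)

/-- A critical point of rank 2 of type "center". -/
def IsCenter (a b lam : ℝ) (x : Phase) : Prop :=
  rankJ a b lam x = 2 ∧
    ∃ c : Fin 3 → ℝ, c ≠ 0 ∧ ∃ C < 0, HasExponentSq lam (combo a b lam c) x C

/-- A critical point of rank 2 of type "saddle". -/
def IsSaddle (a b lam : ℝ) (x : Phase) : Prop :=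
  rankJ a b lam x = 2 ∧
    ∃ c : Fin 3 → ℝ, c ≠ 0 ∧ ∃ C > 0, HasExponentSq lam (combo a b lam c) x C

/-- A degenerate critical point of rank 2: no integral has a non-zero characteristic exponent. -/
def IsDegenerate (a b lam : ℝ) (x : Phase) : Prop :=
  rankJ a b lam x = 2 ∧
    ¬ ∃ c : Fin 3 → ℝ, c ≠ 0 ∧ ∃ C ≠ 0, HasExponentSq lam (combo a b lam c) x C

/-! ### The surfaces `Π₁`, `Π₂` in `ℝ³(h, k, g)` -/

/-- The parametrization of `Π₁` by `(h, s)`, `s ≠ 0`; here `p² = a² + b²`, `r² = a² - b²`. -/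
def surf₁ (a b lam : ℝ) (q : ℝ × ℝ) : Val :=
  let h := q.1
  let s := q.2
  let p2 := a ^ 2 + b ^ 2
  let r4 := (a ^ 2 - b ^ 2) ^ 2
  (h,
    p2 + (h - lam ^ 2 / 2) ^ 2 - 4 * (h - lam ^ 2 / 2) * s + 3 * s ^ 2
      - (p2 ^ 2 - r4) / (4 * s ^ 2),
    (h - lam ^ 2 / 2 - s) * s ^ 2 + (p2 ^ 2 - r4) / (4 * s))

/-- The parametrization of `Π₂` by `(h, s)`, `s ≠ 0`. -/
def surf₂ (a b lam : ℝ) (q : ℝ × ℝ) : Val :=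
  let h := q.1
  let s := q.2
  let p2 := a ^ 2 + b ^ 2
  let r4 := (a ^ 2 - b ^ 2) ^ 2
  (h,
    -2 * lam ^ 2 * (h - lam ^ 2 / 2 - 2 * s) - lam ^ 4 + r4 / (4 * s ^ 2),
    (1 / 2) * p2 * (h + lam ^ 2 / 2) - lam ^ 2 * s ^ 2 - r4 / (4 * s))

/-- The germ of `f` at `q` is a cuspidal edge: after smooth changes of coordinates in the source
and in the target it becomes `(u, v) ↦ (u, v², v³)` at the origin. -/
def IsCuspidalEdgeAt (f : ℝ × ℝ → Val) (q : ℝ × ℝ) : Prop :=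
  ∃ (Φ : OpenPartialHomeomorph (ℝ × ℝ) (ℝ × ℝ)) (Ψ : OpenPartialHomeomorph Val Val),
    q ∈ Φ.source ∧ f q ∈ Ψ.source ∧ Φ q = 0 ∧
    ContDiffOn ℝ ∞ Φ Φ.source ∧ ContDiffOn ℝ ∞ Φ.symm Φ.target ∧
    ContDiffOn ℝ ∞ Ψ Ψ.source ∧ ContDiffOn ℝ ∞ Ψ.symm Ψ.target ∧
    ∀ᶠ y in 𝓝 q, Ψ (f y) = ((Φ y).1, (Φ y).2 ^ 2, (Φ y).2 ^ 3)

/-- The cuspidal edge of `Π₂`. -/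
def cuspidalEdge₂ (a b lam : ℝ) : Set Val :=
  {P | ∃ q : ℝ × ℝ, q.2 ≠ 0 ∧ surf₂ a b lam q = P ∧ IsCuspidalEdgeAt (surf₂ a b lam) q}

/-- The common points of `Π₁`, `Π₂` at which both are regular and have the same tangent plane. -/
def regularTangency (a b lam : ℝ) : Set Val :=
  {P | ∃ q₁ q₂ : ℝ × ℝ, q₁.2 ≠ 0 ∧ q₂.2 ≠ 0 ∧ surf₁ a b lam q₁ = P ∧ surf₂ a b lam q₂ = P ∧
    Function.Injective (fderiv ℝ (surf₁ a b lam) q₁) ∧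
    Function.Injective (fderiv ℝ (surf₂ a b lam) q₂) ∧
    LinearMap.range (fderiv ℝ (surf₁ a b lam) q₁).toLinearMap =
      LinearMap.range (fderiv ℝ (surf₂ a b lam) q₂).toLinearMap}

/-- The curve of tangency of `Π₁` and `Π₂`. The closure adds the isolated points of this curve
at which one of the surfaces is singular. -/
def tangencyCurve (a b lam : ℝ) : Set Val := closure (regularTangency a b lam)

/-! ### The critical subsystem `𝓜₂` -/

/-- The complex coordinates `x₁, y₁, z₁, w₁`; the coordinates `x₂, y₂, z₂, w₂` are their complex
conjugates. -/
def cx₁ (x : Phase) : ℂ := ⟨x.2.1 0 - x.2.2 1, x.2.1 1 + x.2.2 0⟩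
def cx₂ (x : Phase) : ℂ := ⟨x.2.1 0 - x.2.2 1, -(x.2.1 1 + x.2.2 0)⟩
def cy₁ (x : Phase) : ℂ := ⟨x.2.1 0 + x.2.2 1, x.2.1 1 - x.2.2 0⟩
def cy₂ (x : Phase) : ℂ := ⟨x.2.1 0 + x.2.2 1, -(x.2.1 1 - x.2.2 0)⟩
def cz₁ (x : Phase) : ℂ := ⟨x.2.1 2, x.2.2 2⟩
def cz₂ (x : Phase) : ℂ := ⟨x.2.1 2, -(x.2.2 2)⟩
def cw₁ (x : Phase) : ℂ := ⟨x.1 0, x.1 1⟩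
def cw₂ (x : Phase) : ℂ := ⟨x.1 0, -(x.1 1)⟩
def cw₃ (x : Phase) : ℂ := ((x.1 2 : ℝ) : ℂ)

/-- The right-hand side of the equation for `y₁`; the one for `y₂` is obtained by exchanging the
indices 1 and 2. -/
def rhs (l x₁ x₂ z₁ z₂ w₁ w₂ w₃ : ℂ) : ℂ :=
  1 / ((w₁ * w₂ + l * w₃) * (w₂ * x₁ + l * z₁) * l) *
    (w₂ * (w₁ ^ 2 + x₁) * (x₂ * z₁ * w₁ + x₁ * z₂ * w₂ - x₁ * x₂ * w₃ + 2 * z₁ * z₂ * l)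
      + x₂ * (w₁ * w₃ + z₁) * (w₁ * z₁ - x₁ * w₃) * l
      - (x₁ * w₃ ^ 2 - 2 * z₁ * w₁ * w₃ - z₁ ^ 2) * z₂ * l ^ 2)

/-- The part of `𝒫⁶` given by the explicit equations for `y₁, y₂`, with non-zero denominators. -/
def subsystem₂Generic (a b lam : ℝ) : Set Phase :=
  {x | x ∈ phaseSpace a b ∧
    cw₁ x * cw₂ x + lam * cw₃ x ≠ 0 ∧
    cw₂ x * cx₁ x + lam * cz₁ x ≠ 0 ∧
    cw₁ x * cx₂ x + lam * cz₂ x ≠ 0 ∧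
    cy₁ x = rhs lam (cx₁ x) (cx₂ x) (cz₁ x) (cz₂ x) (cw₁ x) (cw₂ x) (cw₃ x) ∧
    cy₂ x = rhs lam (cx₂ x) (cx₁ x) (cz₂ x) (cz₁ x) (cw₂ x) (cw₁ x) (cw₃ x)}

/-- The critical subsystem `𝓜₂` (for `λ ≠ 0`). -/
def subsystem₂ (a b lam : ℝ) : Set Phase := closure (subsystem₂Generic a b lam)

/-! ### The characteristic exponent -/

/-- `μ² = -(1/s) (8 λ² s³ - r⁴) (2 s² - 2 (h + λ²/2) s + p²)`. -/
def muSq (a b lam h s : ℝ) : ℝ :=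
  -(1 / s) * (8 * lam ^ 2 * s ^ 3 - (a ^ 2 - b ^ 2) ^ 2)
    * (2 * s ^ 2 - 2 * (h + lam ^ 2 / 2) * s + (a ^ 2 + b ^ 2))

/-- The coefficients of the integral `L = 2 G - (p² - 2 λ² s) H + s K`. -/
def coeffL (a b lam s : ℝ) : Fin 3 → ℝ :=
  ![-(a ^ 2 + b ^ 2 - 2 * lam ^ 2 * s), s, 2]

end KowalevskiGyrostat

end

noncomputable section

namespace KowalevskiGyrostat

/-! ### Coordinates and gradients -/

/-! Three mechanisms carry the proof.

Symplectic reduction. The map `emb` identifies the tangent space of 𝒫⁶ with pairs (ξ, m), and `symp`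
is the symplectic form there. On 𝒫⁶ the functions H, K, G are in involution. At a point of rank 2 a
critical combination L with non-zero coefficient of G leaves the Hamiltonian vectors of H and K
independent; they span an isotropic plane inside the kernel of A_L. So A_L effectively acts on the
two-dimensional quotient of the skew-orthogonal complement by this plane, and its characteristic
polynomial is X⁴(X² − tr(A_L²)/2) (`charpoly_of_isotropic_kernel`, `charpoly_reducedLin`). One
number remains to be computed.

Computation on 𝓜₂. In complex coordinates A_L is i times the matrix `linL`. The generic points of 𝓜₂
are covered by the polynomial map `param` (`eq_param`). Along it the field of L vanishes, (h, k, g)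
satisfies the equations of Π₂, and `linL` is a multiple of a sum of three rank-one matrices, whence
tr(A_L²) = 2μ² (`trace_linL_param`). Cleared of denominators, these facts form `Related`, a closed
condition on (x, s). The equation for k is a cubic for s with leading coefficient 16λ², so s stays
bounded and the relations extend to the closure (`exists_related`); s ≠ 0 because r⁴ ≠ 0. At rank 2
the critical combination is unique up to a factor t, which multiplies the square of the exponent by
t², so the sign of μ² decides the type.

Surfaces. On both Π₁ and Π₂ the derivative in s is proportional to (0, 1, −s/2). On Π₂ it vanishes
exactly when 8λ²s³ = r⁴, and there the surface is, in suitable coordinates, the set of cubics with a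
double root near a triple one, a cuspidal edge (`isCuspidalEdgeAt_surf₂`). Tangency of Π₁ and Π₂
forces equal values of s, and comparing the derivatives in h gives the vanishing of the second
factor of μ² (`tangencyCurve_eq`). -/

lemma fderiv_omega (x v : Phase) (i : Fin 3) : fderiv ℝ (fun y : Phase => y.1 i) x v = v.1 i := by
  have := ((ContinuousLinearMap.proj (R := ℝ) (φ := fun _ : Fin 3 => ℝ) i).comp
    (ContinuousLinearMap.fst ℝ (Fin 3 → ℝ) ((Fin 3 → ℝ) × (Fin 3 → ℝ)))).hasFDerivAt (x := x)
  exact congrArg (fun f => f v) this.fderiv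

lemma fderiv_alpha (x v : Phase) (i : Fin 3) :
    fderiv ℝ (fun y : Phase => y.2.1 i) x v = v.2.1 i := by
  have := ((ContinuousLinearMap.proj (R := ℝ) (φ := fun _ : Fin 3 => ℝ) i).comp
    ((ContinuousLinearMap.fst ℝ (Fin 3 → ℝ) (Fin 3 → ℝ)).comp
    (ContinuousLinearMap.snd ℝ (Fin 3 → ℝ) ((Fin 3 → ℝ) × (Fin 3 → ℝ))))).hasFDerivAt (x := x)
  exact congrArg (fun f => f v) this.fderiv

lemma fderiv_beta (x v : Phase) (i : Fin 3) :
    fderiv ℝ (fun y : Phase => y.2.2 i) x v = v.2.2 i := by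
  have := ((ContinuousLinearMap.proj (R := ℝ) (φ := fun _ : Fin 3 => ℝ) i).comp
    ((ContinuousLinearMap.snd ℝ (Fin 3 → ℝ) (Fin 3 → ℝ)).comp
    (ContinuousLinearMap.snd ℝ (Fin 3 → ℝ) ((Fin 3 → ℝ) × (Fin 3 → ℝ))))).hasFDerivAt (x := x)
  exact congrArg (fun f => f v) this.fderiv

lemma fderiv_intH (x v : Phase) : fderiv ℝ intH x v =
    2 * x.1 0 * v.1 0 + 2 * x.1 1 * v.1 1 + x.1 2 * v.1 2 - v.2.1 0 - v.2.2 1 := by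
  unfold intH
  simp (disch := fun_prop) only [fderiv_fun_add, fderiv_fun_sub, fderiv_fun_mul, fderiv_fun_pow,
    fderiv_fun_const, add_apply, sub_apply, smul_apply, zero_apply, Pi.zero_apply,
    fderiv_omega, fderiv_alpha, fderiv_beta, smul_eq_mul, nsmul_eq_mul]
  push_cast
  ring

lemma fderiv_intK (lam : ℝ) (x v : Phase) : fderiv ℝ (intK lam) x v =
    2 * ((x.1 0) ^ 2 - (x.1 1) ^ 2 + x.2.1 0 - x.2.2 1)
        * (2 * x.1 0 * v.1 0 - 2 * x.1 1 * v.1 1 + v.2.1 0 - v.2.2 1)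
      + 2 * (2 * x.1 0 * x.1 1 + x.2.1 1 + x.2.2 0)
        * (2 * x.1 0 * v.1 1 + 2 * x.1 1 * v.1 0 + v.2.1 1 + v.2.2 0)
      + 2 * lam * (v.1 2 * ((x.1 0) ^ 2 + (x.1 1) ^ 2)
        + (x.1 2 - lam) * (2 * x.1 0 * v.1 0 + 2 * x.1 1 * v.1 1)
        + 2 * x.1 0 * v.2.1 2 + 2 * v.1 0 * x.2.1 2
        + 2 * x.1 1 * v.2.2 2 + 2 * v.1 1 * x.2.2 2) := by
  unfold intK
  simp (disch := fun_prop) only [fderiv_fun_add, fderiv_fun_sub, fderiv_fun_mul, fderiv_fun_pow,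
    fderiv_fun_const, add_apply, sub_apply, smul_apply, zero_apply, Pi.zero_apply,
    fderiv_omega, fderiv_alpha, fderiv_beta, smul_eq_mul, nsmul_eq_mul]
  push_cast
  ring

lemma intG_eq (a b lam : ℝ) : intG a b lam = fun x : Phase =>
    (1 / 4) * ((2 * x.1 0 * x.2.1 0 + 2 * x.1 1 * x.2.1 1 + (x.1 2 + lam) * x.2.1 2) ^ 2
      + (2 * x.1 0 * x.2.2 0 + 2 * x.1 1 * x.2.2 1 + (x.1 2 + lam) * x.2.2 2) ^ 2)
    + (1 / 2) * (x.1 2 - lam) * (2 * x.1 0 * (x.2.1 1 * x.2.2 2 - x.2.1 2 * x.2.2 1)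
        + 2 * x.1 1 * (x.2.1 2 * x.2.2 0 - x.2.1 0 * x.2.2 2)
        + (x.1 2 + lam) * (x.2.1 0 * x.2.2 1 - x.2.1 1 * x.2.2 0))
    - b ^ 2 * x.2.1 0 - a ^ 2 * x.2.2 1 := by
  funext x
  simp [intG, momentum, dotProduct, Fin.sum_univ_three, cross_apply]

lemma fderiv_intG (a b lam : ℝ) (x v : Phase) : fderiv ℝ (intG a b lam) x v =
    (1 / 2) * ((2 * x.1 0 * x.2.1 0 + 2 * x.1 1 * x.2.1 1 + (x.1 2 + lam) * x.2.1 2)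
        * (2 * x.1 0 * v.2.1 0 + 2 * x.1 1 * v.2.1 1 + (x.1 2 + lam) * v.2.1 2
          + 2 * v.1 0 * x.2.1 0 + 2 * v.1 1 * x.2.1 1 + v.1 2 * x.2.1 2)
      + (2 * x.1 0 * x.2.2 0 + 2 * x.1 1 * x.2.2 1 + (x.1 2 + lam) * x.2.2 2)
        * (2 * x.1 0 * v.2.2 0 + 2 * x.1 1 * v.2.2 1 + (x.1 2 + lam) * v.2.2 2
          + 2 * v.1 0 * x.2.2 0 + 2 * v.1 1 * x.2.2 1 + v.1 2 * x.2.2 2))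
    + (1 / 2) * v.1 2 * (2 * x.1 0 * (x.2.1 1 * x.2.2 2 - x.2.1 2 * x.2.2 1)
        + 2 * x.1 1 * (x.2.1 2 * x.2.2 0 - x.2.1 0 * x.2.2 2)
        + (x.1 2 + lam) * (x.2.1 0 * x.2.2 1 - x.2.1 1 * x.2.2 0))
    + (1 / 2) * (x.1 2 - lam) * (2 * v.1 0 * (x.2.1 1 * x.2.2 2 - x.2.1 2 * x.2.2 1)
        + 2 * v.1 1 * (x.2.1 2 * x.2.2 0 - x.2.1 0 * x.2.2 2)
        + v.1 2 * (x.2.1 0 * x.2.2 1 - x.2.1 1 * x.2.2 0))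
    + (1 / 2) * (x.1 2 - lam) * (
        2 * x.1 0 * (v.2.1 1 * x.2.2 2 + x.2.1 1 * v.2.2 2 - v.2.1 2 * x.2.2 1 - x.2.1 2 * v.2.2 1)
        + 2 * x.1 1 * (v.2.1 2 * x.2.2 0 + x.2.1 2 * v.2.2 0 - v.2.1 0 * x.2.2 2
            - x.2.1 0 * v.2.2 2)
        + (x.1 2 + lam) *
          (v.2.1 0 * x.2.2 1 + x.2.1 0 * v.2.2 1 - v.2.1 1 * x.2.2 0 - x.2.1 1 * v.2.2 0))
    - b ^ 2 * v.2.1 0 - a ^ 2 * v.2.2 1 := by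
  rw [intG_eq]
  simp (disch := fun_prop) only [fderiv_fun_add, fderiv_fun_sub, fderiv_fun_mul, fderiv_fun_pow,
    fderiv_fun_const, add_apply, sub_apply, smul_apply, zero_apply, Pi.zero_apply,
    fderiv_omega, fderiv_alpha, fderiv_beta, smul_eq_mul, nsmul_eq_mul]
  push_cast
  ring

lemma contDiff_intH : ContDiff ℝ ∞ intH := by unfold intH; fun_prop
lemma contDiff_intK (lam : ℝ) : ContDiff ℝ ∞ (intK lam) := by unfold intK; fun_prop
lemma contDiff_intG (a b lam : ℝ) : ContDiff ℝ ∞ (intG a b lam) := by rw [intG_eq]; fun_prop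
lemma contDiff_combo (a b lam : ℝ) (c : Fin 3 → ℝ) : ContDiff ℝ ∞ (combo a b lam c) := by
  have h1 := contDiff_intH
  have h2 := contDiff_intK lam
  have h3 := contDiff_intG a b lam
  unfold combo
  fun_prop

lemma fderiv_combo (a b lam : ℝ) (c : Fin 3 → ℝ) (x v : Phase) :
    fderiv ℝ (combo a b lam c) x v =
      c 0 * fderiv ℝ intH x v + c 1 * fderiv ℝ (intK lam) x v
          + c 2 * fderiv ℝ (intG a b lam) x v := by
  have h1 : DifferentiableAt ℝ intH x := contDiff_intH.differentiable (by simp) x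
  have h2 : DifferentiableAt ℝ (intK lam) x := (contDiff_intK lam).differentiable (by simp) x
  have h3 : DifferentiableAt ℝ (intG a b lam) x :=
      (contDiff_intG a b lam).differentiable (by simp) x
  unfold combo
  simp (disch := fun_prop) only [fderiv_fun_add, fderiv_fun_mul,
    fderiv_fun_const, add_apply, smul_apply, zero_apply, Pi.zero_apply,
    smul_eq_mul]
  ring

lemma fderiv_intJ (a b lam : ℝ) (x v : Phase) :
    fderiv ℝ (intJ a b lam) x v =
      (fderiv ℝ intH x v, fderiv ℝ (intK lam) x v, fderiv ℝ (intG a b lam) x v) := by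
  have h1 : DifferentiableAt ℝ intH x := contDiff_intH.differentiable (by simp) x
  have h2 : DifferentiableAt ℝ (intK lam) x := (contDiff_intK lam).differentiable (by simp) x
  have h3 : DifferentiableAt ℝ (intG a b lam) x :=
      (contDiff_intG a b lam).differentiable (by simp) x
  have := h1.hasFDerivAt.prodMk (h2.hasFDerivAt.prodMk h3.hasFDerivAt)
  have e : fderiv ℝ (intJ a b lam) x = _ := this.fderiv
  rw [e]; rfl

lemma fderiv_geom (x v : Phase) :
    fderiv ℝ geom x v = (2 * (x.2.1 ⬝ᵥ v.2.1), 2 * (x.2.2 ⬝ᵥ v.2.2),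
      x.2.1 ⬝ᵥ v.2.2 + x.2.2 ⬝ᵥ v.2.1) := by
  have e : geom = fun x : Phase =>
    (x.2.1 0 ^ 2 + x.2.1 1 ^ 2 + x.2.1 2 ^ 2, x.2.2 0 ^ 2 + x.2.2 1 ^ 2 + x.2.2 2 ^ 2,
      x.2.1 0 * x.2.2 0 + x.2.1 1 * x.2.2 1 + x.2.1 2 * x.2.2 2) := by
    funext x
    simp only [geom, dotProduct, Fin.sum_univ_three, pow_two]
  rw [e, DifferentiableAt.fderiv_prodMk (by fun_prop) (by fun_prop),
    DifferentiableAt.fderiv_prodMk (by fun_prop) (by fun_prop)]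
  simp (disch := fun_prop) only [fderiv_fun_add, fderiv_fun_mul, fderiv_fun_pow,
    add_apply, smul_apply, ContinuousLinearMap.prod_apply, fderiv_alpha, fderiv_beta,
    smul_eq_mul, nsmul_eq_mul, dotProduct, Fin.sum_univ_three]
  push_cast
  refine Prod.ext ?_ (Prod.ext ?_ ?_) <;> dsimp only <;> ring

lemma mem_tangent {x v : Phase} : v ∈ tangent x ↔
    x.2.1 ⬝ᵥ v.2.1 = 0 ∧ x.2.2 ⬝ᵥ v.2.2 = 0 ∧ x.2.1 ⬝ᵥ v.2.2 + x.2.2 ⬝ᵥ v.2.1 = 0 := by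
  have : v ∈ tangent x ↔ fderiv ℝ geom x v = 0 := Iff.rfl
  rw [this, fderiv_geom, Prod.ext_iff, Prod.ext_iff]
  simp

/-- The differential of a function in terms of its partial gradients. -/
lemma fderiv_eq_grad (F : Phase → ℝ) (x v : Phase) :
    fderiv ℝ F x v = gradM F x ⬝ᵥ ![2 * v.1 0, 2 * v.1 1, v.1 2]
      + gradα F x ⬝ᵥ v.2.1 + gradβ F x ⬝ᵥ v.2.2 := by
  have hv : v = (∑ i, v.1 i • ((Pi.single i 1, 0, 0) : Phase))
      + (∑ i, v.2.1 i • ((0, Pi.single i 1, 0) : Phase))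
      + ∑ i, v.2.2 i • ((0, 0, Pi.single i 1) : Phase) := by
    refine Prod.ext ?_ (Prod.ext ?_ ?_) <;> funext i <;> fin_cases i <;>
      simp [Fin.sum_univ_three]
  conv_lhs => rw [hv]
  simp only [map_add, map_smul, gradM, gradω, gradα, gradβ, dotProduct, Fin.sum_univ_three,
    smul_eq_mul, Matrix.cons_val_zero, Matrix.cons_val_one, Matrix.cons_val]
  ring

/-! ### Trivialization of the tangent space -/

/-- The tangent vector to `𝒫⁶` with `δM = m`, `δα = α × ξ`, `δβ = β × ξ`, for `(ξ, m)`. -/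
def emb (x : Phase) : ((Fin 3 → ℝ) × (Fin 3 → ℝ)) →ₗ[ℝ] Phase where
  toFun u := (![u.2 0 / 2, u.2 1 / 2, u.2 2], x.2.1 ⨯₃ u.1, x.2.2 ⨯₃ u.1)
  map_add' u v := by
    refine Prod.ext ?_ (Prod.ext ?_ ?_)
    · funext i; fin_cases i <;> simp <;> ring
    · simp
    · simp
  map_smul' c u := by
    refine Prod.ext ?_ (Prod.ext ?_ ?_)
    · funext i; fin_cases i <;> simp <;> ring
    · simp
    · simp

lemma emb_apply (x : Phase) (u : (Fin 3 → ℝ) × (Fin 3 → ℝ)) :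
    emb x u = (![u.2 0 / 2, u.2 1 / 2, u.2 2], x.2.1 ⨯₃ u.1, x.2.2 ⨯₃ u.1) := rfl

lemma emb_mem_tangent (x : Phase) (u : (Fin 3 → ℝ) × (Fin 3 → ℝ)) : emb x u ∈ tangent x := by
  rw [mem_tangent]
  simp only [emb_apply, cross_apply, dotProduct, Fin.sum_univ_three, Matrix.cons_val_zero,
    Matrix.cons_val_one, Matrix.cons_val]
  refine ⟨?_, ?_, ?_⟩ <;> ring

lemma phaseSpace_eqs {a b : ℝ} {x : Phase} (hx : x ∈ phaseSpace a b) :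
    x.2.1 0 ^ 2 + x.2.1 1 ^ 2 + x.2.1 2 ^ 2 = a ^ 2 ∧
    x.2.2 0 ^ 2 + x.2.2 1 ^ 2 + x.2.2 2 ^ 2 = b ^ 2 ∧
    x.2.1 0 * x.2.2 0 + x.2.1 1 * x.2.2 1 + x.2.1 2 * x.2.2 2 = 0 := by
  have h : geom x = (a ^ 2, b ^ 2, 0) := hx
  simpa [geom, dotProduct, Fin.sum_univ_three, Prod.ext_iff, pow_two] using h

/-- If α × ξ = β × ξ = 0, then ξ is parallel to both α and β, which are non-zero and orthogonal, so
ξ = 0. -/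
lemma emb_injective {a b : ℝ} (hb : 0 < b) (hab : b < a) {x : Phase} (hx : x ∈ phaseSpace a b) :
    Function.Injective (emb x) := by
  rw [← LinearMap.ker_eq_bot, LinearMap.ker_eq_bot']
  rintro ⟨ξ, m⟩ h
  obtain ⟨h1, h2, h3⟩ := phaseSpace_eqs hx
  have ha : 0 < a := hb.trans hab
  have hm : ∀ i, (emb x (ξ, m)).1 i = 0 := fun i => by rw [h]; rfl
  have hp : ∀ i, (x.2.1 ⨯₃ ξ) i = 0 := fun i => congrFun (congrArg (fun y : Phase => y.2.1) h) i
  have hq : ∀ i, (x.2.2 ⨯₃ ξ) i = 0 := fun i => congrFun (congrArg (fun y : Phase => y.2.2) h) i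
  have m0 := hm 0
  have m1 := hm 1
  have m2 := hm 2
  have p0 := hp 0
  have p1 := hp 1
  have p2 := hp 2
  have q0 := hq 0
  have q1 := hq 1
  have q2 := hq 2
  simp only [emb_apply, cross_apply, Matrix.cons_val_zero, Matrix.cons_val_one,
    Matrix.cons_val] at m0 m1 m2 p0 p1 p2 q0 q1 q2
  -- With d = α·ξ, the identity α × (α × ξ) = dα − a²ξ gives a²ξ = dα.
  set d := x.2.1 0 * ξ 0 + x.2.1 1 * ξ 1 + x.2.1 2 * ξ 2 with hd
  have e0 : a ^ 2 * ξ 0 = d * x.2.1 0 := by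
    rw [hd, ← h1]; linear_combination x.2.1 2 * p1 - x.2.1 1 * p2
  have e1 : a ^ 2 * ξ 1 = d * x.2.1 1 := by
    rw [hd, ← h1]; linear_combination x.2.1 0 * p2 - x.2.1 2 * p0
  have e2 : a ^ 2 * ξ 2 = d * x.2.1 2 := by
    rw [hd, ← h1]; linear_combination x.2.1 1 * p0 - x.2.1 0 * p1
  have ha2 : a ^ 2 ≠ 0 := by positivity
  have hd0 : d = 0 := by
    have g0 : d * (x.2.1 1 * x.2.2 2 - x.2.1 2 * x.2.2 1) = 0 := by
      linear_combination (-a ^ 2) * q0 - x.2.2 2 * e1 + x.2.2 1 * e2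
    have g1 : d * (x.2.1 2 * x.2.2 0 - x.2.1 0 * x.2.2 2) = 0 := by
      linear_combination (-a ^ 2) * q1 - x.2.2 0 * e2 + x.2.2 2 * e0
    have g2 : d * (x.2.1 0 * x.2.2 1 - x.2.1 1 * x.2.2 0) = 0 := by
      linear_combination (-a ^ 2) * q2 - x.2.2 1 * e0 + x.2.2 0 * e1
    -- Lagrange's identity: |α × β|² = a²b² − (α·β)².
    have : a ^ 2 * b ^ 2 * d = 0 := by
      rw [← h1, ← h2]
      linear_combination (x.2.1 1 * x.2.2 2 - x.2.1 2 * x.2.2 1) * g0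
        + (x.2.1 2 * x.2.2 0 - x.2.1 0 * x.2.2 2) * g1
        + (x.2.1 0 * x.2.2 1 - x.2.1 1 * x.2.2 0) * g2
        + d * (x.2.1 0 * x.2.2 0 + x.2.1 1 * x.2.2 1 + x.2.1 2 * x.2.2 2) * h3
    exact (mul_eq_zero.mp this).resolve_left (by positivity)
  rw [hd0, zero_mul] at e0 e1 e2
  have k : ∀ {t : ℝ}, a ^ 2 * t = 0 → t = 0 := fun ht => (mul_eq_zero.mp ht).resolve_left ha2
  refine Prod.ext ?_ ?_ <;> funext i <;> fin_cases i
  · exact k e0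
  · exact k e1
  · exact k e2
  · exact (div_eq_zero_iff.mp m0).resolve_right (by norm_num)
  · exact (div_eq_zero_iff.mp m1).resolve_right (by norm_num)
  · exact m2

lemma finrank_tangent {a b : ℝ} (hb : 0 < b) (hab : b < a) {x : Phase}
    (hx : x ∈ phaseSpace a b) : Module.finrank ℝ (tangent x) = 6 := by
  obtain ⟨h1, h2, h3⟩ := phaseSpace_eqs hx
  have ha : 0 < a := hb.trans hab
  have hsurj : LinearMap.range (fderiv ℝ geom x).toLinearMap = ⊤ := by
    rw [LinearMap.range_eq_top]
    rintro ⟨p, q, r⟩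
    -- Because α ⟂ β, shifting α along α, α along β and β along β changes the three Casimir
    -- functions independently.
    refine ⟨(0, (p / (2 * a ^ 2)) • x.2.1 + (r / b ^ 2) • x.2.2, (q / (2 * b ^ 2)) • x.2.2), ?_⟩
    change fderiv ℝ geom x _ = _
    rw [fderiv_geom]
    simp only [dotProduct, Fin.sum_univ_three, Pi.add_apply, Pi.smul_apply, smul_eq_mul]
    refine Prod.ext ?_ (Prod.ext ?_ ?_) <;> dsimp only
    · field_simp
      linear_combination p * b ^ 2 * h1 + 2 * r * a ^ 2 * h3
    · field_simp
      linear_combination q * h2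
    · field_simp
      linear_combination (q * a ^ 2 + p * b ^ 2) * h3 + 2 * r * a ^ 2 * h2
  have := LinearMap.finrank_range_add_finrank_ker (fderiv ℝ geom x).toLinearMap
  rw [hsurj] at this
  simp only [finrank_top, Module.finrank_prod, Module.finrank_fin_fun, Module.finrank_self] at this
  change Module.finrank ℝ (LinearMap.ker (fderiv ℝ geom x).toLinearMap) = 6
  omega

lemma range_emb {a b : ℝ} (hb : 0 < b) (hab : b < a) {x : Phase} (hx : x ∈ phaseSpace a b) :
    LinearMap.range (emb x) = tangent x := by
  refine Submodule.eq_of_le_of_finrank_eq ?_ ?_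
  · rintro _ ⟨u, rfl⟩
    exact emb_mem_tangent x u
  · rw [finrank_tangent hb hab hx, LinearMap.finrank_range_of_inj (emb_injective hb hab hx)]
    simp

/-- The isomorphism of `ℝ³ × ℝ³` onto the tangent space given by `emb`. -/
def tangentEquiv {a b : ℝ} (hb : 0 < b) (hab : b < a) {x : Phase} (hx : x ∈ phaseSpace a b) :
    ((Fin 3 → ℝ) × (Fin 3 → ℝ)) ≃ₗ[ℝ] tangent x :=
  (LinearEquiv.ofInjective (emb x) (emb_injective hb hab hx)).trans
    (LinearEquiv.ofEq _ _ (range_emb hb hab hx))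

lemma coe_tangentEquiv {a b : ℝ} (hb : 0 < b) (hab : b < a) {x : Phase}
    (hx : x ∈ phaseSpace a b) (u : (Fin 3 → ℝ) × (Fin 3 → ℝ)) :
    (tangentEquiv hb hab hx u : Phase) = emb x u := rfl

/-! ### The Hamiltonian field in the trivialization -/

/-- The components `(F_M, Ṁ)` of the field `sgrad F` in the trivialization `emb`. -/
def reducedField (lam : ℝ) (F : Phase → ℝ) (x : Phase) : (Fin 3 → ℝ) × (Fin 3 → ℝ) :=
  (gradM F x, momentumDot lam F x)

/-- The linearization of `reducedField` along the tangent space to `𝒫⁶`. -/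
def reducedLin (lam : ℝ) (F : Phase → ℝ) (x : Phase) :
    ((Fin 3 → ℝ) × (Fin 3 → ℝ)) →ₗ[ℝ] ((Fin 3 → ℝ) × (Fin 3 → ℝ)) :=
  (fderiv ℝ (reducedField lam F) x).toLinearMap ∘ₗ emb x

lemma sgrad_eq_emb (lam : ℝ) (F : Phase → ℝ) (x : Phase) :
    sgrad lam F x = emb x (reducedField lam F x) := rfl

lemma contDiff_fderiv_apply {F : Phase → ℝ} (hF : ContDiff ℝ ∞ F) (v : Phase) :
    ContDiff ℝ ∞ (fun y => fderiv ℝ F y v) :=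
  (hF.fderiv_right (m := ∞) (by simp)).clm_apply contDiff_const

lemma contDiff_gradM {F : Phase → ℝ} (hF : ContDiff ℝ ∞ F) : ContDiff ℝ ∞ (gradM F) := by
  have h := contDiff_fderiv_apply hF
  rw [contDiff_pi]
  intro i
  fin_cases i
  · exact (h _).div_const 2
  · exact (h _).div_const 2
  · exact h _

lemma contDiff_gradα {F : Phase → ℝ} (hF : ContDiff ℝ ∞ F) : ContDiff ℝ ∞ (gradα F) :=
  contDiff_pi.2 fun _ => contDiff_fderiv_apply hF _

lemma contDiff_gradβ {F : Phase → ℝ} (hF : ContDiff ℝ ∞ F) : ContDiff ℝ ∞ (gradβ F) :=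
  contDiff_pi.2 fun _ => contDiff_fderiv_apply hF _

lemma momentumDot_eq (lam : ℝ) (F : Phase → ℝ) : momentumDot lam F = fun x =>
    ![2 * x.1 1 * gradM F x 2 - (x.1 2 + lam) * gradM F x 1
        + (x.2.1 1 * gradα F x 2 - x.2.1 2 * gradα F x 1)
        + (x.2.2 1 * gradβ F x 2 - x.2.2 2 * gradβ F x 1),
      (x.1 2 + lam) * gradM F x 0 - 2 * x.1 0 * gradM F x 2
        + (x.2.1 2 * gradα F x 0 - x.2.1 0 * gradα F x 2)
        + (x.2.2 2 * gradβ F x 0 - x.2.2 0 * gradβ F x 2),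
      2 * x.1 0 * gradM F x 1 - 2 * x.1 1 * gradM F x 0
        + (x.2.1 0 * gradα F x 1 - x.2.1 1 * gradα F x 0)
        + (x.2.2 0 * gradβ F x 1 - x.2.2 1 * gradβ F x 0)] := by
  funext x i
  fin_cases i <;> simp [momentumDot, momentum, cross_apply]

lemma contDiff_momentumDot (lam : ℝ) {F : Phase → ℝ} (hF : ContDiff ℝ ∞ F) :
    ContDiff ℝ ∞ (momentumDot lam F) := by
  have h1 : ∀ i, ContDiff ℝ ∞ (fun y => gradM F y i) := contDiff_pi.1 (contDiff_gradM hF)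
  have h2 : ∀ i, ContDiff ℝ ∞ (fun y => gradα F y i) := contDiff_pi.1 (contDiff_gradα hF)
  have h3 : ∀ i, ContDiff ℝ ∞ (fun y => gradβ F y i) := contDiff_pi.1 (contDiff_gradβ hF)
  rw [contDiff_pi, momentumDot_eq]
  intro i
  fin_cases i <;>
    simp only [Fin.zero_eta, Fin.mk_one, Fin.reduceFinMk, Matrix.cons_val_zero, Matrix.cons_val_one,
      Matrix.cons_val] <;>
    fun_prop

lemma contDiff_reducedField (lam : ℝ) {F : Phase → ℝ} (hF : ContDiff ℝ ∞ F) :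
    ContDiff ℝ ∞ (reducedField lam F) :=
  (contDiff_gradM hF).prodMk (contDiff_momentumDot lam hF)

lemma fderiv_pi_apply {f : Phase → Fin 3 → ℝ} {x : Phase} (hf : DifferentiableAt ℝ f x)
    (v : Phase) (i : Fin 3) : fderiv ℝ f x v i = fderiv ℝ (fun y => f y i) x v := by
  have h := (hasFDerivAt_pi'.1 hf.hasFDerivAt i).fderiv
  rw [h]; rfl

lemma fderiv_reducedField (lam : ℝ) {F : Phase → ℝ} (hF : ContDiff ℝ ∞ F) (x v : Phase) :
    fderiv ℝ (reducedField lam F) x v =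
      (fderiv ℝ (gradM F) x v, fderiv ℝ (momentumDot lam F) x v) := by
  have h1 := (contDiff_gradM hF).differentiable (by simp) x
  have h2 := (contDiff_momentumDot lam hF).differentiable (by simp) x
  have e : fderiv ℝ (reducedField lam F) x = _ := (h1.hasFDerivAt.prodMk h2.hasFDerivAt).fderiv
  rw [e]; rfl

lemma differentiable_emb :
    Differentiable ℝ (fun p : Phase × ((Fin 3 → ℝ) × (Fin 3 → ℝ)) => emb p.1 p.2) := by
  have : (fun p : Phase × ((Fin 3 → ℝ) × (Fin 3 → ℝ)) => emb p.1 p.2) = fun p =>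
      (![p.2.2 0 / 2, p.2.2 1 / 2, p.2.2 2],
        ![p.1.2.1 1 * p.2.1 2 - p.1.2.1 2 * p.2.1 1, p.1.2.1 2 * p.2.1 0 - p.1.2.1 0 * p.2.1 2,
          p.1.2.1 0 * p.2.1 1 - p.1.2.1 1 * p.2.1 0],
        ![p.1.2.2 1 * p.2.1 2 - p.1.2.2 2 * p.2.1 1, p.1.2.2 2 * p.2.1 0 - p.1.2.2 0 * p.2.1 2,
          p.1.2.2 0 * p.2.1 1 - p.1.2.2 1 * p.2.1 0]) := by
    funext p
    simp [emb_apply, cross_apply]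
  rw [this]
  refine Differentiable.prodMk ?_ (Differentiable.prodMk ?_ ?_) <;>
    rw [differentiable_pi] <;> intro i <;> fin_cases i <;>
    simp only [Fin.zero_eta, Fin.mk_one, Fin.reduceFinMk, Matrix.cons_val_zero, Matrix.cons_val_one,
      Matrix.cons_val] <;>
    fun_prop

/-- At a zero of the Hamiltonian field its linearization is that of `reducedField`. -/
lemma linField_apply {lam : ℝ} {F : Phase → ℝ} (hF : ContDiff ℝ ∞ F) {x : Phase}
    (h0 : reducedField lam F x = 0) (v : Phase) :
    linField lam F x v = emb x (fderiv ℝ (reducedField lam F) x v) := by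
  have h1 := ((contDiff_reducedField lam hF).differentiable (by simp) x).hasFDerivAt
  have hg := (differentiable_emb (x, reducedField lam F x)).hasFDerivAt
  set g' := fderiv ℝ (fun p : Phase × ((Fin 3 → ℝ) × (Fin 3 → ℝ)) => emb p.1 p.2)
    (x, reducedField lam F x) with hg'
  have hp : HasFDerivAt (fun y => (y, reducedField lam F y))
      ((ContinuousLinearMap.id ℝ Phase).prod (fderiv ℝ (reducedField lam F) x)) x :=
    (hasFDerivAt_id x).prodMk h1
  have hc : HasFDerivAt (sgrad lam F)
      (g'.comp ((ContinuousLinearMap.id ℝ Phase).prod (fderiv ℝ (reducedField lam F) x))) x :=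
    HasFDerivAt.comp (f := fun y => (y, reducedField lam F y)) x hg hp
  -- `emb` is linear in its second argument, which is zero at x, so moving the base point
  -- contributes nothing.
  have k1 : ∀ w, g' (w, 0) = 0 := by
    intro w
    have hp : HasFDerivAt (fun y : Phase => (y, reducedField lam F x))
        ((ContinuousLinearMap.id ℝ Phase).prod 0) x :=
      (hasFDerivAt_id x).prodMk (hasFDerivAt_const _ x)
    have hl : HasFDerivAt (fun y : Phase => emb y (reducedField lam F x))
        (g'.comp ((ContinuousLinearMap.id ℝ Phase).prod 0)) x :=
      HasFDerivAt.comp (f := fun y => (y, reducedField lam F x)) x hg hp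
    have : (fun y : Phase => emb y (reducedField lam F x)) = fun _ => 0 := by
      funext y; rw [h0, map_zero]
    rw [this] at hl
    have e := hl.unique (hasFDerivAt_const (0 : Phase) x)
    exact congrArg (fun f => f w) e
  have k2 : ∀ w, g' (0, w) = emb x w := by
    intro w
    have hp : HasFDerivAt (fun u : (Fin 3 → ℝ) × (Fin 3 → ℝ) => (x, u))
        ((0 : ((Fin 3 → ℝ) × (Fin 3 → ℝ)) →L[ℝ] Phase).prod (ContinuousLinearMap.id ℝ _))
        (reducedField lam F x) :=
      (hasFDerivAt_const x _).prodMk (hasFDerivAt_id _)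
    have hl : HasFDerivAt (fun u => emb x u) (g'.comp
        ((0 : ((Fin 3 → ℝ) × (Fin 3 → ℝ)) →L[ℝ] Phase).prod (ContinuousLinearMap.id ℝ _)))
        (reducedField lam F x) :=
      HasFDerivAt.comp (f := fun u => (x, u)) (reducedField lam F x) hg hp
    have e := hl.unique ((LinearMap.toContinuousLinearMap (emb x)).hasFDerivAt)
    exact congrArg (fun f => f w) e
  have e : linField lam F x v = g' (v, fderiv ℝ (reducedField lam F) x v) := by
    change fderiv ℝ (sgrad lam F) x v = _
    rw [hc.fderiv]; rfl
  have hs : (v, fderiv ℝ (reducedField lam F) x v) =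
      (v, 0) + (0, fderiv ℝ (reducedField lam F) x v) := by simp
  rw [e, ← k2, hs, map_add, k1, zero_add]

lemma linField_mem_tangent {lam : ℝ} {F : Phase → ℝ} (hF : ContDiff ℝ ∞ F) {x : Phase}
    (h0 : reducedField lam F x = 0) (v : Phase) : linField lam F x v ∈ tangent x := by
  rw [linField_apply hF h0]
  exact emb_mem_tangent _ _

/-- The right side is the symplectic form of (F_M, Ṁ) and u: this is dF = ω(sgrad F, ·) before ω is
named. -/
lemma gradM_dotProduct_emb (F : Phase → ℝ) (lam : ℝ) (x : Phase)
    (u : (Fin 3 → ℝ) × (Fin 3 → ℝ)) :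
    fderiv ℝ F x (emb x u) = gradM F x ⬝ᵥ u.2 - momentumDot lam F x ⬝ᵥ u.1
      + momentum lam x ⬝ᵥ (gradM F x ⨯₃ u.1) := by
  rw [fderiv_eq_grad, momentumDot_eq]
  simp only [emb_apply, momentum, cross_apply, dotProduct, Fin.sum_univ_three, Matrix.cons_val_zero,
    Matrix.cons_val_one, Matrix.cons_val]
  ring

lemma criticalAt_of_reducedField_eq_zero {a b lam : ℝ} (hb : 0 < b) (hab : b < a)
    {F : Phase → ℝ} {x : Phase} (hx : x ∈ phaseSpace a b) (h0 : reducedField lam F x = 0) :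
    CriticalAt F x := by
  intro v hv
  rw [← range_emb hb hab hx] at hv
  obtain ⟨u, rfl⟩ := hv
  have e1 : gradM F x = 0 := congrArg Prod.fst h0
  have e2 : momentumDot lam F x = 0 := congrArg Prod.snd h0
  rw [gradM_dotProduct_emb F lam, e1, e2]
  simp

/-- Conjugation by `tangentEquiv` moves the operator from the tangent space, which varies with x, to
the fixed space ℝ³ × ℝ³. -/
lemma hasExponentSq_iff {a b lam : ℝ} (hb : 0 < b) (hab : b < a)
    {F : Phase → ℝ} (hF : ContDiff ℝ ∞ F) {x : Phase} (hx : x ∈ phaseSpace a b)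
    (h0 : reducedField lam F x = 0) (C : ℝ) :
    HasExponentSq lam F x C ↔ (reducedLin lam F x).charpoly =
      Polynomial.X ^ 4 * (Polynomial.X ^ 2 - Polynomial.C C) := by
  have key : ∀ hA : ∀ v ∈ tangent x, linField lam F x v ∈ tangent x,
      ((linField lam F x).restrict hA).charpoly = (reducedLin lam F x).charpoly := by
    intro hA
    rw [← LinearEquiv.charpoly_conj (tangentEquiv hb hab hx) (reducedLin lam F x)]
    congr 1
    ext1 v
    obtain ⟨u, rfl⟩ := (tangentEquiv hb hab hx).surjective v
    apply Subtype.ext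
    rw [LinearEquiv.conj_apply_apply, LinearEquiv.symm_apply_apply, coe_tangentEquiv,
      LinearMap.coe_restrict_apply, coe_tangentEquiv, linField_apply hF h0]
    rfl
  constructor
  · rintro ⟨-, hA, h⟩
    rw [← key hA, h]
  · intro h
    exact ⟨criticalAt_of_reducedField_eq_zero hb hab hx h0,
      fun v _ => linField_mem_tangent hF h0 v, (key _).trans h⟩

/-! ### The symplectic form -/

/-- The symplectic form on the tangent space, in the trivialization `emb`. -/
def symp (M : Fin 3 → ℝ) :
    LinearMap.BilinForm ℝ ((Fin 3 → ℝ) × (Fin 3 → ℝ)) :=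
  LinearMap.mk₂ ℝ (fun u v => u.1 ⬝ᵥ v.2 - u.2 ⬝ᵥ v.1 + M ⬝ᵥ (u.1 ⨯₃ v.1))
    (fun u u' v => by
      simp only [Prod.fst_add, Prod.snd_add, add_dotProduct, map_add, LinearMap.add_apply,
        dotProduct_add]; ring)
    (fun c u v => by
      simp only [Prod.smul_fst, Prod.smul_snd, smul_dotProduct, map_smul, LinearMap.smul_apply,
        dotProduct_smul, smul_eq_mul]; ring)
    (fun u v v' => by
      simp only [Prod.fst_add, Prod.snd_add, map_add, dotProduct_add]; ring)
    (fun c u v => by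
      simp only [Prod.smul_fst, Prod.smul_snd, map_smul, dotProduct_smul, smul_eq_mul]; ring)

lemma symp_apply (M : Fin 3 → ℝ) (u v : (Fin 3 → ℝ) × (Fin 3 → ℝ)) :
    symp M u v = u.1 ⬝ᵥ v.2 - u.2 ⬝ᵥ v.1 + M ⬝ᵥ (u.1 ⨯₃ v.1) := rfl

lemma symp_swap (M : Fin 3 → ℝ) (u v : (Fin 3 → ℝ) × (Fin 3 → ℝ)) :
    symp M u v = - symp M v u := by
  simp only [symp_apply, cross_apply, dotProduct, Fin.sum_univ_three, Matrix.cons_val_zero,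
    Matrix.cons_val_one, Matrix.cons_val]
  ring

lemma symp_nondegenerate (M : Fin 3 → ℝ) {u : (Fin 3 → ℝ) × (Fin 3 → ℝ)}
    (h : ∀ v, symp M u v = 0) : u = 0 := by
  have h1 : u.1 = 0 := by
    apply dotProduct_eq_zero
    intro w
    simpa [symp_apply] using h (0, w)
  have h2 : u.2 = 0 := by
    apply dotProduct_eq_zero
    intro w
    simpa [symp_apply, h1] using h (w, 0)
  exact Prod.ext h1 h2

lemma symp_reducedField (F : Phase → ℝ) (lam : ℝ) (x : Phase)
    (u : (Fin 3 → ℝ) × (Fin 3 → ℝ)) :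
    symp (momentum lam x) (reducedField lam F x) u = fderiv ℝ F x (emb x u) :=
  (gradM_dotProduct_emb F lam x u).symm

lemma fderiv_fderiv_eq {F : Phase → ℝ} (hF : ContDiff ℝ ∞ F) (x u v : Phase) :
    fderiv ℝ (fderiv ℝ F) x u v =
      fderiv ℝ (gradM F) x u ⬝ᵥ ![2 * v.1 0, 2 * v.1 1, v.1 2]
        + fderiv ℝ (gradα F) x u ⬝ᵥ v.2.1 + fderiv ℝ (gradβ F) x u ⬝ᵥ v.2.2 := by
  have h1 := (contDiff_gradM hF).differentiable (by simp) x
  have h2 := (contDiff_gradα hF).differentiable (by simp) x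
  have h3 := (contDiff_gradβ hF).differentiable (by simp) x
  have h1' : ∀ i, DifferentiableAt ℝ (fun y => gradM F y i) x := differentiableAt_pi.1 h1
  have h2' : ∀ i, DifferentiableAt ℝ (fun y => gradα F y i) x := differentiableAt_pi.1 h2
  have h3' : ∀ i, DifferentiableAt ℝ (fun y => gradβ F y i) x := differentiableAt_pi.1 h3
  have h4 : DifferentiableAt ℝ (fderiv ℝ F) x :=
    (hF.fderiv_right (m := ∞) (by simp)).differentiable (by simp) x
  have e1 : fderiv ℝ (fun y => fderiv ℝ F y v) x u = fderiv ℝ (fderiv ℝ F) x u v := by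
    rw [fderiv_clm_apply h4 (by fun_prop)]
    simp
  rw [← e1]
  have e2 : (fun y => fderiv ℝ F y v) = fun y => gradM F y 0 * (2 * v.1 0)
      + gradM F y 1 * (2 * v.1 1) + gradM F y 2 * v.1 2
      + (gradα F y 0 * v.2.1 0 + gradα F y 1 * v.2.1 1 + gradα F y 2 * v.2.1 2)
      + (gradβ F y 0 * v.2.2 0 + gradβ F y 1 * v.2.2 1 + gradβ F y 2 * v.2.2 2) := by
    funext y
    rw [fderiv_eq_grad]
    simp only [dotProduct, Fin.sum_univ_three, Matrix.cons_val_zero, Matrix.cons_val_one,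
      Matrix.cons_val]
  rw [e2]
  simp (disch := fun_prop) only [fderiv_fun_add, fderiv_fun_mul, fderiv_fun_const, add_apply,
    smul_apply, zero_apply, Pi.zero_apply, smul_eq_mul, dotProduct, Fin.sum_univ_three,
    fderiv_pi_apply h1, fderiv_pi_apply h2, fderiv_pi_apply h3, Matrix.cons_val_zero,
    Matrix.cons_val_one, Matrix.cons_val]
  ring

lemma fderiv_fderiv_symm {F : Phase → ℝ} (hF : ContDiff ℝ ∞ F) (x u v : Phase) :
    fderiv ℝ (fderiv ℝ F) x u v = fderiv ℝ (fderiv ℝ F) x v u :=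
  (hF.contDiffAt.isSymmSndFDerivAt (by
    rw [minSmoothness_of_isRCLikeNormedField]; exact WithTop.coe_le_coe.2 le_top)) u v

lemma fderiv_momentumDot (lam : ℝ) {F : Phase → ℝ} (hF : ContDiff ℝ ∞ F) (x v : Phase) :
    fderiv ℝ (momentumDot lam F) x v =
      ![2 * v.1 0, 2 * v.1 1, v.1 2] ⨯₃ gradM F x + momentum lam x ⨯₃ fderiv ℝ (gradM F) x v
      + v.2.1 ⨯₃ gradα F x + x.2.1 ⨯₃ fderiv ℝ (gradα F) x v
      + v.2.2 ⨯₃ gradβ F x + x.2.2 ⨯₃ fderiv ℝ (gradβ F) x v := by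
  have h1 := (contDiff_gradM hF).differentiable (by simp) x
  have h2 := (contDiff_gradα hF).differentiable (by simp) x
  have h3 := (contDiff_gradβ hF).differentiable (by simp) x
  have h1' : ∀ i, DifferentiableAt ℝ (fun y => gradM F y i) x := differentiableAt_pi.1 h1
  have h2' : ∀ i, DifferentiableAt ℝ (fun y => gradα F y i) x := differentiableAt_pi.1 h2
  have h3' : ∀ i, DifferentiableAt ℝ (fun y => gradβ F y i) x := differentiableAt_pi.1 h3
  have h4 := (contDiff_momentumDot lam hF).differentiable (by simp) x
  funext i
  rw [fderiv_pi_apply h4, momentumDot_eq]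
  fin_cases i <;>
  · simp only [Fin.zero_eta, Fin.mk_one, Fin.reduceFinMk, Matrix.cons_val_zero, Matrix.cons_val_one,
      Matrix.cons_val]
    simp (disch := fun_prop) only [fderiv_fun_add, fderiv_fun_sub, fderiv_fun_mul,
      fderiv_fun_const, add_apply, sub_apply, smul_apply, zero_apply, Pi.zero_apply, smul_eq_mul,
      fderiv_omega, fderiv_alpha, fderiv_beta, Pi.add_apply, cross_apply, momentum,
      fderiv_pi_apply h1, fderiv_pi_apply h2, fderiv_pi_apply h3, Matrix.cons_val_zero,
      Matrix.cons_val_one, Matrix.cons_val]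
    ring

/-- The linearization of a Hamiltonian field at its zero is skew with respect to `symp`. -/
lemma symp_reducedLin {lam : ℝ} {F : Phase → ℝ} (hF : ContDiff ℝ ∞ F) {x : Phase}
    (h0 : reducedField lam F x = 0) (u v : (Fin 3 → ℝ) × (Fin 3 → ℝ)) :
    symp (momentum lam x) (reducedLin lam F x u) v =
      - symp (momentum lam x) u (reducedLin lam F x v) := by
  rw [symp_swap _ u, neg_neg]
  have e1 : gradM F x = 0 := congrArg Prod.fst h0
  have e2 : momentumDot lam F x = 0 := congrArg Prod.snd h0
  -- The bilinear form of the linearization is the Hessian of F on tangent vectors minus a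
  -- correction, due to `emb` depending on the base point.
  have e : ∀ u v, symp (momentum lam x) (reducedLin lam F x u) v =
      fderiv ℝ (fderiv ℝ F) x (emb x u) (emb x v)
        - v.1 ⬝ᵥ ((x.2.1 ⨯₃ u.1) ⨯₃ gradα F x + (x.2.2 ⨯₃ u.1) ⨯₃ gradβ F x) := by
    intro u v
    have : reducedLin lam F x u = fderiv ℝ (reducedField lam F) x (emb x u) := rfl
    rw [this, fderiv_reducedField lam hF, symp_apply, fderiv_fderiv_eq hF,
      fderiv_momentumDot lam hF, e1]
    generalize fderiv ℝ (gradM F) x (emb x u) = p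
    generalize fderiv ℝ (gradα F) x (emb x u) = q
    generalize fderiv ℝ (gradβ F) x (emb x u) = r
    simp only [emb_apply, momentum, cross_apply, dotProduct, Fin.sum_univ_three, Pi.add_apply,
      Pi.zero_apply, Matrix.cons_val_zero, Matrix.cons_val_one, Matrix.cons_val]
    ring
  rw [e, e, fderiv_fderiv_symm hF x (emb x u)]
  have n0 := congrFun e2 0
  have n1 := congrFun e2 1
  have n2 := congrFun e2 2
  simp only [momentumDot, e1, cross_apply, Pi.add_apply, Pi.zero_apply, Matrix.cons_val_zero,
    Matrix.cons_val_one, Matrix.cons_val] at n0 n1 n2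
  simp only [cross_apply, dotProduct, Fin.sum_univ_three, Pi.add_apply, Matrix.cons_val_zero,
    Matrix.cons_val_one, Matrix.cons_val]
  -- The Hessian part is symmetric. The antisymmetric part of the correction is, up to sign, the
  -- pairing of u.1 × v.1 with Ṁ, which vanishes at x.
  linear_combination (u.1 2 * v.1 1 - u.1 1 * v.1 2) * n0
    + (u.1 0 * v.1 2 - u.1 2 * v.1 0) * n1 + (u.1 1 * v.1 0 - u.1 0 * v.1 1) * n2

/-! ### Involution of the integrals -/

lemma gradM_intH (y : Phase) : gradM intH y = ![y.1 0, y.1 1, y.1 2] := by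
  funext i
  fin_cases i <;> simp [gradM, gradω, fderiv_intH]

lemma gradα_intH (y : Phase) : gradα intH y = ![-1, 0, 0] := by
  funext i
  fin_cases i <;> simp [gradα, fderiv_intH]

lemma gradβ_intH (y : Phase) : gradβ intH y = ![0, -1, 0] := by
  funext i
  fin_cases i <;> simp [gradβ, fderiv_intH]

lemma gradM_intK (lam : ℝ) (y : Phase) : gradM (intK lam) y =
    ![2 * (y.1 0 ^ 2 - y.1 1 ^ 2 + y.2.1 0 - y.2.2 1) * y.1 0
        + 2 * (2 * y.1 0 * y.1 1 + y.2.1 1 + y.2.2 0) * y.1 1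
        + 2 * lam * ((y.1 2 - lam) * y.1 0 + y.2.1 2),
      -2 * (y.1 0 ^ 2 - y.1 1 ^ 2 + y.2.1 0 - y.2.2 1) * y.1 1
        + 2 * (2 * y.1 0 * y.1 1 + y.2.1 1 + y.2.2 0) * y.1 0
        + 2 * lam * ((y.1 2 - lam) * y.1 1 + y.2.2 2),
      2 * lam * (y.1 0 ^ 2 + y.1 1 ^ 2)] := by
  funext i
  fin_cases i <;> simp [gradM, gradω, fderiv_intK] <;> ring

lemma gradα_intK (lam : ℝ) (y : Phase) : gradα (intK lam) y =
    ![2 * (y.1 0 ^ 2 - y.1 1 ^ 2 + y.2.1 0 - y.2.2 1),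
      2 * (2 * y.1 0 * y.1 1 + y.2.1 1 + y.2.2 0), 4 * lam * y.1 0] := by
  funext i
  fin_cases i <;> simp [gradα, fderiv_intK] <;> ring

lemma gradβ_intK (lam : ℝ) (y : Phase) : gradβ (intK lam) y =
    ![2 * (2 * y.1 0 * y.1 1 + y.2.1 1 + y.2.2 0),
      -2 * (y.1 0 ^ 2 - y.1 1 ^ 2 + y.2.1 0 - y.2.2 1), 4 * lam * y.1 1] := by
  funext i
  fin_cases i <;> simp [gradβ, fderiv_intK] <;> ring

lemma gradM_intG (a b lam : ℝ) (y : Phase) : gradM (intG a b lam) y =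
    ((1 / 2) * (momentum lam y ⬝ᵥ y.2.1)) • y.2.1 + ((1 / 2) * (momentum lam y ⬝ᵥ y.2.2)) • y.2.2
      + ((1 / 2) * (momentum lam y ⬝ᵥ (y.2.1 ⨯₃ y.2.2))) • ![0, 0, 1]
      + ((1 / 2) * (y.1 2 - lam)) • (y.2.1 ⨯₃ y.2.2) := by
  funext i
  fin_cases i <;> simp [gradM, gradω, fderiv_intG, momentum, dotProduct, Fin.sum_univ_three,
    cross_apply, Matrix.vecHead, Matrix.vecTail] <;> ring

lemma gradα_intG (a b lam : ℝ) (y : Phase) : gradα (intG a b lam) y =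
    ((1 / 2) * (momentum lam y ⬝ᵥ y.2.1)) • momentum lam y
      + ((1 / 2) * (y.1 2 - lam)) • (y.2.2 ⨯₃ momentum lam y) - b ^ 2 • ![1, 0, 0] := by
  funext i
  fin_cases i <;> simp [gradα, fderiv_intG, momentum, dotProduct, Fin.sum_univ_three,
    cross_apply] <;> ring

lemma gradβ_intG (a b lam : ℝ) (y : Phase) : gradβ (intG a b lam) y =
    ((1 / 2) * (momentum lam y ⬝ᵥ y.2.2)) • momentum lam y
      + ((1 / 2) * (y.1 2 - lam)) • (momentum lam y ⨯₃ y.2.1) - a ^ 2 • ![0, 1, 0] := by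
  funext i
  fin_cases i <;> simp [gradβ, fderiv_intG, momentum, dotProduct, Fin.sum_univ_three,
    cross_apply] <;> ring

lemma gradM_combo (a b lam : ℝ) (c : Fin 3 → ℝ) (y : Phase) : gradM (combo a b lam c) y =
    c 0 • gradM intH y + c 1 • gradM (intK lam) y + c 2 • gradM (intG a b lam) y := by
  funext i
  fin_cases i <;> simp [gradM, gradω, fderiv_combo] <;> ring

lemma gradα_combo (a b lam : ℝ) (c : Fin 3 → ℝ) (y : Phase) : gradα (combo a b lam c) y =
    c 0 • gradα intH y + c 1 • gradα (intK lam) y + c 2 • gradα (intG a b lam) y := by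
  funext i
  simp [gradα, fderiv_combo]

lemma gradβ_combo (a b lam : ℝ) (c : Fin 3 → ℝ) (y : Phase) : gradβ (combo a b lam c) y =
    c 0 • gradβ intH y + c 1 • gradβ (intK lam) y + c 2 • gradβ (intG a b lam) y := by
  funext i
  simp [gradβ, fderiv_combo]

lemma reducedField_combo (a b lam : ℝ) (c : Fin 3 → ℝ) (y : Phase) :
    reducedField lam (combo a b lam c) y = c 0 • reducedField lam intH y
      + c 1 • reducedField lam (intK lam) y + c 2 • reducedField lam (intG a b lam) y := by
  refine Prod.ext (gradM_combo ..) ?_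
  simp only [reducedField, momentumDot, gradM_combo, gradα_combo, gradβ_combo, map_add, map_smul,
    Prod.snd_add, Prod.smul_snd, smul_add]
  abel

/-- The Poisson bracket. -/
def bracket (lam : ℝ) (F₁ F₂ : Phase → ℝ) (y : Phase) : ℝ := fderiv ℝ F₁ y (sgrad lam F₂ y)

lemma bracket_eq_symp (lam : ℝ) (F₁ F₂ : Phase → ℝ) (y : Phase) : bracket lam F₁ F₂ y =
    symp (momentum lam y) (reducedField lam F₁ y) (reducedField lam F₂ y) := by
  rw [symp_reducedField, bracket, sgrad_eq_emb]

lemma bracket_swap (lam : ℝ) (F₁ F₂ : Phase → ℝ) (y : Phase) :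
    bracket lam F₁ F₂ y = - bracket lam F₂ F₁ y := by
  rw [bracket_eq_symp, symp_swap, bracket_eq_symp]

lemma bracket_combo (a b lam : ℝ) (F : Phase → ℝ) (c : Fin 3 → ℝ) (y : Phase) :
    bracket lam F (combo a b lam c) y = c 0 * bracket lam F intH y
      + c 1 * bracket lam F (intK lam) y + c 2 * bracket lam F (intG a b lam) y := by
  simp only [bracket_eq_symp, reducedField_combo, map_add, map_smul, smul_eq_mul]

lemma bracket_explicit (lam : ℝ) (F₁ F₂ : Phase → ℝ) (y : Phase) : bracket lam F₁ F₂ y =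
    gradM F₁ y ⬝ᵥ momentumDot lam F₂ y + gradα F₁ y ⬝ᵥ (y.2.1 ⨯₃ gradM F₂ y)
      + gradβ F₁ y ⬝ᵥ (y.2.2 ⨯₃ gradM F₂ y) := by
  rw [bracket, fderiv_eq_grad]
  simp only [sgrad, dotProduct, Fin.sum_univ_three, Matrix.cons_val_zero, Matrix.cons_val_one,
    Matrix.cons_val]
  ring

lemma bracket_intH_intK (lam : ℝ) (y : Phase) : bracket lam intH (intK lam) y = 0 := by
  rw [bracket_explicit]
  simp only [momentumDot, gradM_intH, gradα_intH, gradβ_intH, gradM_intK, gradα_intK, gradβ_intK,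
    momentum, cross_apply, dotProduct, Fin.sum_univ_three, Pi.add_apply, Matrix.cons_val_zero,
    Matrix.cons_val_one, Matrix.cons_val]
  ring

-- G is an integral only on 𝒫⁶. Replacing −b²α₁ − a²β₂ by −(β·β)α₁ − (α·α)β₂ + (α·β)(α₂ + β₁) would
-- give a function commuting with H on all of ℝ⁹; the right side is the bracket of H with the
-- difference. The bracket of K with G has the same form, so `fderiv_linField_eq_zero` treats both
-- at once.
set_option maxHeartbeats 1000000 in
lemma bracket_intH_intG (a b lam : ℝ) (y : Phase) : bracket lam intH (intG a b lam) y =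
    (b ^ 2 - y.2.2 ⬝ᵥ y.2.2) * (y.2.1 ⨯₃ gradM intH y) 0
      + (a ^ 2 - y.2.1 ⬝ᵥ y.2.1) * (y.2.2 ⨯₃ gradM intH y) 1
      + (y.2.1 ⬝ᵥ y.2.2) * ((y.2.1 ⨯₃ gradM intH y) 1 + (y.2.2 ⨯₃ gradM intH y) 0) := by
  rw [bracket_explicit]
  simp only [momentumDot, gradM_intH, gradα_intH, gradβ_intH, gradM_intG, gradα_intG, gradβ_intG,
    momentum, cross_apply, dotProduct, Fin.sum_univ_three, Pi.add_apply, Pi.sub_apply,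
    Pi.smul_apply, smul_eq_mul, Matrix.cons_val_zero, Matrix.cons_val_one, Matrix.cons_val]
  ring

set_option maxHeartbeats 4000000 in
lemma bracket_intK_intG (a b lam : ℝ) (y : Phase) : bracket lam (intK lam) (intG a b lam) y =
    (b ^ 2 - y.2.2 ⬝ᵥ y.2.2) * (y.2.1 ⨯₃ gradM (intK lam) y) 0
      + (a ^ 2 - y.2.1 ⬝ᵥ y.2.1) * (y.2.2 ⨯₃ gradM (intK lam) y) 1
      + (y.2.1 ⬝ᵥ y.2.2) * ((y.2.1 ⨯₃ gradM (intK lam) y) 1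
        + (y.2.2 ⨯₃ gradM (intK lam) y) 0) := by
  rw [bracket_explicit]
  simp only [momentumDot, gradM_intK, gradα_intK, gradβ_intK, gradM_intG, gradα_intG, gradβ_intG,
    momentum, cross_apply, dotProduct, Fin.sum_univ_three, Pi.add_apply, Pi.sub_apply,
    Pi.smul_apply, smul_eq_mul, Matrix.cons_val_zero, Matrix.cons_val_one, Matrix.cons_val]
  ring

/-! ### Linear algebra of Hamiltonian operators -/

section LinearAlgebra

open Polynomial Module

variable {V W : Type*} [AddCommGroup V] [Module ℝ V] [FiniteDimensional ℝ V]
  [AddCommGroup W] [Module ℝ W] [FiniteDimensional ℝ W]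

/-- Sylvester's identity: fg and gf have the same characteristic polynomial up to a power of X. -/
lemma charpoly_comp_comm (f : V →ₗ[ℝ] W) (g : W →ₗ[ℝ] V) :
    (X : ℝ[X]) ^ finrank ℝ W * (g ∘ₗ f).charpoly = X ^ finrank ℝ V * (f ∘ₗ g).charpoly := by
  have bV := finBasis ℝ V
  have bW := finBasis ℝ W
  rw [← LinearMap.charpoly_toMatrix (g ∘ₗ f) bV, ← LinearMap.charpoly_toMatrix (f ∘ₗ g) bW,
    LinearMap.toMatrix_comp bV bW bV, LinearMap.toMatrix_comp bW bV bW]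
  simpa using Matrix.charpoly_mul_comm' (LinearMap.toMatrix bW bV g) (LinearMap.toMatrix bV bW f)

/-- For a traceless 2 × 2 matrix, tr M² = −2 det M. -/
lemma charpoly_of_finrank_eq_two (h : finrank ℝ V = 2) (f : V →ₗ[ℝ] V)
    (h0 : LinearMap.trace ℝ V f = 0) :
    f.charpoly = X ^ 2 - C (LinearMap.trace ℝ V (f ∘ₗ f) / 2) := by
  have b := finBasisOfFinrankEq ℝ V h
  rw [LinearMap.trace_eq_matrix_trace ℝ b] at h0 ⊢
  rw [← LinearMap.charpoly_toMatrix f b, Matrix.charpoly_fin_two, h0,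
    LinearMap.toMatrix_comp b b b]
  set M := LinearMap.toMatrix b b f
  have e : (M * M).trace / 2 = - M.det := by
    rw [Matrix.trace_fin_two] at h0
    rw [Matrix.trace_fin_two, Matrix.det_fin_two, Matrix.mul_apply, Matrix.mul_apply,
      Fin.sum_univ_two, Fin.sum_univ_two]
    linear_combination (M 0 0 + M 1 1) / 2 * h0
  rw [e]
  simp

/-- A Hamiltonian operator on a six-dimensional symplectic space that vanishes on a
two-dimensional isotropic subspace has at most one pair of non-zero eigenvalues. -/
lemma charpoly_of_isotropic_kernel (hV : finrank ℝ V = 6) {B : LinearMap.BilinForm ℝ V}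
    (hB : B.Nondegenerate) {A : V →ₗ[ℝ] V}
    (hA : ∀ u v, B (A u) v = - B u (A v)) {P : Submodule ℝ V} (hP : finrank ℝ P = 2)
    (hPP : P ≤ B.orthogonal P) (hAP : ∀ w ∈ P, A w = 0) :
    A.charpoly = X ^ 4 * (X ^ 2 - C (LinearMap.trace ℝ V (A ∘ₗ A) / 2)) := by
  set U := B.orthogonal P with hU
  have hUdim : finrank ℝ U = 4 := by
    rw [hU, LinearMap.BilinForm.finrank_orthogonal hB, hV, hP]
  -- The form conjugates A to minus its transpose, hence tr A = −tr A.
  have htr : LinearMap.trace ℝ V A = 0 := by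
    have e : (B.toDual hB).conj A = (-1 : ℝ) • Module.Dual.transpose (R := ℝ) A := by
      ext f v
      obtain ⟨u, rfl⟩ := (B.toDual hB).surjective f
      rw [LinearEquiv.conj_apply_apply, LinearEquiv.symm_apply_apply]
      change B (A u) v = (-1 : ℝ) * B u (A v)
      rw [hA, neg_one_mul]
    have e2 := LinearMap.trace_conj' A (B.toDual hB)
    rw [e, map_smul, LinearMap.trace_transpose', smul_eq_mul] at e2
    linarith
  have hmem : ∀ v, A v ∈ U := by
    intro v
    rw [hU, LinearMap.BilinForm.mem_orthogonal_iff]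
    intro w hw
    have := hA w v
    rw [hAP w hw, map_zero, LinearMap.zero_apply] at this
    change B w (A v) = 0
    linarith
  set g : V →ₗ[ℝ] U := A.codRestrict U hmem with hg
  -- A factors through U, and its restriction to U factors through U/Q. Swapping the two factors
  -- each time leaves an operator D on the plane U/Q, with the same traces of itself and of its
  -- square; each swap removes X² from the characteristic polynomial.
  have hA1 : A = U.subtype ∘ₗ g := by ext v; rfl
  set Q : Submodule ℝ U := P.comap U.subtype with hQ
  have hQdim : finrank ℝ Q = 2 := by
    rw [← hP]; exact (Submodule.comapSubtypeEquivOfLe hPP).finrank_eq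
  have hker : Q ≤ LinearMap.ker (g ∘ₗ U.subtype) := by
    intro w hw
    rw [LinearMap.mem_ker]
    exact Subtype.ext (hAP w hw)
  set k : (U ⧸ Q) →ₗ[ℝ] U := Q.liftQ (g ∘ₗ U.subtype) hker with hk
  have hA2 : g ∘ₗ U.subtype = k ∘ₗ Q.mkQ := by
    rw [hk, Submodule.liftQ_mkQ]
  set D := Q.mkQ ∘ₗ k with hD
  have hdim : finrank ℝ (U ⧸ Q) = 2 := by
    rw [Submodule.finrank_quotient, hUdim, hQdim]
  have t1 : LinearMap.trace ℝ _ D = 0 := by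
    rw [hD, LinearMap.trace_comp_comm', ← hA2, LinearMap.trace_comp_comm', ← hA1, htr]
  have t2 : LinearMap.trace ℝ _ (D ∘ₗ D) = LinearMap.trace ℝ V (A ∘ₗ A) := by
    have e1 : D ∘ₗ D = Q.mkQ ∘ₗ (k ∘ₗ Q.mkQ ∘ₗ k) := by rw [hD]; rfl
    rw [e1, LinearMap.trace_comp_comm']
    have e2 : (k ∘ₗ Q.mkQ ∘ₗ k) ∘ₗ Q.mkQ = (k ∘ₗ Q.mkQ) ∘ₗ (k ∘ₗ Q.mkQ) := rfl
    rw [e2, ← hA2]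
    have e3 : (g ∘ₗ U.subtype) ∘ₗ (g ∘ₗ U.subtype) = g ∘ₗ (U.subtype ∘ₗ g ∘ₗ U.subtype) := rfl
    rw [e3, LinearMap.trace_comp_comm']
    have e4 : (U.subtype ∘ₗ g ∘ₗ U.subtype) ∘ₗ g = (U.subtype ∘ₗ g) ∘ₗ (U.subtype ∘ₗ g) := rfl
    rw [e4, ← hA1]
  have c0 := charpoly_of_finrank_eq_two hdim D t1
  have c1 := charpoly_comp_comm g U.subtype
  have c2 := charpoly_comp_comm Q.mkQ k
  rw [← hA1, hUdim, hV] at c1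
  rw [← hA2, hdim, hUdim, ← hD, c0, t2] at c2
  have c2' : (g ∘ₗ U.subtype).charpoly =
      X ^ 2 * (X ^ 2 - C (LinearMap.trace ℝ V (A ∘ₗ A) / 2)) := by
    apply mul_left_cancel₀ (pow_ne_zero 2 (X_ne_zero (R := ℝ)))
    rw [c2]; ring
  apply mul_left_cancel₀ (pow_ne_zero 4 (X_ne_zero (R := ℝ)))
  rw [c1, c2']; ring

end LinearAlgebra

/-! ### Characteristic polynomial of a critical combination of H, K, G -/

lemma differentiable_sgrad (lam : ℝ) {F : Phase → ℝ} (hF : ContDiff ℝ ∞ F) :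
    Differentiable ℝ (sgrad lam F) :=
  differentiable_emb.comp (differentiable_id.prodMk
    ((contDiff_reducedField lam hF).differentiable (by simp)))

lemma fderiv_mul_eq_zero {k q : Phase → ℝ} {x v : Phase} (hk : DifferentiableAt ℝ k x)
    (hq : DifferentiableAt ℝ q x) (h0 : k x = 0) (h1 : fderiv ℝ k x v = 0) :
    fderiv ℝ (fun y => k y * q y) x v = 0 := by
  rw [fderiv_fun_mul hk hq]
  simp [h0, h1]

/-- If `F₀` is in involution with `F` on `𝒫⁶`, the linearization of `sgrad F` at a zero is
tangent to the level of `F₀`. -/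
lemma fderiv_linField_eq_zero {a b lam : ℝ} {F₀ F : Phase → ℝ} (hF₀ : ContDiff ℝ ∞ F₀)
    (hF : ContDiff ℝ ∞ F) {x : Phase} (hx : x ∈ phaseSpace a b)
    (h0 : reducedField lam F x = 0) (c : ℝ)
    (hbr : ∀ y, bracket lam F₀ F y = c * ((b ^ 2 - y.2.2 ⬝ᵥ y.2.2) * (y.2.1 ⨯₃ gradM F₀ y) 0
      + (a ^ 2 - y.2.1 ⬝ᵥ y.2.1) * (y.2.2 ⨯₃ gradM F₀ y) 1
      + (y.2.1 ⬝ᵥ y.2.2) * ((y.2.1 ⨯₃ gradM F₀ y) 1 + (y.2.2 ⨯₃ gradM F₀ y) 0)))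
    {v : Phase} (hv : v ∈ tangent x) : fderiv ℝ F₀ x (linField lam F x v) = 0 := by
  have hM : ∀ i, DifferentiableAt ℝ (fun y => gradM F₀ y i) x :=
    differentiableAt_pi.1 ((contDiff_gradM hF₀).differentiable (by simp) x)
  have d1 : DifferentiableAt ℝ (fderiv ℝ F₀) x :=
    (hF₀.fderiv_right (m := ∞) (by simp)).differentiable (by simp) x
  have d2 := differentiable_sgrad lam hF x
  have hs0 : sgrad lam F x = 0 := by rw [sgrad_eq_emb, h0, map_zero]
  -- In the product rule for dF₀(sgrad F) the second-derivative term drops out, since sgrad F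
  -- vanishes at x.
  have e1 : fderiv ℝ (bracket lam F₀ F) x v = fderiv ℝ F₀ x (linField lam F x v) := by
    change fderiv ℝ (fun y => fderiv ℝ F₀ y (sgrad lam F y)) x v = _
    rw [fderiv_clm_apply d1 d2]
    simp [hs0, linField]
  obtain ⟨g1, g2, g3⟩ := phaseSpace_eqs hx
  obtain ⟨v1, v2, v3⟩ := mem_tangent.1 hv
  simp only [dotProduct, Fin.sum_univ_three] at v1 v2 v3
  rw [← e1, funext hbr]
  simp only [dotProduct, Fin.sum_univ_three, cross_apply, Matrix.cons_val_zero, Matrix.cons_val_one]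
  -- Each summand has a Casimir defect as a factor, and the defect vanishes at x together with its
  -- derivative along the tangent vector v.
  rw [fderiv_const_mul (by fun_prop), smul_apply, fderiv_fun_add (by fun_prop) (by fun_prop),
    fderiv_fun_add (by fun_prop) (by fun_prop), add_apply, add_apply, fderiv_mul_eq_zero,
    fderiv_mul_eq_zero, fderiv_mul_eq_zero]
  · simp
  · fun_prop
  · fun_prop
  · exact g3
  · simp (disch := fun_prop) only [fderiv_fun_add, fderiv_fun_mul, add_apply, smul_apply,
      fderiv_alpha, fderiv_beta, smul_eq_mul]
    linarith
  · fun_prop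
  · fun_prop
  · linarith
  · simp (disch := fun_prop) only [fderiv_fun_sub, fderiv_fun_const, fderiv_fun_add,
      fderiv_fun_mul, add_apply, sub_apply, smul_apply, zero_apply, Pi.zero_apply,
      fderiv_alpha, smul_eq_mul]
    linarith
  · fun_prop
  · fun_prop
  · linarith
  · simp (disch := fun_prop) only [fderiv_fun_sub, fderiv_fun_const, fderiv_fun_add,
      fderiv_fun_mul, add_apply, sub_apply, smul_apply, zero_apply, Pi.zero_apply,
      fderiv_beta, smul_eq_mul]
    linarith

lemma bracket_self (lam : ℝ) (F : Phase → ℝ) (y : Phase) : bracket lam F F y = 0 := by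
  have := bracket_swap lam F F y
  linarith

/-- The characteristic polynomial of the linearization at a critical point at which `H` and `K`
are independent. -/
theorem charpoly_reducedLin {a b lam : ℝ} {x : Phase}
    (hx : x ∈ phaseSpace a b) {c : Fin 3 → ℝ} (h0 : reducedField lam (combo a b lam c) x = 0)
    (hind : LinearIndependent ℝ ![reducedField lam intH x, reducedField lam (intK lam) x]) :
    (reducedLin lam (combo a b lam c) x).charpoly = Polynomial.X ^ 4 * (Polynomial.X ^ 2 -
      Polynomial.C (LinearMap.trace ℝ _ (reducedLin lam (combo a b lam c) x ∘ₗ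
        reducedLin lam (combo a b lam c) x) / 2)) := by
  have hF := contDiff_combo a b lam c
  set F := combo a b lam c with hFdef
  have hskew := symp_reducedLin hF h0
  have hnd : (symp (momentum lam x)).Nondegenerate :=
    ⟨fun u h => symp_nondegenerate _ h,
      fun v h => symp_nondegenerate _ fun u => by rw [symp_swap, h u, neg_zero]⟩
  -- For X₀ the Hamiltonian vector of F₀, ω(A X₀, v) = −ω(X₀, A v) = −dF₀(A v) = 0 for every v, so A
  -- X₀ = 0 by non-degeneracy.
  have hker : ∀ F₀, ContDiff ℝ ∞ F₀ → (∀ y, bracket lam F₀ F y = c 2 *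
      ((b ^ 2 - y.2.2 ⬝ᵥ y.2.2) * (y.2.1 ⨯₃ gradM F₀ y) 0
      + (a ^ 2 - y.2.1 ⬝ᵥ y.2.1) * (y.2.2 ⨯₃ gradM F₀ y) 1
      + (y.2.1 ⬝ᵥ y.2.2) * ((y.2.1 ⨯₃ gradM F₀ y) 1 + (y.2.2 ⨯₃ gradM F₀ y) 0))) →
      reducedLin lam F x (reducedField lam F₀ x) = 0 := by
    intro F₀ hF₀ hbr
    apply symp_nondegenerate (momentum lam x)
    intro v
    rw [hskew, symp_reducedField]
    have : emb x (reducedLin lam F x v) = linField lam F x (emb x v) :=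
        (linField_apply hF h0 _).symm
    rw [this, fderiv_linField_eq_zero hF₀ hF hx h0 (c 2) hbr (emb_mem_tangent x v), neg_zero]
  have kH := hker intH contDiff_intH (fun y => by
    rw [hFdef, bracket_combo, bracket_self, bracket_intH_intK, bracket_intH_intG]; ring)
  have kK := hker (intK lam) (contDiff_intK lam) (fun y => by
    rw [hFdef, bracket_combo, bracket_self, bracket_swap, bracket_intH_intK, bracket_intK_intG]; ring)
  refine charpoly_of_isotropic_kernel (P := Submodule.span ℝ
    (Set.range ![reducedField lam intH x, reducedField lam (intK lam) x]))
        (by simp) hnd hskew ?_ ?_ ?_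
  · simpa using finrank_span_eq_card hind
  · have hij : ∀ i j, symp (momentum lam x)
        (![reducedField lam intH x, reducedField lam (intK lam) x] i)
        (![reducedField lam intH x, reducedField lam (intK lam) x] j) = 0 := by
      have h1 := bracket_self lam intH x
      have h2 := bracket_self lam (intK lam) x
      have h3 := bracket_intH_intK lam x
      have h4 := bracket_swap lam (intK lam) intH x
      rw [h3, neg_zero] at h4
      rw [bracket_eq_symp] at h1 h2 h3 h4
      intro i j
      fin_cases i <;> fin_cases j
      · exact h1
      · exact h3
      · exact h4
      · exact h2
    rw [Submodule.span_le]
    rintro _ ⟨j, rfl⟩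
    rw [SetLike.mem_coe, LinearMap.BilinForm.mem_orthogonal_iff]
    intro w hw
    induction hw using Submodule.span_induction with
    | mem w hw => obtain ⟨i, rfl⟩ := hw; exact hij i j
    | zero =>
      change symp _ 0 _ = 0
      rw [map_zero, LinearMap.zero_apply]
    | add u v _ _ hu hv =>
      change symp _ (u + v) _ = 0
      rw [map_add, LinearMap.add_apply, hu, hv, add_zero]
    | smul t u _ hu =>
      change symp _ (t • u) _ = 0
      rw [map_smul, LinearMap.smul_apply, hu, smul_zero]
  · intro w hw
    have : Submodule.span ℝ
        (Set.range ![reducedField lam intH x, reducedField lam (intK lam) x]) ≤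
        LinearMap.ker (reducedLin lam F x) := by
      rw [Submodule.span_le]
      rintro _ ⟨i, rfl⟩
      fin_cases i
      · exact kH
      · exact kK
    exact this hw

/-! ### Complex coordinates -/

/-- Values of the complex coordinates. -/
structure Coords where
  (x₁ x₂ y₁ y₂ z₁ z₂ w₁ w₂ w₃ : ℂ)

/-- The complex coordinates of a point. -/
def coords (y : Phase) : Coords :=
  ⟨cx₁ y, cx₂ y, cy₁ y, cy₂ y, cz₁ y, cz₂ y, cw₁ y, cw₂ y, cw₃ y⟩

/-- The combination `φ₁ + i φ₂` of the components of `(φ, ψ) = (L_M, Ṁ_L)`. -/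
def phiP (l s p : ℂ) (q : Coords) : ℂ :=
  1/2 * q.x₁ * q.x₂ * q.w₁ + q.x₁ * q.y₁ * q.w₂ + q.x₁ * q.z₂ * q.w₃ + 2 * q.x₁ * q.w₂ * s
  + 1/2 * q.y₁ * q.y₂ * q.w₁
  + q.y₁ * q.z₁ * l + 2 * q.z₁ * s * l + 2 * q.w₁ ^ 2 * q.w₂ * s
  + 2 * q.w₁ * q.w₃ * s * l - q.w₁ * p

/-- The combination `φ₁ - i φ₂` of the components of `(φ, ψ) = (L_M, Ṁ_L)`. -/
def phiM (l s p : ℂ) (q : Coords) : ℂ :=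
  1/2 * q.x₁ * q.x₂ * q.w₂ + q.x₂ * q.y₂ * q.w₁ + q.x₂ * q.z₁ * q.w₃ + 2 * q.x₂ * q.w₁ * s
  + 1/2 * q.y₁ * q.y₂ * q.w₂
  + q.y₂ * q.z₂ * l + 2 * q.z₂ * s * l + 2 * q.w₁ * q.w₂ ^ 2 * s
  + 2 * q.w₂ * q.w₃ * s * l - q.w₂ * p

/-- The combination `φ₃` of the components of `(φ, ψ) = (L_M, Ṁ_L)`. -/
def phi3 (l s p : ℂ) (q : Coords) : ℂ :=
  -1/2 * q.x₁ * q.x₂ * q.w₃ + q.x₁ * q.z₂ * q.w₂ + q.x₂ * q.z₁ * q.w₁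
  + 1/2 * q.y₁ * q.y₂ * q.w₃ + q.z₁ * q.z₂ * q.w₃
  + q.z₁ * q.z₂ * l + 2 * q.w₁ * q.w₂ * s * l + 2 * q.w₃ * s * l ^ 2 - q.w₃ * p

/-- The combination `-i (ψ₁ + i ψ₂)` of the components of `(φ, ψ) = (L_M, Ṁ_L)`. -/
def psiP (l s p r : ℂ) (q : Coords) : ℂ :=
  1/2 * q.x₁ * q.x₂ * q.w₁ * q.w₃ + 1/2 * q.x₁ * q.x₂ * q.w₁ * l - q.x₁ * q.z₂ * q.w₁ * q.w₂
  + 2 * q.x₁ * q.z₂ * s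
  + 2 * q.x₁ * q.w₂ * q.w₃ * s - q.x₂ * q.z₁ * q.w₁ ^ 2 - 1/2 * q.y₁ * q.y₂ * q.w₁ * q.w₃
  - 1/2 * q.y₁ * q.y₂ * q.w₁ * l
  + q.y₁ * q.z₁ * q.w₁ * q.w₂ - 2 * q.y₁ * q.w₁ * s * l + q.y₂ * q.z₂ * q.w₁ ^ 2
  + 2 * q.z₁ * q.w₃ * s * l
  + 2 * q.z₂ * q.w₁ ^ 2 * s + q.z₂ * r + 2 * q.w₁ ^ 2 * q.w₂ * q.w₃ * s
  - 2 * q.w₁ ^ 2 * q.w₂ * s * l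
  + 2 * q.w₁ * q.w₃ ^ 2 * s * l - 2 * q.w₁ * q.w₃ * s * l ^ 2 + q.w₁ * q.w₃ * p - q.w₁ * l * p

/-- The combination `-i (ψ₁ - i ψ₂)` of the components of `(φ, ψ) = (L_M, Ṁ_L)`. -/
def psiM (l s p r : ℂ) (q : Coords) : ℂ :=
  -1/2 * q.x₁ * q.x₂ * q.w₂ * q.w₃ - 1/2 * q.x₁ * q.x₂ * q.w₂ * l + q.x₁ * q.z₂ * q.w₂ ^ 2
  + q.x₂ * q.z₁ * q.w₁ * q.w₂
  - 2 * q.x₂ * q.z₁ * s - 2 * q.x₂ * q.w₁ * q.w₃ * s + 1/2 * q.y₁ * q.y₂ * q.w₂ * q.w₃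
  + 1/2 * q.y₁ * q.y₂ * q.w₂ * l
  - q.y₁ * q.z₁ * q.w₂ ^ 2 - q.y₂ * q.z₂ * q.w₁ * q.w₂ + 2 * q.y₂ * q.w₂ * s * l
  - 2 * q.z₁ * q.w₂ ^ 2 * s
  - q.z₁ * r - 2 * q.z₂ * q.w₃ * s * l - 2 * q.w₁ * q.w₂ ^ 2 * q.w₃ * s
  + 2 * q.w₁ * q.w₂ ^ 2 * s * l
  - 2 * q.w₂ * q.w₃ ^ 2 * s * l + 2 * q.w₂ * q.w₃ * s * l ^ 2 - q.w₂ * q.w₃ * p + q.w₂ * l * p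

/-- The combination `-i ψ₃` of the components of `(φ, ψ) = (L_M, Ṁ_L)`. -/
def psi3 (l s r : ℂ) (q : Coords) : ℂ :=
  -q.x₁ * q.w₂ ^ 2 * s + 1/2 * q.x₁ * r + q.x₂ * q.w₁ ^ 2 * s - 1/2 * q.x₂ * r - q.y₁ * s * l ^ 2
  + q.y₂ * s * l ^ 2 - 2 * q.z₁ * q.w₂ * s * l + 2 * q.z₂ * q.w₁ * s * l

/-- A block of the linearization of the field `(φ, ψ)` in complex coordinates. -/
def linφξ (l s : ℂ) (q : Coords) : Matrix (Fin 3) (Fin 3) ℂ :=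
  !![
      -1/2 * q.x₁ * q.x₂ * q.w₃ + q.x₁ * q.z₂ * q.w₂ + 1/2 * q.x₂ * q.z₁ * q.w₁
      - 1/2 * q.y₁ * q.y₂ * l
      + q.y₁ * q.z₁ * q.w₂ + 1/2 * q.y₂ * q.z₂ * q.w₁ - q.y₂ * s * l + q.z₁ * q.z₂ * q.w₃
      + q.z₁ * q.z₂ * l
      + 2 * q.z₁ * q.w₂ * s,
      1/2 * q.x₁ * q.y₁ * q.w₃ + 1/2 * q.x₁ * q.y₁ * l - 1/2 * q.x₁ * q.z₂ * q.w₁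
      + q.x₁ * s * l - 1/2 * q.y₁ * q.z₁ * q.w₁,
      -2 * q.x₁ * q.y₁ * q.w₂ - q.x₁ * q.z₂ * q.w₃ - 2 * q.x₁ * q.w₂ * s - q.y₁ * q.z₁ * l;
      -1/2 * q.x₂ * q.y₂ * q.w₃ - 1/2 * q.x₂ * q.y₂ * l + 1/2 * q.x₂ * q.z₁ * q.w₂ - q.x₂ * s * l
      + 1/2 * q.y₂ * q.z₂ * q.w₂,
      1/2 * q.x₁ * q.x₂ * q.w₃ - 1/2 * q.x₁ * q.z₂ * q.w₂ - q.x₂ * q.z₁ * q.w₁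
      + 1/2 * q.y₁ * q.y₂ * l
      - 1/2 * q.y₁ * q.z₁ * q.w₂ + q.y₁ * s * l - q.y₂ * q.z₂ * q.w₁ - q.z₁ * q.z₂ * q.w₃
      - q.z₁ * q.z₂ * l
      - 2 * q.z₂ * q.w₁ * s,
      2 * q.x₂ * q.y₂ * q.w₁ + q.x₂ * q.z₁ * q.w₃ + 2 * q.x₂ * q.w₁ * s + q.y₂ * q.z₂ * l;
      -1/2 * q.x₁ * q.x₂ * q.w₂ - 1/2 * q.x₂ * q.y₂ * q.w₁ - q.x₂ * q.z₁ * q.w₃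
      - 1/2 * q.x₂ * q.z₁ * l
      - 1/2 * q.y₂ * q.z₂ * l + q.z₁ * q.z₂ * q.w₂,
      1/2 * q.x₁ * q.x₂ * q.w₁ + 1/2 * q.x₁ * q.y₁ * q.w₂ + q.x₁ * q.z₂ * q.w₃
      + 1/2 * q.x₁ * q.z₂ * l
      + 1/2 * q.y₁ * q.z₁ * l - q.z₁ * q.z₂ * q.w₁,
      -q.x₁ * q.z₂ * q.w₂ + q.x₂ * q.z₁ * q.w₁]

/-- A block of the linearization of the field `(φ, ψ)` in complex coordinates. -/
def linφm (l s p : ℂ) (q : Coords) : Matrix (Fin 3) (Fin 3) ℂ :=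
  !![
      1/4 * q.x₁ * q.x₂ + 1/4 * q.y₁ * q.y₂ + 2 * q.w₁ * q.w₂ * s + q.w₃ * s * l - 1/2 * p,
      1/2 * q.x₁ * q.y₁ + q.x₁ * s + q.w₁ ^ 2 * s,
      q.x₁ * q.z₂ + 2 * q.w₁ * s * l;
      1/2 * q.x₂ * q.y₂ + q.x₂ * s + q.w₂ ^ 2 * s,
      1/4 * q.x₁ * q.x₂ + 1/4 * q.y₁ * q.y₂ + 2 * q.w₁ * q.w₂ * s + q.w₃ * s * l - 1/2 * p,
      q.x₂ * q.z₁ + 2 * q.w₂ * s * l;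
      1/2 * q.x₂ * q.z₁ + q.w₂ * s * l,
      1/2 * q.x₁ * q.z₂ + q.w₁ * s * l,
      -1/2 * q.x₁ * q.x₂ + 1/2 * q.y₁ * q.y₂ + q.z₁ * q.z₂ + 2 * s * l ^ 2 - p]

/-- A block of the linearization of the field `(φ, ψ)` in complex coordinates. -/
def linψξ (l s r : ℂ) (q : Coords) : Matrix (Fin 3) (Fin 3) ℂ :=
  !![
      1/2 * q.x₁ * q.x₂ * q.w₁ * q.w₂ - q.x₁ * q.x₂ * s + 1/2 * q.x₂ * q.z₁ * q.w₁ * q.w₃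
      + 1/2 * q.x₂ * q.z₁ * q.w₁ * l
      - q.x₂ * q.w₁ ^ 2 * s - 1/2 * q.x₂ * r - 1/2 * q.y₁ * q.y₂ * q.w₁ * q.w₂
      - 1/2 * q.y₂ * q.z₂ * q.w₁ * q.w₃
      - 1/2 * q.y₂ * q.z₂ * q.w₁ * l - q.y₂ * q.w₃ * s * l + 2 * q.z₁ * q.z₂ * s
      + 2 * q.z₁ * q.w₂ * q.w₃ * s
      - 2 * q.z₂ * q.w₁ * s * l,
      -1/2 * q.x₁ * q.x₂ * q.w₁ ^ 2 + q.x₁ * q.y₁ * s - 1/2 * q.x₁ * q.z₂ * q.w₁ * q.w₃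
      - 1/2 * q.x₁ * q.z₂ * q.w₁ * l
      + q.x₁ * q.w₃ * s * l + 1/2 * q.y₁ * q.y₂ * q.w₁ ^ 2 + 1/2 * q.y₁ * q.z₁ * q.w₁ * q.w₃
      + 1/2 * q.y₁ * q.z₁ * q.w₁ * l
      + q.y₁ * q.w₁ ^ 2 * s + 1/2 * q.y₁ * r,
      q.x₁ * q.z₂ * q.w₁ * q.w₂ - 2 * q.x₁ * q.z₂ * s - 2 * q.x₁ * q.w₂ * q.w₃ * s
      - q.x₂ * q.z₁ * q.w₁ ^ 2
      - q.y₁ * q.z₁ * q.w₁ * q.w₂ + 2 * q.y₁ * q.w₁ * s * l + q.y₂ * q.z₂ * q.w₁ ^ 2;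
      -1/2 * q.x₁ * q.x₂ * q.w₂ ^ 2 + q.x₂ * q.y₂ * s - 1/2 * q.x₂ * q.z₁ * q.w₂ * q.w₃
      - 1/2 * q.x₂ * q.z₁ * q.w₂ * l
      + q.x₂ * q.w₃ * s * l + 1/2 * q.y₁ * q.y₂ * q.w₂ ^ 2 + 1/2 * q.y₂ * q.z₂ * q.w₂ * q.w₃
      + 1/2 * q.y₂ * q.z₂ * q.w₂ * l
      + q.y₂ * q.w₂ ^ 2 * s + 1/2 * q.y₂ * r,
      1/2 * q.x₁ * q.x₂ * q.w₁ * q.w₂ - q.x₁ * q.x₂ * s + 1/2 * q.x₁ * q.z₂ * q.w₂ * q.w₃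
      + 1/2 * q.x₁ * q.z₂ * q.w₂ * l
      - q.x₁ * q.w₂ ^ 2 * s - 1/2 * q.x₁ * r - 1/2 * q.y₁ * q.y₂ * q.w₁ * q.w₂
      - 1/2 * q.y₁ * q.z₁ * q.w₂ * q.w₃
      - 1/2 * q.y₁ * q.z₁ * q.w₂ * l - q.y₁ * q.w₃ * s * l + 2 * q.z₁ * q.z₂ * s
      - 2 * q.z₁ * q.w₂ * s * l
      + 2 * q.z₂ * q.w₁ * q.w₃ * s,
      -q.x₁ * q.z₂ * q.w₂ ^ 2 + q.x₂ * q.z₁ * q.w₁ * q.w₂ - 2 * q.x₂ * q.z₁ * s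
      - 2 * q.x₂ * q.w₁ * q.w₃ * s
      + q.y₁ * q.z₁ * q.w₂ ^ 2 - q.y₂ * q.z₂ * q.w₁ * q.w₂ + 2 * q.y₂ * q.w₂ * s * l;
      -q.x₂ * q.w₁ * s * l + q.y₂ * q.w₂ * s * l - q.z₁ * q.w₂ ^ 2 * s
      + 1/2 * q.z₁ * r - q.z₂ * s * l ^ 2,
      -q.x₁ * q.w₂ * s * l + q.y₁ * q.w₁ * s * l - q.z₁ * s * l ^ 2 - q.z₂ * q.w₁ ^ 2 * s
      + 1/2 * q.z₂ * r,
      q.x₁ * q.w₂ ^ 2 * s - 1/2 * q.x₁ * r + q.x₂ * q.w₁ ^ 2 * s - 1/2 * q.x₂ * r + q.y₁ * s * l ^ 2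
      + q.y₂ * s * l ^ 2]

/-- A block of the linearization of the field `(φ, ψ)` in complex coordinates. -/
def linψm (l s p : ℂ) (q : Coords) : Matrix (Fin 3) (Fin 3) ℂ :=
  !![
      1/4 * q.x₁ * q.x₂ * q.w₃ + 1/4 * q.x₁ * q.x₂ * l - 1/2 * q.x₁ * q.z₂ * q.w₂
      - q.x₂ * q.z₁ * q.w₁
      - 1/4 * q.y₁ * q.y₂ * q.w₃ - 1/4 * q.y₁ * q.y₂ * l + 1/2 * q.y₁ * q.z₁ * q.w₂ - q.y₁ * s * l
      + q.y₂ * q.z₂ * q.w₁ + 2 * q.z₂ * q.w₁ * s + 2 * q.w₁ * q.w₂ * q.w₃ * s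
      - 2 * q.w₁ * q.w₂ * s * l
      + q.w₃ ^ 2 * s * l - q.w₃ * s * l ^ 2 + 1/2 * q.w₃ * p - 1/2 * l * p,
      -1/2 * q.x₁ * q.z₂ * q.w₁ + q.x₁ * q.w₃ * s + 1/2 * q.y₁ * q.z₁ * q.w₁ + q.w₁ ^ 2 * q.w₃ * s
      - q.w₁ ^ 2 * s * l,
      1/2 * q.x₁ * q.x₂ * q.w₁ + 2 * q.x₁ * q.w₂ * s - 1/2 * q.y₁ * q.y₂ * q.w₁ + 2 * q.z₁ * s * l
      + 2 * q.w₁ ^ 2 * q.w₂ * s + 4 * q.w₁ * q.w₃ * s * l - 2 * q.w₁ * s * l ^ 2 + q.w₁ * p;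
      1/2 * q.x₂ * q.z₁ * q.w₂ - q.x₂ * q.w₃ * s - 1/2 * q.y₂ * q.z₂ * q.w₂ - q.w₂ ^ 2 * q.w₃ * s
      + q.w₂ ^ 2 * s * l,
      -1/4 * q.x₁ * q.x₂ * q.w₃ - 1/4 * q.x₁ * q.x₂ * l + q.x₁ * q.z₂ * q.w₂
      + 1/2 * q.x₂ * q.z₁ * q.w₁
      + 1/4 * q.y₁ * q.y₂ * q.w₃ + 1/4 * q.y₁ * q.y₂ * l - q.y₁ * q.z₁ * q.w₂
      - 1/2 * q.y₂ * q.z₂ * q.w₁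
      + q.y₂ * s * l - 2 * q.z₁ * q.w₂ * s - 2 * q.w₁ * q.w₂ * q.w₃ * s + 2 * q.w₁ * q.w₂ * s * l
      - q.w₃ ^ 2 * s * l + q.w₃ * s * l ^ 2 - 1/2 * q.w₃ * p + 1/2 * l * p,
      -1/2 * q.x₁ * q.x₂ * q.w₂ - 2 * q.x₂ * q.w₁ * s + 1/2 * q.y₁ * q.y₂ * q.w₂ - 2 * q.z₂ * s * l
      - 2 * q.w₁ * q.w₂ ^ 2 * s - 4 * q.w₂ * q.w₃ * s * l + 2 * q.w₂ * s * l ^ 2 - q.w₂ * p;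
      q.x₂ * q.w₁ * s + q.z₂ * s * l,
      -q.x₁ * q.w₂ * s - q.z₁ * s * l,
      0]

/-! ### The field of L: real components against complex ones -/

section
open Complex

lemma gradM_eq_phiP (a b lam s : ℝ) (y : Phase) :
    (gradM (combo a b lam (coeffL a b lam s)) y 0 : ℂ) + gradM (combo a b lam
        (coeffL a b lam s)) y 1 * I =
    phiP lam s (a ^ 2 + b ^ 2) (coords y) := by
  simp only [gradM_combo, gradM_intH, gradM_intK, gradM_intG, coeffL, momentum, cross_apply,
    dotProduct, Fin.sum_univ_three, Pi.add_apply, Pi.smul_apply, smul_eq_mul,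
    Matrix.cons_val_zero, Matrix.cons_val_one, Matrix.cons_val]
  apply Complex.ext <;>
  · simp [phiP, coords, cx₁, cx₂, cy₁, cy₂, cz₁, cz₂, cw₁, cw₂, cw₃, pow_two]
    ring

lemma gradM_eq_phiM (a b lam s : ℝ) (y : Phase) :
    (gradM (combo a b lam (coeffL a b lam s)) y 0 : ℂ) - gradM (combo a b lam
        (coeffL a b lam s)) y 1 * I =
    phiM lam s (a ^ 2 + b ^ 2) (coords y) := by
  simp only [gradM_combo, gradM_intH, gradM_intK, gradM_intG, coeffL, momentum, cross_apply,
    dotProduct, Fin.sum_univ_three, Pi.add_apply, Pi.smul_apply, smul_eq_mul,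
    Matrix.cons_val_zero, Matrix.cons_val_one, Matrix.cons_val]
  apply Complex.ext <;>
  · simp [phiM, coords, cx₁, cx₂, cy₁, cy₂, cz₁, cz₂, cw₁, cw₂, cw₃, pow_two]
    ring

lemma gradM_eq_phi3 (a b lam s : ℝ) (y : Phase) :
    (gradM (combo a b lam (coeffL a b lam s)) y 2 : ℂ) = phi3 lam s (a ^ 2 + b ^ 2) (coords y) := by
  simp only [gradM_combo, gradM_intH, gradM_intK, gradM_intG, coeffL, momentum, cross_apply,
    dotProduct, Fin.sum_univ_three, Pi.add_apply, Pi.smul_apply, smul_eq_mul,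
    Matrix.cons_val_zero, Matrix.cons_val_one, Matrix.cons_val]
  apply Complex.ext <;>
  · simp [phi3, coords, cx₁, cx₂, cy₁, cy₂, cz₁, cz₂, cw₁, cw₂, cw₃, pow_two]
    ring

lemma momentumDot_eq_psiP (a b lam s : ℝ) (y : Phase) :
    -I * ((momentumDot lam (combo a b lam (coeffL a b lam s)) y 0 : ℂ)
      + momentumDot lam (combo a b lam (coeffL a b lam s)) y 1 * I) =
    psiP lam s (a ^ 2 + b ^ 2) (a ^ 2 - b ^ 2) (coords y) := by
  simp only [momentumDot_eq, gradM_combo, gradM_intH, gradM_intK, gradM_intG,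
    gradα_combo, gradα_intH, gradα_intK, gradα_intG,
    gradβ_combo, gradβ_intH, gradβ_intK, gradβ_intG, coeffL, momentum, cross_apply,
    dotProduct, Fin.sum_univ_three, Pi.add_apply, Pi.sub_apply, Pi.smul_apply, smul_eq_mul,
    Matrix.cons_val_zero, Matrix.cons_val_one, Matrix.cons_val]
  apply Complex.ext <;>
  · simp [psiP, coords, cx₁, cx₂, cy₁, cy₂, cz₁, cz₂, cw₁, cw₂, cw₃, pow_two]
    ring

lemma momentumDot_eq_psiM (a b lam s : ℝ) (y : Phase) :
    -I * ((momentumDot lam (combo a b lam (coeffL a b lam s)) y 0 : ℂ)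
      - momentumDot lam (combo a b lam (coeffL a b lam s)) y 1 * I) =
    psiM lam s (a ^ 2 + b ^ 2) (a ^ 2 - b ^ 2) (coords y) := by
  simp only [momentumDot_eq, gradM_combo, gradM_intH, gradM_intK, gradM_intG,
    gradα_combo, gradα_intH, gradα_intK, gradα_intG,
    gradβ_combo, gradβ_intH, gradβ_intK, gradβ_intG, coeffL, momentum, cross_apply,
    dotProduct, Fin.sum_univ_three, Pi.add_apply, Pi.sub_apply, Pi.smul_apply, smul_eq_mul,
    Matrix.cons_val_zero, Matrix.cons_val_one, Matrix.cons_val]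
  apply Complex.ext <;>
  · simp [psiM, coords, cx₁, cx₂, cy₁, cy₂, cz₁, cz₂, cw₁, cw₂, cw₃, pow_two]
    ring

lemma momentumDot_eq_psi3 (a b lam s : ℝ) (y : Phase) :
    -I * (momentumDot lam (combo a b lam (coeffL a b lam s)) y 2 : ℂ) =
    psi3 lam s (a ^ 2 - b ^ 2) (coords y) := by
  simp only [momentumDot_eq, gradM_combo, gradM_intH, gradM_intK, gradM_intG,
    gradα_combo, gradα_intH, gradα_intK, gradα_intG,
    gradβ_combo, gradβ_intH, gradβ_intK, gradβ_intG, coeffL, momentum, cross_apply,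
    dotProduct, Fin.sum_univ_three, Pi.add_apply, Pi.sub_apply, Pi.smul_apply, smul_eq_mul,
    Matrix.cons_val_zero, Matrix.cons_val_one, Matrix.cons_val]
  apply Complex.ext <;>
  · simp [psi3, coords, cx₁, cx₂, cy₁, cy₂, cz₁, cz₂, cw₁, cw₂, cw₃, pow_two]
    ring

end

/-! ### Complex coordinates as linear maps and their values on tangent vectors -/

section

set_option linter.unusedSimpArgs false
set_option linter.unnecessarySeqFocus false

section
open Complex

lemma hasFDerivAt_of_isLinearMap {f : Phase → ℂ} (hf : IsLinearMap ℝ f) (x : Phase) :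
    HasFDerivAt f (LinearMap.toContinuousLinearMap (hf.mk' f)) x :=
  (LinearMap.toContinuousLinearMap (hf.mk' f)).hasFDerivAt

lemma fderiv_of_isLinearMap {f : Phase → ℂ} (hf : IsLinearMap ℝ f) (x v : Phase) :
    fderiv ℝ (fun y => f y) x v = f v :=
  congrArg (fun f => f v) (hasFDerivAt_of_isLinearMap hf x).fderiv

lemma isLinearMap_cx₁ : IsLinearMap ℝ cx₁ where
  map_add _ _ := by apply Complex.ext <;> dsimp [cx₁] <;> ring
  map_smul _ _ := by
    apply Complex.ext <;> simp only [cx₁, Complex.smul_re, Complex.smul_im] <;> dsimp <;> ring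

lemma isLinearMap_cx₂ : IsLinearMap ℝ cx₂ where
  map_add _ _ := by apply Complex.ext <;> dsimp [cx₂] <;> ring
  map_smul _ _ := by
    apply Complex.ext <;> simp only [cx₂, Complex.smul_re, Complex.smul_im] <;> dsimp <;> ring

lemma isLinearMap_cy₁ : IsLinearMap ℝ cy₁ where
  map_add _ _ := by apply Complex.ext <;> dsimp [cy₁] <;> ring
  map_smul _ _ := by
    apply Complex.ext <;> simp only [cy₁, Complex.smul_re, Complex.smul_im] <;> dsimp <;> ring

lemma isLinearMap_cy₂ : IsLinearMap ℝ cy₂ where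
  map_add _ _ := by apply Complex.ext <;> dsimp [cy₂] <;> ring
  map_smul _ _ := by
    apply Complex.ext <;> simp only [cy₂, Complex.smul_re, Complex.smul_im] <;> dsimp <;> ring

lemma isLinearMap_cz₁ : IsLinearMap ℝ cz₁ where
  map_add _ _ := by apply Complex.ext <;> dsimp [cz₁]
  map_smul _ _ := by
    apply Complex.ext <;> simp only [cz₁, Complex.smul_re, Complex.smul_im] <;> dsimp

lemma isLinearMap_cz₂ : IsLinearMap ℝ cz₂ where
  map_add _ _ := by apply Complex.ext <;> dsimp [cz₂] <;> ring
  map_smul _ _ := by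
    apply Complex.ext <;> simp only [cz₂, Complex.smul_re, Complex.smul_im] <;> dsimp <;> ring

lemma isLinearMap_cw₁ : IsLinearMap ℝ cw₁ where
  map_add _ _ := by apply Complex.ext <;> dsimp [cw₁]
  map_smul _ _ := by
    apply Complex.ext <;> simp only [cw₁, Complex.smul_re, Complex.smul_im] <;> dsimp

lemma isLinearMap_cw₂ : IsLinearMap ℝ cw₂ where
  map_add _ _ := by apply Complex.ext <;> dsimp [cw₂] <;> ring
  map_smul _ _ := by
    apply Complex.ext <;> simp only [cw₂, Complex.smul_re, Complex.smul_im] <;> dsimp <;> ring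

lemma isLinearMap_cw₃ : IsLinearMap ℝ cw₃ where
  map_add _ _ := by apply Complex.ext <;> dsimp [cw₃] <;> ring
  map_smul _ _ := by
    apply Complex.ext <;> simp only [cw₃, Complex.smul_re, Complex.smul_im] <;> dsimp <;> ring

@[fun_prop] lemma differentiable_cx₁ : Differentiable ℝ cx₁ := fun x =>
  (hasFDerivAt_of_isLinearMap isLinearMap_cx₁ x).differentiableAt

@[fun_prop] lemma differentiable_cx₂ : Differentiable ℝ cx₂ := fun x =>
  (hasFDerivAt_of_isLinearMap isLinearMap_cx₂ x).differentiableAt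

@[fun_prop] lemma differentiable_cy₁ : Differentiable ℝ cy₁ := fun x =>
  (hasFDerivAt_of_isLinearMap isLinearMap_cy₁ x).differentiableAt

@[fun_prop] lemma differentiable_cy₂ : Differentiable ℝ cy₂ := fun x =>
  (hasFDerivAt_of_isLinearMap isLinearMap_cy₂ x).differentiableAt

@[fun_prop] lemma differentiable_cz₁ : Differentiable ℝ cz₁ := fun x =>
  (hasFDerivAt_of_isLinearMap isLinearMap_cz₁ x).differentiableAt

@[fun_prop] lemma differentiable_cz₂ : Differentiable ℝ cz₂ := fun x =>
  (hasFDerivAt_of_isLinearMap isLinearMap_cz₂ x).differentiableAt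

@[fun_prop] lemma differentiable_cw₁ : Differentiable ℝ cw₁ := fun x =>
  (hasFDerivAt_of_isLinearMap isLinearMap_cw₁ x).differentiableAt

@[fun_prop] lemma differentiable_cw₂ : Differentiable ℝ cw₂ := fun x =>
  (hasFDerivAt_of_isLinearMap isLinearMap_cw₂ x).differentiableAt

@[fun_prop] lemma differentiable_cw₃ : Differentiable ℝ cw₃ := fun x =>
  (hasFDerivAt_of_isLinearMap isLinearMap_cw₃ x).differentiableAt

/-- Here and in the next eight lemmas the value is written as I times a linear form in the
components of `complexify u`. The common factor I is what later lets `ring` work without I² = −1. -/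
lemma cx₁_emb (x : Phase) (u : (Fin 3 → ℝ) × (Fin 3 → ℝ)) : cx₁ (emb x u) =
    I * ((u.1 0 + u.1 1 * I) * cz₁ x - u.1 2 * cx₁ x) := by
  apply Complex.ext <;>
    simp [cx₁, cx₂, cy₁, cy₂, cz₁, cz₂, emb_apply, cross_apply] <;> ring

lemma cx₂_emb (x : Phase) (u : (Fin 3 → ℝ) × (Fin 3 → ℝ)) : cx₂ (emb x u) =
    I * (-(u.1 0 - u.1 1 * I) * cz₂ x + u.1 2 * cx₂ x) := by
  apply Complex.ext <;>
    simp [cx₁, cx₂, cy₁, cy₂, cz₁, cz₂, emb_apply, cross_apply] <;> ring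

lemma cy₁_emb (x : Phase) (u : (Fin 3 → ℝ) × (Fin 3 → ℝ)) : cy₁ (emb x u) =
    I * ((u.1 0 + u.1 1 * I) * cz₂ x - u.1 2 * cy₁ x) := by
  apply Complex.ext <;>
    simp [cx₁, cx₂, cy₁, cy₂, cz₁, cz₂, emb_apply, cross_apply] <;> ring

lemma cy₂_emb (x : Phase) (u : (Fin 3 → ℝ) × (Fin 3 → ℝ)) : cy₂ (emb x u) =
    I * (-(u.1 0 - u.1 1 * I) * cz₁ x + u.1 2 * cy₂ x) := by
  apply Complex.ext <;>
    simp [cx₁, cx₂, cy₁, cy₂, cz₁, cz₂, emb_apply, cross_apply] <;> ring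

lemma cz₁_emb (x : Phase) (u : (Fin 3 → ℝ) × (Fin 3 → ℝ)) : cz₁ (emb x u) =
    I / 2 * ((u.1 0 - u.1 1 * I) * cx₁ x - (u.1 0 + u.1 1 * I) * cy₂ x) := by
  apply Complex.ext <;>
    simp [cx₁, cx₂, cy₁, cy₂, cz₁, cz₂, emb_apply, cross_apply] <;> ring

lemma cz₂_emb (x : Phase) (u : (Fin 3 → ℝ) × (Fin 3 → ℝ)) : cz₂ (emb x u) =
    I / 2 * ((u.1 0 - u.1 1 * I) * cy₁ x - (u.1 0 + u.1 1 * I) * cx₂ x) := by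
  apply Complex.ext <;>
    simp [cx₁, cx₂, cy₁, cy₂, cz₁, cz₂, emb_apply, cross_apply] <;> ring

lemma cw₁_emb (x : Phase) (u : (Fin 3 → ℝ) × (Fin 3 → ℝ)) : cw₁ (emb x u) =
    I / 2 * (-I * (u.2 0 + u.2 1 * I)) := by
  apply Complex.ext <;>
    simp [cx₁, cx₂, cy₁, cy₂, cz₁, cz₂, cw₁, emb_apply, cross_apply] <;> ring

lemma cw₂_emb (x : Phase) (u : (Fin 3 → ℝ) × (Fin 3 → ℝ)) : cw₂ (emb x u) =
    I / 2 * (-I * (u.2 0 - u.2 1 * I)) := by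
  apply Complex.ext <;>
    simp [cx₁, cx₂, cy₁, cy₂, cz₁, cz₂, cw₂, emb_apply, cross_apply] <;> ring

lemma cw₃_emb (x : Phase) (u : (Fin 3 → ℝ) × (Fin 3 → ℝ)) : cw₃ (emb x u) =
    I * (-I * u.2 2) := by
  apply Complex.ext <;>
    simp [cx₁, cx₂, cy₁, cy₂, cz₁, cz₂, cw₃, emb_apply, cross_apply]

end

end

/-! ### The trace of the squared linearization in complex coordinates -/

section

set_option linter.unusedSimpArgs false
set_option linter.unnecessarySeqFocus false

section
open Complex Matrix

/-- If a real operator is conjugate to `i C` over `ℂ`, the trace of its square is `-tr C²`. -/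
lemma trace_comp_self_of_complex {V ι : Type*} [AddCommGroup V] [Module ℝ V] [Fintype ι]
    [DecidableEq ι] (B : Module.Basis ι ℝ V) (Θ : V →ₗ[ℝ] (ι → ℂ)) (T' C : Matrix ι ι ℂ)
    (hT : T' * Matrix.of (fun k j => Θ (B j) k) = 1) (A : V →ₗ[ℝ] V)
    (hA : ∀ v, Θ (A v) = I • (C *ᵥ Θ v)) :
    ((LinearMap.trace ℝ V (A ∘ₗ A) : ℝ) : ℂ) = -(C * C).trace := by
  set T : Matrix ι ι ℂ := Matrix.of (fun k j => Θ (B j) k) with hTdef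
  have hT2 : T * T' = 1 := mul_eq_one_comm.mp hT
  set R : Matrix ι ι ℂ := (LinearMap.toMatrix B B A).map (algebraMap ℝ ℂ) with hR
  have h1 : T * R = I • (C * T) := by
    ext k j
    have h2 : Θ (A (B j)) k = (T * R) k j := by
      conv_lhs => rw [← B.sum_repr (A (B j))]
      rw [map_sum, Finset.sum_apply, Matrix.mul_apply]
      refine Finset.sum_congr rfl fun i _ => ?_
      rw [map_smul, Pi.smul_apply, hR, Matrix.map_apply, LinearMap.toMatrix_apply, hTdef,
        Matrix.of_apply, mul_comm]
      simp
    rw [← h2, hA]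
    simp [Matrix.mul_apply, Matrix.mulVec, dotProduct, hTdef]
  have h3 : R = T' * (I • (C * T)) := by rw [← h1, ← Matrix.mul_assoc, hT, Matrix.one_mul]
  have h4 : R * R = -(T' * (C * C) * T) := by
    rw [h3]
    have : T' * (I • (C * T)) * (T' * (I • (C * T))) = (I * I) • (T' * C * (T * T') * C * T) := by
      simp only [Matrix.mul_smul, Matrix.smul_mul, smul_smul, Matrix.mul_assoc]
    rw [this, hT2]
    simp [Matrix.mul_assoc]
  have h5 : ((LinearMap.trace ℝ V (A ∘ₗ A) : ℝ) : ℂ) = (R * R).trace := by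
    rw [LinearMap.trace_eq_matrix_trace ℝ B, LinearMap.toMatrix_comp B B B, hR, ← Matrix.map_mul]
    exact AddMonoidHom.map_trace (algebraMap ℝ ℂ) _
  rw [h5, h4, Matrix.trace_neg, Matrix.trace_mul_comm, ← Matrix.mul_assoc, hT2, Matrix.one_mul]

/-- Complex coordinates on the pairs `(ξ, m)`. -/
def complexify : ((Fin 3 → ℝ) × (Fin 3 → ℝ)) →ₗ[ℝ] (Fin 3 ⊕ Fin 3 → ℂ) where
  toFun u := Sum.elim ![u.1 0 + u.1 1 * I, u.1 0 - u.1 1 * I, u.1 2]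
    ![-I * (u.2 0 + u.2 1 * I), -I * (u.2 0 - u.2 1 * I), -I * u.2 2]
  map_add' u v := by
    ext k
    rcases k with k | k <;> fin_cases k <;> simp <;> ring
  map_smul' t u := by
    ext k
    rcases k with k | k <;> fin_cases k <;> simp <;> ring

lemma complexify_apply (u : (Fin 3 → ℝ) × (Fin 3 → ℝ)) :
    complexify u = Sum.elim ![(u.1 0 : ℂ) + u.1 1 * I, u.1 0 - u.1 1 * I, u.1 2]
      ![-I * (u.2 0 + u.2 1 * I), -I * (u.2 0 - u.2 1 * I), -I * u.2 2] := rfl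

/-- The left factor is the explicit inverse of the matrix of `complexify`; it shows that the six
complex components form a basis of the complexification. -/
lemma complexify_matrix :
    (fromBlocks !![1/2, 1/2, 0; -I/2, I/2, 0; 0, 0, 1] 0 0
        !![I/2, I/2, 0; 1/2, -1/2, 0; 0, 0, I] : Matrix (Fin 3 ⊕ Fin 3) (Fin 3 ⊕ Fin 3) ℂ) *
      Matrix.of (fun k j => complexify
        (((Pi.basisFun ℝ (Fin 3)).prod (Pi.basisFun ℝ (Fin 3))) j) k) = 1 := by
  have : (Matrix.of (fun k j => complexify
      (((Pi.basisFun ℝ (Fin 3)).prod (Pi.basisFun ℝ (Fin 3))) j) k)) =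
      fromBlocks !![1, I, 0; 1, -I, 0; 0, 0, 1] 0 0 !![-I, 1, 0; -I, -1, 0; 0, 0, -I] := by
    ext k j
    rcases k with k | k <;> rcases j with j | j <;> fin_cases k <;> fin_cases j <;>
      simp [complexify_apply]
  rw [this, fromBlocks_multiply, ← fromBlocks_one]
  congr 1
  · ext k j
    fin_cases k <;> fin_cases j <;> simp [Matrix.mul_apply, Fin.sum_univ_three] <;> ring_nf <;>
      simp [I_sq]
  · simp
  · simp
  · ext k j
    fin_cases k <;> fin_cases j <;> simp [Matrix.mul_apply, Fin.sum_univ_three] <;> ring_nf <;>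
      simp [I_sq]

/-- The linearization of the field of `L` in complex coordinates, divided by `i`. -/
def linL (l s p r : ℂ) (q : Coords) : Matrix (Fin 3 ⊕ Fin 3) (Fin 3 ⊕ Fin 3) ℂ :=
  fromBlocks (linφξ l s q) (linφm l s p q) (linψξ l s r q) (linψm l s p q)

/-- The field of `L` in complex coordinates. -/
def fieldL (l s p r : ℂ) (q : Coords) : Fin 3 ⊕ Fin 3 → ℂ :=
  Sum.elim ![phiP l s p q, phiM l s p q, phi3 l s p q]
    ![psiP l s p r q, psiM l s p r q, psi3 l s r q]

lemma complexify_reducedField (a b lam s : ℝ) (y : Phase) :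
    complexify (reducedField lam (combo a b lam (coeffL a b lam s)) y) =
      fieldL lam s (a ^ 2 + b ^ 2) (a ^ 2 - b ^ 2) (coords y) := by
  rw [complexify_apply, fieldL]
  simp only [reducedField]
  rw [gradM_eq_phiP, gradM_eq_phiM, gradM_eq_phi3, momentumDot_eq_psiP, momentumDot_eq_psiM,
    momentumDot_eq_psi3]

set_option maxHeartbeats 4000000 in
lemma fderiv_fieldL (a b lam s : ℝ) (x : Phase) (u : (Fin 3 → ℝ) × (Fin 3 → ℝ))
    (k : Fin 3 ⊕ Fin 3) :
    fderiv ℝ (fun y => fieldL lam s (a ^ 2 + b ^ 2) (a ^ 2 - b ^ 2) (coords y) k) x (emb x u) =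
      (I • (linL lam s (a ^ 2 + b ^ 2) (a ^ 2 - b ^ 2) (coords x) *ᵥ complexify u)) k := by
  rw [linL, complexify_apply, fromBlocks_mulVec]
  rcases k with k | k <;> fin_cases k <;>
  · simp only [fieldL, phiP, phiM, phi3, psiP, psiM, psi3, coords, Sum.elim_inl, Sum.elim_inr,
      Fin.zero_eta, Fin.mk_one, Fin.reduceFinMk, Matrix.cons_val_zero, Matrix.cons_val_one,
      Matrix.cons_val]
    simp (disch := fun_prop) only [fderiv_fun_add, fderiv_fun_sub, fderiv_fun_mul, fderiv_fun_pow,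
      fderiv_fun_neg, _root_.neg_apply, fderiv_fun_const, _root_.add_apply, _root_.sub_apply,
      _root_.smul_apply, _root_.zero_apply,
      Pi.zero_apply, Pi.smul_apply, Pi.add_apply, smul_eq_mul, nsmul_eq_mul,
      fderiv_of_isLinearMap isLinearMap_cx₁, fderiv_of_isLinearMap isLinearMap_cx₂,
      fderiv_of_isLinearMap isLinearMap_cy₁, fderiv_of_isLinearMap isLinearMap_cy₂,
      fderiv_of_isLinearMap isLinearMap_cz₁, fderiv_of_isLinearMap isLinearMap_cz₂,
      fderiv_of_isLinearMap isLinearMap_cw₁, fderiv_of_isLinearMap isLinearMap_cw₂,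
      fderiv_of_isLinearMap isLinearMap_cw₃, cx₁_emb, cx₂_emb, cy₁_emb, cy₂_emb, cz₁_emb,
      cz₂_emb, cw₁_emb, cw₂_emb, cw₃_emb, linφξ, linφm, linψξ, linψm, Matrix.mulVec, dotProduct,
      Function.comp, Sum.elim_inl, Sum.elim_inr,
      Fin.sum_univ_three, Matrix.of_apply, Matrix.cons_val_zero, Matrix.cons_val_one,
      Matrix.cons_val]
    push_cast
    -- What remains is an identity of polynomials in which I is merely another variable.
    generalize cx₁ x = x₁, cx₂ x = x₂, cy₁ x = y₁, cy₂ x = y₂, cz₁ x = z₁, cz₂ x = z₂,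
      cw₁ x = w₁, cw₂ x = w₂, cw₃ x = w₃
    ring

lemma complexify_reducedLin (a b lam s : ℝ) (x : Phase) (u : (Fin 3 → ℝ) × (Fin 3 → ℝ)) :
    complexify (reducedLin lam (combo a b lam (coeffL a b lam s)) x u) =
      I • (linL lam s (a ^ 2 + b ^ 2) (a ^ 2 - b ^ 2) (coords x) *ᵥ complexify u) := by
  set F := combo a b lam (coeffL a b lam s)
  have hd : DifferentiableAt ℝ (reducedField lam F) x :=
    (contDiff_reducedField lam (contDiff_combo a b lam _)).differentiable (by simp) x
  have h1 : complexify (reducedLin lam F x u) =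
      fderiv ℝ (fun y => fieldL lam s (a ^ 2 + b ^ 2) (a ^ 2 - b ^ 2) (coords y)) x (emb x u) := by
    have e : (fun y => fieldL lam s (a ^ 2 + b ^ 2) (a ^ 2 - b ^ 2) (coords y)) =
        fun y => (LinearMap.toContinuousLinearMap complexify) (reducedField lam F y) := by
      funext y
      exact (complexify_reducedField a b lam s y).symm
    rw [e]
    exact congrArg (fun f => f (emb x u)) ((LinearMap.toContinuousLinearMap
      complexify).hasFDerivAt.comp x hd.hasFDerivAt).fderiv.symm
  have hdf : DifferentiableAt ℝ
      (fun y => fieldL lam s (a ^ 2 + b ^ 2) (a ^ 2 - b ^ 2) (coords y)) x := by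
    have e : (fun y => fieldL lam s (a ^ 2 + b ^ 2) (a ^ 2 - b ^ 2) (coords y)) =
        fun y => (LinearMap.toContinuousLinearMap complexify) (reducedField lam F y) := by
      funext y
      exact (complexify_reducedField a b lam s y).symm
    rw [e]
    exact (LinearMap.toContinuousLinearMap complexify).differentiableAt.comp x hd
  rw [h1]
  ext k
  rw [← fderiv_fieldL, fderiv_pi (fun i => (differentiableAt_pi.1 hdf) i)]
  rfl

lemma trace_reducedLin (a b lam s : ℝ) (x : Phase) :
    ((LinearMap.trace ℝ _ (reducedLin lam (combo a b lam (coeffL a b lam s)) x ∘ₗ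
        reducedLin lam (combo a b lam (coeffL a b lam s)) x) : ℝ) : ℂ) =
      -(linL lam s (a ^ 2 + b ^ 2) (a ^ 2 - b ^ 2) (coords x) *
        linL lam s (a ^ 2 + b ^ 2) (a ^ 2 - b ^ 2) (coords x)).trace :=
  trace_comp_self_of_complex _ complexify _ _ complexify_matrix _
    (complexify_reducedLin a b lam s x)

lemma reducedField_eq_zero_of_fieldL {a b lam s : ℝ} {x : Phase}
    (h : fieldL lam s (a ^ 2 + b ^ 2) (a ^ 2 - b ^ 2) (coords x) = 0) :
    reducedField lam (combo a b lam (coeffL a b lam s)) x = 0 := by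
  rw [← complexify_reducedField, complexify_apply] at h
  -- These four components suffice: the real and imaginary parts of the first one in each triple
  -- determine two real coordinates.
  have h1 := congrFun h (Sum.inl 0)
  have h3 := congrFun h (Sum.inl 2)
  have h4 := congrFun h (Sum.inr 0)
  have h6 := congrFun h (Sum.inr 2)
  simp [Complex.ext_iff] at h1 h3 h4 h6
  ext i
  · fin_cases i <;> simp [h1, h3]
  · fin_cases i <;> simp [h4, h6]
end

end

section

set_option linter.unusedSimpArgs false
set_option linter.unusedVariables false

/-! ### Rational parametrization of the generic points of `𝓜₂` -/

section
open Matrix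

/-- A parametrization of `𝓜₂`: complex coordinates in terms of `x₁, x₂` and auxiliary parameters. -/
def param (l s x₁ x₂ e₁ e₂ f₁ f₂ : ℂ) : Coords where
  x₁ := x₁
  x₂ := x₂
  y₁ := -2 * s * x₁ * e₂ ^ 2 - 4 * l * s * e₂ * f₁ - x₂ * f₁ ^ 2 - 2 * s
  y₂ := -2 * s * x₂ * e₁ ^ 2 - 4 * l * s * e₁ * f₂ - x₁ * f₂ ^ 2 - 2 * s
  z₁ := -2 * l * s * e₁ - x₁ * f₂
  z₂ := -2 * l * s * e₂ - x₂ * f₁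
  w₁ := x₁ * e₂ + l * f₁
  w₂ := x₂ * e₁ + l * f₂
  w₃ := -2 * l * s * e₁ * e₂ - x₁ * e₂ * f₂ - x₂ * e₁ * f₁ - l * f₁ * f₂

/-- The constant `p²` as a function of the complex coordinates. -/
def Coords.p2 (q : Coords) : ℂ := (q.x₁ * q.x₂ + q.y₁ * q.y₂) / 2 + q.z₁ * q.z₂

/-- The Hamiltonian as a function of the complex coordinates. -/
def Coords.h (q : Coords) : ℂ := q.w₁ * q.w₂ + q.w₃ ^ 2 / 2 - (q.y₁ + q.y₂) / 2

/-- A factor of the linearization of the field of `L` on `𝓜₂`. -/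
def colA (l s x₁ x₂ e₁ e₂ f₁ f₂ : ℂ) : Fin 3 ⊕ Fin 3 → ℂ :=
  Sum.elim
    ![f₁,
      f₂,
      1]
    ![-2 * x₁ * s * e₁ * e₂ ^ 2 - x₁ * e₂ * f₁ * f₂ - x₁ * e₂ - 2 * s * l * e₁ * e₂ * f₁
          - 2 * s * e₁ - l * f₁ ^ 2 * f₂ - l * f₁,
      2 * x₂ * s * e₁ ^ 2 * e₂ + x₂ * e₁ * f₁ * f₂ + x₂ * e₁ + 2 * s * l * e₁ * e₂ * f₂
          + 2 * s * e₂ + l * f₁ * f₂ ^ 2 + l * f₂,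
      0]

/-- A factor of the linearization of the field of `L` on `𝓜₂`. -/
def colB (l s x₁ x₂ e₁ e₂ f₁ f₂ : ℂ) : Fin 3 ⊕ Fin 3 → ℂ :=
  Sum.elim
    ![2 * e₁,
      0,
      0]
    ![-2 * x₁ * e₁ * e₂ * f₂ - 2 * l * e₁ * f₁ * f₂,
      2 * x₂ * e₁ ^ 2 * f₂ + 2 * l * e₁ * f₂ ^ 2 + 2 * f₂,
      1]

/-- A factor of the linearization of the field of `L` on `𝓜₂`. -/
def colC (l s x₁ x₂ e₁ e₂ f₁ f₂ : ℂ) : Fin 3 ⊕ Fin 3 → ℂ :=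
  Sum.elim
    ![0,
      -2 * e₂,
      0]
    ![2 * x₁ * e₂ ^ 2 * f₁ + 2 * l * e₂ * f₁ ^ 2 + 2 * f₁,
      -2 * x₂ * e₁ * e₂ * f₁ - 2 * l * e₂ * f₁ * f₂,
      1]

/-- A factor of the linearization of the field of `L` on `𝓜₂`. -/
def rowU (l s x₁ x₂ e₁ e₂ f₁ f₂ : ℂ) : Fin 3 ⊕ Fin 3 → ℂ :=
  Sum.elim
    ![-1/2 * x₁ * e₂ * f₂ ^ 2 + x₂ * s * e₁ ^ 2 * e₂ - 1/2 * x₂ * e₁ + s * e₂,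
      -x₁ * s * e₁ * e₂ ^ 2 + 1/2 * x₁ * e₂ + 1/2 * x₂ * e₁ * f₁ ^ 2 - s * e₁,
      -x₁ * e₂ * f₂ + x₂ * e₁ * f₁]
    ![-1/2 * f₂,
      -1/2 * f₁,
      -1]

/-- A factor of the linearization of the field of `L` on `𝓜₂`. -/
def rowV (l s x₁ x₂ e₁ e₂ f₁ f₂ : ℂ) : Fin 3 ⊕ Fin 3 → ℂ :=
  Sum.elim
    ![x₁ * s * e₂ ^ 2 * f₂ + 2 * s ^ 2 * l * e₁ * e₂ ^ 2 - s * l * e₂,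
      x₁ * s * e₂ ^ 2 * f₁ + s * l * e₂ * f₁ ^ 2 + s * f₁,
      2 * x₁ * s * e₂ ^ 2 + 2 * s * l * e₂ * f₁ + s]
    ![s * e₂,
      0,
      0]

/-- A factor of the linearization of the field of `L` on `𝓜₂`. -/
def rowW (l s x₁ x₂ e₁ e₂ f₁ f₂ : ℂ) : Fin 3 ⊕ Fin 3 → ℂ :=
  Sum.elim
    ![x₂ * s * e₁ ^ 2 * f₂ + s * l * e₁ * f₂ ^ 2 + s * f₂,
      x₂ * s * e₁ ^ 2 * f₁ + 2 * s ^ 2 * l * e₁ ^ 2 * e₂ - s * l * e₁,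
      2 * x₂ * s * e₁ ^ 2 + 2 * s * l * e₁ * f₂ + s]
    ![0,
      -s * e₁,
      0]

variable {l s p r x₁ x₂ e₁ e₂ f₁ f₂ : ℂ}

/-- The variables `p` and `r` stand for p² and r². The hypotheses `hr₁`, `hr₂` are the Casimir
relations z₁² + x₁y₂ = r² and z₂² + x₂y₁ = r² after substitution of the parametrization. The
φ-components vanish identically in the parameters; only the ψ-components use these relations. -/
lemma fieldL_param (hp : p = (param l s x₁ x₂ e₁ e₂ f₁ f₂).p2)
    (hr₁ : r = -2 * s * (x₁ + (x₁ * x₂ - 2 * l ^ 2 * s) * e₁ ^ 2))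
    (hr₂ : r = -2 * s * (x₂ + (x₁ * x₂ - 2 * l ^ 2 * s) * e₂ ^ 2)) :
    fieldL l s p r (param l s x₁ x₂ e₁ e₂ f₁ f₂) = 0 := by
  subst hp
  ext k
  rcases k with k | k <;> fin_cases k
  · simp only [fieldL, phiP, param, Coords.p2, Sum.elim_inl, Fin.zero_eta, Matrix.cons_val_zero,
      Pi.zero_apply]
    ring
  · simp only [fieldL, phiM, param, Coords.p2, Sum.elim_inl, Fin.mk_one, Matrix.cons_val_one,
      Matrix.cons_val_zero, Pi.zero_apply]
    ring
  · simp only [fieldL, phi3, param, Coords.p2, Sum.elim_inl, Fin.reduceFinMk, Matrix.cons_val,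
      Pi.zero_apply]
    ring
  · simp only [fieldL, psiP, param, Coords.p2, Sum.elim_inr, Fin.zero_eta, Matrix.cons_val_zero,
      Pi.zero_apply]
    linear_combination (-2 * l * s * e₂ - x₂ * f₁) * hr₁
  · simp only [fieldL, psiM, param, Coords.p2, Sum.elim_inr, Fin.mk_one, Matrix.cons_val_one,
      Matrix.cons_val_zero, Pi.zero_apply]
    linear_combination -(-2 * l * s * e₁ - x₁ * f₂) * hr₂
  · simp only [fieldL, psi3, param, Sum.elim_inr, Fin.reduceFinMk, Matrix.cons_val,
      Pi.zero_apply]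
    linear_combination 1 / 2 * x₁ * hr₂ - 1 / 2 * x₂ * hr₁

lemma linφξ_param (i j : Fin 3) :
    linφξ l s (param l s x₁ x₂ e₁ e₂ f₁ f₂) i j =
      (x₁ * x₂ - 2 * l ^ 2 * s) * (colA l s x₁ x₂ e₁ e₂ f₁ f₂
          (.inl i) * rowU l s x₁ x₂ e₁ e₂ f₁ f₂ (.inl j)
        + colB l s x₁ x₂ e₁ e₂ f₁ f₂ (.inl i) * rowV l s x₁ x₂ e₁ e₂ f₁ f₂ (.inl j)
        + colC l s x₁ x₂ e₁ e₂ f₁ f₂ (.inl i) * rowW l s x₁ x₂ e₁ e₂ f₁ f₂ (.inl j)) := by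
  fin_cases i <;> fin_cases j <;>
  simp only [linφξ, param, Coords.p2, colA, colB, colC, rowU, rowV, rowW, Sum.elim_inl,
    Sum.elim_inr, Fin.zero_eta, Fin.mk_one, Fin.reduceFinMk, Matrix.of_apply,
    Matrix.cons_val_zero, Matrix.cons_val_one, Matrix.cons_val]
  · ring
  · ring
  · ring
  · ring
  · ring
  · ring
  · ring
  · ring
  · ring

lemma linφm_param (hp : p = (param l s x₁ x₂ e₁ e₂ f₁ f₂).p2)
    (i j : Fin 3) :
    linφm l s p (param l s x₁ x₂ e₁ e₂ f₁ f₂) i j =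
      (x₁ * x₂ - 2 * l ^ 2 * s) * (colA l s x₁ x₂ e₁ e₂ f₁ f₂
          (.inl i) * rowU l s x₁ x₂ e₁ e₂ f₁ f₂ (.inr j)
        + colB l s x₁ x₂ e₁ e₂ f₁ f₂ (.inl i) * rowV l s x₁ x₂ e₁ e₂ f₁ f₂ (.inr j)
        + colC l s x₁ x₂ e₁ e₂ f₁ f₂ (.inl i) * rowW l s x₁ x₂ e₁ e₂ f₁ f₂ (.inr j)) := by
  subst hp
  fin_cases i <;> fin_cases j <;>
  simp only [linφm, param, Coords.p2, colA, colB, colC, rowU, rowV, rowW, Sum.elim_inl,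
    Sum.elim_inr, Fin.zero_eta, Fin.mk_one, Fin.reduceFinMk, Matrix.of_apply,
    Matrix.cons_val_zero, Matrix.cons_val_one, Matrix.cons_val]
  · ring
  · ring
  · ring
  · ring
  · ring
  · ring
  · ring
  · ring
  · ring

lemma linψξ_param
    (hr₁ : r = -2 * s * (x₁ + (x₁ * x₂ - 2 * l ^ 2 * s) * e₁ ^ 2))
    (hr₂ : r = -2 * s * (x₂ + (x₁ * x₂ - 2 * l ^ 2 * s) * e₂ ^ 2))
    (i j : Fin 3) :
    linψξ l s r (param l s x₁ x₂ e₁ e₂ f₁ f₂) i j =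
      (x₁ * x₂ - 2 * l ^ 2 * s) * (colA l s x₁ x₂ e₁ e₂ f₁ f₂
          (.inr i) * rowU l s x₁ x₂ e₁ e₂ f₁ f₂ (.inl j)
        + colB l s x₁ x₂ e₁ e₂ f₁ f₂ (.inr i) * rowV l s x₁ x₂ e₁ e₂ f₁ f₂ (.inl j)
        + colC l s x₁ x₂ e₁ e₂ f₁ f₂ (.inr i) * rowW l s x₁ x₂ e₁ e₂ f₁ f₂ (.inl j)) := by
  fin_cases i <;> fin_cases j <;>
  simp only [linψξ, param, Coords.p2, colA, colB, colC, rowU, rowV, rowW, Sum.elim_inl,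
    Sum.elim_inr, Fin.zero_eta, Fin.mk_one, Fin.reduceFinMk, Matrix.of_apply,
    Matrix.cons_val_zero, Matrix.cons_val_one, Matrix.cons_val]
  · linear_combination -1 / 2 * x₂ * hr₁
  · linear_combination 1 / 2 * (-2 * s * x₁ * e₂ ^ 2 - 4 * l * s * e₂ * f₁ - x₂ * f₁ ^ 2
      - 2 * s) * hr₁
  · ring
  · linear_combination 1 / 2 * (-2 * s * x₂ * e₁ ^ 2 - 4 * l * s * e₁ * f₂ - x₁ * f₂ ^ 2
      - 2 * s) * hr₂
  · linear_combination -1 / 2 * x₁ * hr₂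
  · ring
  · linear_combination 1 / 2 * (-2 * l * s * e₁ - x₁ * f₂) * hr₂
  · linear_combination 1 / 2 * (-2 * l * s * e₂ - x₂ * f₁) * hr₁
  · linear_combination -1 / 2 * x₁ * hr₂ - 1 / 2 * x₂ * hr₁

lemma linψm_param (hp : p = (param l s x₁ x₂ e₁ e₂ f₁ f₂).p2)
    (i j : Fin 3) :
    linψm l s p (param l s x₁ x₂ e₁ e₂ f₁ f₂) i j =
      (x₁ * x₂ - 2 * l ^ 2 * s) * (colA l s x₁ x₂ e₁ e₂ f₁ f₂
          (.inr i) * rowU l s x₁ x₂ e₁ e₂ f₁ f₂ (.inr j)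
        + colB l s x₁ x₂ e₁ e₂ f₁ f₂ (.inr i) * rowV l s x₁ x₂ e₁ e₂ f₁ f₂ (.inr j)
        + colC l s x₁ x₂ e₁ e₂ f₁ f₂ (.inr i) * rowW l s x₁ x₂ e₁ e₂ f₁ f₂ (.inr j)) := by
  subst hp
  fin_cases i <;> fin_cases j <;>
  simp only [linψm, param, Coords.p2, colA, colB, colC, rowU, rowV, rowW, Sum.elim_inl,
    Sum.elim_inr, Fin.zero_eta, Fin.mk_one, Fin.reduceFinMk, Matrix.of_apply,
    Matrix.cons_val_zero, Matrix.cons_val_one, Matrix.cons_val]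
  · ring
  · ring
  · ring
  · ring
  · ring
  · ring
  · ring
  · ring
  · ring

/-- The linearization has rank at most three on 𝓜₂ and carries the scalar factor n = x₁x₂ − 2l²s, so
the trace of its square needs only the nine scalar products of rows with columns. -/
lemma linL_param (hp : p = (param l s x₁ x₂ e₁ e₂ f₁ f₂).p2)
    (hr₁ : r = -2 * s * (x₁ + (x₁ * x₂ - 2 * l ^ 2 * s) * e₁ ^ 2))
    (hr₂ : r = -2 * s * (x₂ + (x₁ * x₂ - 2 * l ^ 2 * s) * e₂ ^ 2)) :
    linL l s p r (param l s x₁ x₂ e₁ e₂ f₁ f₂) = (x₁ * x₂ - 2 * l ^ 2 * s) •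
      (vecMulVec (colA l s x₁ x₂ e₁ e₂ f₁ f₂) (rowU l s x₁ x₂ e₁ e₂ f₁ f₂)
        + vecMulVec (colB l s x₁ x₂ e₁ e₂ f₁ f₂) (rowV l s x₁ x₂ e₁ e₂ f₁ f₂)
        + vecMulVec (colC l s x₁ x₂ e₁ e₂ f₁ f₂) (rowW l s x₁ x₂ e₁ e₂ f₁ f₂)) := by
  ext i j
  rcases i with i | i <;> rcases j with j | j
  · exact linφξ_param i j
  · exact linφm_param hp i j
  · exact linψξ_param hr₁ hr₂ i j
  · exact linψm_param hp i j

lemma rowU_dotProduct_colA : rowU l s x₁ x₂ e₁ e₂ f₁ f₂ ⬝ᵥ colA l s x₁ x₂ e₁ e₂ f₁ f₂ =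
    0 := by
  simp only [dotProduct, rowU, colA, Fintype.sum_sum_type, Fin.sum_univ_three, Sum.elim_inl,
    Sum.elim_inr, Matrix.cons_val_zero, Matrix.cons_val_one, Matrix.cons_val]
  ring

lemma rowU_dotProduct_colB : rowU l s x₁ x₂ e₁ e₂ f₁ f₂ ⬝ᵥ colB l s x₁ x₂ e₁ e₂ f₁ f₂ =
    (2 * s * e₁ * e₂ - f₁ * f₂ - 1) * (x₂ * e₁ ^ 2 + 1) := by
  simp only [dotProduct, rowU, colB, Fintype.sum_sum_type, Fin.sum_univ_three, Sum.elim_inl,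
    Sum.elim_inr, Matrix.cons_val_zero, Matrix.cons_val_one, Matrix.cons_val]
  ring

lemma rowU_dotProduct_colC : rowU l s x₁ x₂ e₁ e₂ f₁ f₂ ⬝ᵥ colC l s x₁ x₂ e₁ e₂ f₁ f₂ =
    (2 * s * e₁ * e₂ - f₁ * f₂ - 1) * (x₁ * e₂ ^ 2 + 1) := by
  simp only [dotProduct, rowU, colC, Fintype.sum_sum_type, Fin.sum_univ_three, Sum.elim_inl,
    Sum.elim_inr, Matrix.cons_val_zero, Matrix.cons_val_one, Matrix.cons_val]
  ring

lemma rowV_dotProduct_colA : rowV l s x₁ x₂ e₁ e₂ f₁ f₂ ⬝ᵥ colA l s x₁ x₂ e₁ e₂ f₁ f₂ =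
    -s * (2 * s * e₁ * e₂ - f₁ * f₂ - 1) * (x₁ * e₂ ^ 2 + 1) := by
  simp only [dotProduct, rowV, colA, Fintype.sum_sum_type, Fin.sum_univ_three, Sum.elim_inl,
    Sum.elim_inr, Matrix.cons_val_zero, Matrix.cons_val_one, Matrix.cons_val]
  ring

lemma rowV_dotProduct_colB : rowV l s x₁ x₂ e₁ e₂ f₁ f₂ ⬝ᵥ colB l s x₁ x₂ e₁ e₂ f₁ f₂ =
    2 * s * l * e₁ * e₂ * (2 * s * e₁ * e₂ - f₁ * f₂ - 1) := by
  simp only [dotProduct, rowV, colB, Fintype.sum_sum_type, Fin.sum_univ_three, Sum.elim_inl,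
    Sum.elim_inr, Matrix.cons_val_zero, Matrix.cons_val_one, Matrix.cons_val]
  ring

lemma rowV_dotProduct_colC : rowV l s x₁ x₂ e₁ e₂ f₁ f₂ ⬝ᵥ colC l s x₁ x₂ e₁ e₂ f₁ f₂ =
    0 := by
  simp only [dotProduct, rowV, colC, Fintype.sum_sum_type, Fin.sum_univ_three, Sum.elim_inl,
    Sum.elim_inr, Matrix.cons_val_zero, Matrix.cons_val_one, Matrix.cons_val]
  ring

lemma rowW_dotProduct_colA : rowW l s x₁ x₂ e₁ e₂ f₁ f₂ ⬝ᵥ colA l s x₁ x₂ e₁ e₂ f₁ f₂ =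
    -s * (2 * s * e₁ * e₂ - f₁ * f₂ - 1) * (x₂ * e₁ ^ 2 + 1) := by
  simp only [dotProduct, rowW, colA, Fintype.sum_sum_type, Fin.sum_univ_three, Sum.elim_inl,
    Sum.elim_inr, Matrix.cons_val_zero, Matrix.cons_val_one, Matrix.cons_val]
  ring

lemma rowW_dotProduct_colB : rowW l s x₁ x₂ e₁ e₂ f₁ f₂ ⬝ᵥ colB l s x₁ x₂ e₁ e₂ f₁ f₂ =
    0 := by
  simp only [dotProduct, rowW, colB, Fintype.sum_sum_type, Fin.sum_univ_three, Sum.elim_inl,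
    Sum.elim_inr, Matrix.cons_val_zero, Matrix.cons_val_one, Matrix.cons_val]
  ring

lemma rowW_dotProduct_colC : rowW l s x₁ x₂ e₁ e₂ f₁ f₂ ⬝ᵥ colC l s x₁ x₂ e₁ e₂ f₁ f₂ =
    -2 * s * l * e₁ * e₂ * (2 * s * e₁ * e₂ - f₁ * f₂ - 1) := by
  simp only [dotProduct, rowW, colC, Fintype.sum_sum_type, Fin.sum_univ_three, Sum.elim_inl,
    Sum.elim_inr, Matrix.cons_val_zero, Matrix.cons_val_one, Matrix.cons_val]
  ring

/-- The trace of (a uᵀ)(b vᵀ) is (u·b)(v·a). -/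
lemma trace_sq_of_rank_three {ι : Type*} [Fintype ι] (n : ℂ) (a b c u v w : ι → ℂ) :
    ((n • (vecMulVec a u + vecMulVec b v + vecMulVec c w)) *
      (n • (vecMulVec a u + vecMulVec b v + vecMulVec c w))).trace =
    n ^ 2 * ((u ⬝ᵥ a) ^ 2 + (v ⬝ᵥ b) ^ 2 + (w ⬝ᵥ c) ^ 2 + 2 * (u ⬝ᵥ b) * (v ⬝ᵥ a)
      + 2 * (u ⬝ᵥ c) * (w ⬝ᵥ a) + 2 * (v ⬝ᵥ c) * (w ⬝ᵥ b)) := by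
  simp only [Matrix.smul_mul, Matrix.mul_smul, trace_smul, Matrix.add_mul, Matrix.mul_add,
    vecMulVec_mul_vecMulVec, trace_add, trace_vecMulVec, smul_dotProduct, smul_eq_mul,
    dotProduct_comm a, dotProduct_comm b, dotProduct_comm c]
  ring

/-- This is where the second factor of μ² comes from: 2se₁e₂ − f₁f₂ − 1 divides all nine scalar
products, and n times its square is twice that factor. -/
lemma discriminant_param :
    (x₁ * x₂ - 2 * l ^ 2 * s) * (2 * s * e₁ * e₂ - f₁ * f₂ - 1) ^ 2 =
      2 * (2 * s ^ 2 - 2 * ((param l s x₁ x₂ e₁ e₂ f₁ f₂).h + l ^ 2 / 2) * s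
        + (param l s x₁ x₂ e₁ e₂ f₁ f₂).p2) := by
  simp only [param, Coords.h, Coords.p2]
  ring

lemma trace_linL_param (hp : p = (param l s x₁ x₂ e₁ e₂ f₁ f₂).p2)
    (hr₁ : r = -2 * s * (x₁ + (x₁ * x₂ - 2 * l ^ 2 * s) * e₁ ^ 2))
    (hr₂ : r = -2 * s * (x₂ + (x₁ * x₂ - 2 * l ^ 2 * s) * e₂ ^ 2)) :
    s * (linL l s p r (param l s x₁ x₂ e₁ e₂ f₁ f₂) *
        linL l s p r (param l s x₁ x₂ e₁ e₂ f₁ f₂)).trace =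
      2 * (8 * l ^ 2 * s ^ 3 - r ^ 2) *
        (2 * s ^ 2 - 2 * ((param l s x₁ x₂ e₁ e₂ f₁ f₂).h + l ^ 2 / 2) * s + p) := by
  have hd := discriminant_param (l := l) (s := s) (x₁ := x₁) (x₂ := x₂) (e₁ := e₁) (e₂ := e₂)
    (f₁ := f₁) (f₂ := f₂)
  -- Multiplying the two expressions for `r` makes the result symmetric in the indices 1 and 2.
  have hrr : r ^ 2 = 4 * s ^ 2 * (x₁ + (x₁ * x₂ - 2 * l ^ 2 * s) * e₁ ^ 2) *
      (x₂ + (x₁ * x₂ - 2 * l ^ 2 * s) * e₂ ^ 2) := by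
    rw [sq]
    nth_rewrite 1 [hr₁]
    rw [hr₂]
    ring
  rw [linL_param hp hr₁ hr₂, trace_sq_of_rank_three, hp, hrr,
    rowU_dotProduct_colA, rowU_dotProduct_colB, rowU_dotProduct_colC, rowV_dotProduct_colA,
    rowV_dotProduct_colB, rowV_dotProduct_colC, rowW_dotProduct_colA, rowW_dotProduct_colB,
    rowW_dotProduct_colC]
  -- The first factor of μ² enters through 8l²s³ − r ^ 2 = −4s²n((x₁e₂² + 1)(x₂e₁² + 1) − 2l²s
  -- e₁²e₂²), with n = x₁x₂ − 2l²s.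
  linear_combination -4 * s ^ 2 * (x₁ * x₂ - 2 * l ^ 2 * s) *
    ((x₁ * e₂ ^ 2 + 1) * (x₂ * e₁ ^ 2 + 1) - 2 * l ^ 2 * s * e₁ ^ 2 * e₂ ^ 2) * hd
end

end

/-! ### Generic points of 𝓜₂ and the parametrization -/

section

/-- The generic points of `𝓜₂` are covered by the parametrization. -/
lemma eq_param {l x₁ x₂ y₁ y₂ z₁ z₂ w₁ w₂ w₃ s : ℂ} (hl : l ≠ 0)
    (hD : w₁ * w₂ + l * w₃ ≠ 0) (hX₁ : w₂ * x₁ + l * z₁ ≠ 0) (hX₂ : w₁ * x₂ + l * z₂ ≠ 0)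
    (hy₁ : y₁ = rhs l x₁ x₂ z₁ z₂ w₁ w₂ w₃) (hy₂ : y₂ = rhs l x₂ x₁ z₂ z₁ w₂ w₁ w₃)
    (hs : s = (x₁ * x₂ - (w₂ * x₁ + l * z₁) * (w₁ * x₂ + l * z₂) / (w₁ * w₂ + l * w₃)) /
      (2 * l ^ 2)) :
    (⟨x₁, x₂, y₁, y₂, z₁, z₂, w₁, w₂, w₃⟩ : Coords) = param l s x₁ x₂
      ((w₁ * w₂ + l * w₃) / (w₁ * x₂ + l * z₂)) ((w₁ * w₂ + l * w₃) / (w₂ * x₁ + l * z₁))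
      ((w₁ - x₁ * ((w₁ * w₂ + l * w₃) / (w₂ * x₁ + l * z₁))) / l)
      ((w₂ - x₂ * ((w₁ * w₂ + l * w₃) / (w₁ * x₂ + l * z₂))) / l) := by
  have hD' : w₂ * w₁ + l * w₃ ≠ 0 := by rwa [mul_comm w₂]
  rw [rhs] at hy₁ hy₂
  -- D, X₁, X₂ replace w₃, z₁, z₂ as free variables, so that all denominators are monomials. Then e₁
  -- = D/X₂, e₂ = D/X₁, x₁x₂ − 2l²s = X₁X₂/D, and f₁, f₂ are chosen to fit w₁, w₂.
  obtain ⟨D, hDe⟩ : ∃ D, D = w₁ * w₂ + l * w₃ := ⟨_, rfl⟩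
  obtain ⟨X₁, hX₁e⟩ : ∃ X, X = w₂ * x₁ + l * z₁ := ⟨_, rfl⟩
  obtain ⟨X₂, hX₂e⟩ : ∃ X, X = w₁ * x₂ + l * z₂ := ⟨_, rfl⟩
  have hw₃ : w₃ = (D - w₁ * w₂) / l := by rw [hDe]; field_simp; ring
  have hz₁ : z₁ = (X₁ - w₂ * x₁) / l := by rw [hX₁e]; field_simp; ring
  have hz₂ : z₂ = (X₂ - w₁ * x₂) / l := by rw [hX₂e]; field_simp; ring
  rw [mul_comm w₂ w₁] at hy₂
  rw [← hDe] at hD hs hy₁ hy₂ ⊢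
  rw [← hX₁e] at hX₁ hs hy₁ ⊢
  rw [← hX₂e] at hX₂ hs hy₂ ⊢
  clear hDe hX₁e hX₂e hD'
  subst hw₃ hz₁ hz₂ hs hy₁ hy₂
  simp only [param, Coords.mk.injEq, true_and]
  refine ⟨?_, ?_, ?_, ?_, ?_, ?_, ?_⟩
  all_goals
    field_simp
    try ring

end

/-! ### First integrals and Casimir functions in complex coordinates -/

lemma cx₂_eq_conj (x : Phase) : cx₂ x = (starRingEnd ℂ) (cx₁ x) := rfl
lemma cz₂_eq_conj (x : Phase) : cz₂ x = (starRingEnd ℂ) (cz₁ x) := rfl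
lemma cw₂_eq_conj (x : Phase) : cw₂ x = (starRingEnd ℂ) (cw₁ x) := rfl

/-- The first integral `K` as a function of the complex coordinates. -/
def Coords.k (l : ℂ) (q : Coords) : ℂ :=
  (q.w₁ ^ 2 + q.x₁) * (q.w₂ ^ 2 + q.x₂)
    + 2 * l * ((q.w₃ - l) * q.w₁ * q.w₂ + q.w₁ * q.z₂ + q.w₂ * q.z₁)

/-- The first integral `G` as a function of the complex coordinates. -/
def Coords.g (l p r : ℂ) (q : Coords) : ℂ :=
  1 / 4 * (q.x₁ * q.w₂ + q.y₂ * q.w₁ + (q.w₃ + l) * q.z₁)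
      * (q.x₂ * q.w₁ + q.y₁ * q.w₂ + (q.w₃ + l) * q.z₂)
    + 1 / 2 * (q.w₃ - l) * (1 / 2 * (q.w₂ * (q.z₂ * q.x₁ - q.z₁ * q.y₁)
      + q.w₁ * (q.z₁ * q.x₂ - q.z₂ * q.y₂)) + 1 / 4 * (q.w₃ + l) * (q.y₁ * q.y₂ - q.x₁ * q.x₂))
    - p / 4 * (q.y₁ + q.y₂) + r / 4 * (q.x₁ + q.x₂)

lemma intH_eq_coords (x : Phase) : (intH x : ℂ) = (coords x).h := by
  apply Complex.ext <;>
  · simp [intH, Coords.h, coords, cy₁, cy₂, cw₁, cw₂, cw₃, pow_two]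
    ring

lemma intK_eq_coords (lam : ℝ) (x : Phase) : (intK lam x : ℂ) = (coords x).k lam := by
  apply Complex.ext <;>
  · simp [intK, Coords.k, coords, cx₁, cx₂, cz₁, cz₂, cw₁, cw₂, cw₃, pow_two]
    ring

lemma intG_eq_coords (a b lam : ℝ) (x : Phase) :
    (intG a b lam x : ℂ) = (coords x).g lam (a ^ 2 + b ^ 2) (a ^ 2 - b ^ 2) := by
  apply Complex.ext <;>
  · simp [intG, Coords.g, coords, cx₁, cx₂, cy₁, cy₂, cz₁, cz₂, cw₁, cw₂, cw₃, pow_two, momentum,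
      dotProduct, Fin.sum_univ_three, cross_apply]
    ring

lemma casimir_p (a b : ℝ) {x : Phase} (hx : x ∈ phaseSpace a b) :
    (a : ℂ) ^ 2 + b ^ 2 = (coords x).p2 := by
  obtain ⟨h1, h2, h3⟩ := phaseSpace_eqs hx
  apply Complex.ext
  · simp [Coords.p2, coords, cx₁, cx₂, cy₁, cy₂, cz₁, cz₂, pow_two]
    linear_combination -h1 - h2
  · simp [Coords.p2, coords, cx₁, cx₂, cy₁, cy₂, cz₁, cz₂, pow_two]
    ring

/-- The right side is the complex square (α + iβ)·(α + iβ) = |α|² − |β|² + 2i α·β. -/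
lemma casimir_r (a b : ℝ) {x : Phase} (hx : x ∈ phaseSpace a b) :
    (a : ℂ) ^ 2 - b ^ 2 = cz₁ x ^ 2 + cx₁ x * cy₂ x := by
  obtain ⟨h1, h2, h3⟩ := phaseSpace_eqs hx
  apply Complex.ext
  · simp [cx₁, cy₂, cz₁, pow_two]
    linear_combination -h1 + h2
  · simp [cx₁, cy₂, cz₁, pow_two]
    linear_combination -2 * h3

lemma casimir_r' (a b : ℝ) {x : Phase} (hx : x ∈ phaseSpace a b) :
    (a : ℂ) ^ 2 - b ^ 2 = cz₂ x ^ 2 + cx₂ x * cy₁ x := by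
  obtain ⟨h1, h2, h3⟩ := phaseSpace_eqs hx
  apply Complex.ext
  · simp [cx₂, cy₁, cz₂, pow_two]
    linear_combination -h1 + h2
  · simp [cx₂, cy₁, cz₂, pow_two]
    linear_combination 2 * h3

section
variable {l s p r x₁ x₂ e₁ e₂ f₁ f₂ : ℂ}

/-- Multiplied by 4s², the equation of Π₂ for k is polynomial in s, the form in which it passes to
limits; the same is done for g with 4s. -/
lemma k_param (hr₁ : r = -2 * s * (x₁ + (x₁ * x₂ - 2 * l ^ 2 * s) * e₁ ^ 2))
    (hr₂ : r = -2 * s * (x₂ + (x₁ * x₂ - 2 * l ^ 2 * s) * e₂ ^ 2)) :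
    4 * s ^ 2 * (param l s x₁ x₂ e₁ e₂ f₁ f₂).k l =
      4 * s ^ 2 * (-2 * l ^ 2 * ((param l s x₁ x₂ e₁ e₂ f₁ f₂).h - l ^ 2 / 2 - 2 * s) - l ^ 4)
        + r ^ 2 := by
  have hrr : r ^ 2 = 4 * s ^ 2 * (x₁ + (x₁ * x₂ - 2 * l ^ 2 * s) * e₁ ^ 2) *
      (x₂ + (x₁ * x₂ - 2 * l ^ 2 * s) * e₂ ^ 2) := by
    rw [sq]
    nth_rewrite 1 [hr₁]
    rw [hr₂]
    ring
  rw [hrr]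
  simp only [Coords.k, Coords.h, param]
  ring

lemma g_param (hp : p = (param l s x₁ x₂ e₁ e₂ f₁ f₂).p2)
    (hr₁ : r = -2 * s * (x₁ + (x₁ * x₂ - 2 * l ^ 2 * s) * e₁ ^ 2))
    (hr₂ : r = -2 * s * (x₂ + (x₁ * x₂ - 2 * l ^ 2 * s) * e₂ ^ 2)) :
    4 * s * (param l s x₁ x₂ e₁ e₂ f₁ f₂).g l p r =
      4 * s * (1 / 2 * p * ((param l s x₁ x₂ e₁ e₂ f₁ f₂).h + l ^ 2 / 2) - l ^ 2 * s ^ 2)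
        - r ^ 2 := by
  have hrr : r ^ 2 = 4 * s ^ 2 * (x₁ + (x₁ * x₂ - 2 * l ^ 2 * s) * e₁ ^ 2) *
      (x₂ + (x₁ * x₂ - 2 * l ^ 2 * s) * e₂ ^ 2) := by
    rw [sq]
    nth_rewrite 1 [hr₁]
    rw [hr₂]
    ring
  rw [hrr, hp]
  simp only [Coords.g, Coords.h, Coords.p2, param]
  linear_combination s * x₁ * hr₂ + s * x₂ * hr₁
end

/-! ### Polynomial relations between a point of 𝓜₂ and s -/

/-- The relations between a point `x` of `𝓜₂` and the corresponding value of the parameter `s`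
on `Π₂`, in polynomial form. -/
structure Related (a b lam : ℝ) (x : Phase) (s : ℝ) : Prop where
  mem : x ∈ phaseSpace a b
  field : fieldL lam s (a ^ 2 + b ^ 2) (a ^ 2 - b ^ 2) (coords x) = 0
  k_eq : 4 * s ^ 2 * intK lam x =
    4 * s ^ 2 * (-2 * lam ^ 2 * (intH x - lam ^ 2 / 2 - 2 * s) - lam ^ 4) + (a ^ 2 - b ^ 2) ^ 2
  g_eq : 4 * s * intG a b lam x =
    4 * s * (1 / 2 * (a ^ 2 + b ^ 2) * (intH x + lam ^ 2 / 2) - lam ^ 2 * s ^ 2)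
      - (a ^ 2 - b ^ 2) ^ 2
  trace_eq : (s : ℂ) * (linL lam s (a ^ 2 + b ^ 2) (a ^ 2 - b ^ 2) (coords x) *
        linL lam s (a ^ 2 + b ^ 2) (a ^ 2 - b ^ 2) (coords x)).trace =
      2 * (8 * lam ^ 2 * s ^ 3 - (a ^ 2 - b ^ 2) ^ 2) *
        (2 * s ^ 2 - 2 * (intH x + lam ^ 2 / 2) * s + (a ^ 2 + b ^ 2))

lemma exists_related_of_generic {a b lam : ℝ} (hlam : lam ≠ 0) {x : Phase}
    (hx : x ∈ subsystem₂Generic a b lam) : ∃ s, Related a b lam x s := by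
  obtain ⟨hm, hD, hX₁, hX₂, hy₁, hy₂⟩ := hx
  have hl : (lam : ℂ) ≠ 0 := by exact_mod_cast hlam
  -- The value of s is real because w₂x₁ + λz₁ and w₁x₂ + λz₂ are conjugate, while x₁x₂ and w₁w₂ +
  -- λw₃ are real.
  obtain ⟨s, hs⟩ : ∃ s : ℝ, (cx₁ x * cx₂ x - (cw₂ x * cx₁ x + lam * cz₁ x) *
      (cw₁ x * cx₂ x + lam * cz₂ x) / (cw₁ x * cw₂ x + lam * cw₃ x)) / (2 * lam ^ 2) = s := by
    apply Complex.conj_eq_iff_real.mp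
    simp only [cx₂_eq_conj, cz₂_eq_conj, cw₂_eq_conj, cw₃, map_div₀, map_sub, map_mul, map_add,
      map_pow, Complex.conj_conj, Complex.conj_ofReal, map_ofNat]
    ring
  have hq := eq_param hl hD hX₁ hX₂ hy₁ hy₂ hs.symm
  change coords x = _ at hq
  have hp := casimir_p a b hm
  have hr₁ := casimir_r a b hm
  have hr₂ := casimir_r' a b hm
  change _ = (coords x).z₁ ^ 2 + (coords x).x₁ * (coords x).y₂ at hr₁
  change _ = (coords x).z₂ ^ 2 + (coords x).x₂ * (coords x).y₁ at hr₂
  refine ⟨s, hm, ?_, ?_, ?_, ?_⟩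
  all_goals
    -- Only the form of `param` matters from here on: the identities hold for arbitrary x₁, x₂, e₁,
    -- e₂, f₁, f₂ satisfying the Casimir relations.
    generalize (cw₁ x * cw₂ x + lam * cw₃ x) / (cw₁ x * cx₂ x + lam * cz₂ x) = e₁ at hq
    generalize (cw₁ x * cw₂ x + lam * cw₃ x) / (cw₂ x * cx₁ x + lam * cz₁ x) = e₂ at hq
    generalize (cw₁ x - cx₁ x * e₂) / (lam : ℂ) = f₁ at hq
    generalize (cw₂ x - cx₂ x * e₁) / (lam : ℂ) = f₂ at hq
    generalize cx₁ x = x₁ at hq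
    generalize cx₂ x = x₂ at hq
    rw [hq] at hp hr₁ hr₂
    have hr₁' : (a : ℂ) ^ 2 - b ^ 2 = -2 * s * (x₁ + (x₁ * x₂ - 2 * lam ^ 2 * s) * e₁ ^ 2) := by
      rw [hr₁]; simp only [param]; ring
    have hr₂' : (a : ℂ) ^ 2 - b ^ 2 = -2 * s * (x₂ + (x₁ * x₂ - 2 * lam ^ 2 * s) * e₂ ^ 2) := by
      rw [hr₂]; simp only [param]; ring
  · rw [hq]
    exact fieldL_param hp hr₁' hr₂'
  · have := k_param (f₁ := f₁) (f₂ := f₂) hr₁' hr₂'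
    rw [← hq, ← intH_eq_coords, ← intK_eq_coords] at this
    exact_mod_cast this
  · have := g_param hp hr₁' hr₂'
    rw [← hq, ← intH_eq_coords, ← intG_eq_coords] at this
    have h2 : (4 : ℂ) * s * intG a b lam x = 4 * s * (1 / 2 * (a ^ 2 + b ^ 2) *
      (intH x + lam ^ 2 / 2) - lam ^ 2 * s ^ 2) - (a ^ 2 - b ^ 2) ^ 2 := this
    apply Complex.ofReal_injective
    push_cast
    exact h2
  · have := trace_linL_param hp hr₁' hr₂'
    rw [← hq, ← intH_eq_coords] at this
    exact this

/-! ### Passage to the closure -/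

section

set_option linter.unusedSimpArgs false

section
open Filter

@[fun_prop] lemma continuous_cx₁ : Continuous cx₁ :=
  differentiable_cx₁.continuous
@[fun_prop] lemma continuous_cx₂ : Continuous cx₂ :=
  differentiable_cx₂.continuous
@[fun_prop] lemma continuous_cy₁ : Continuous cy₁ :=
  differentiable_cy₁.continuous
@[fun_prop] lemma continuous_cy₂ : Continuous cy₂ :=
  differentiable_cy₂.continuous
@[fun_prop] lemma continuous_cz₁ : Continuous cz₁ :=
  differentiable_cz₁.continuous
@[fun_prop] lemma continuous_cz₂ : Continuous cz₂ :=
  differentiable_cz₂.continuous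
@[fun_prop] lemma continuous_cw₁ : Continuous cw₁ :=
  differentiable_cw₁.continuous
@[fun_prop] lemma continuous_cw₂ : Continuous cw₂ :=
  differentiable_cw₂.continuous
@[fun_prop] lemma continuous_cw₃ : Continuous cw₃ :=
  differentiable_cw₃.continuous

@[fun_prop] lemma continuous_intH : Continuous intH := contDiff_intH.continuous
@[fun_prop] lemma continuous_intK (lam : ℝ) : Continuous (intK lam) :=
    (contDiff_intK lam).continuous
@[fun_prop] lemma continuous_intG (a b lam : ℝ) : Continuous (intG a b lam) :=
  (contDiff_intG a b lam).continuous

lemma continuous_fieldL (l p r : ℂ) :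
    Continuous fun y : Phase × ℝ => fieldL l y.2 p r (coords y.1) := by
  refine continuous_pi fun k => ?_
  rcases k with k | k <;> fin_cases k <;>
  · simp only [fieldL, phiP, phiM, phi3, psiP, psiM, psi3, coords, Sum.elim_inl, Sum.elim_inr,
      Fin.zero_eta, Fin.mk_one, Fin.reduceFinMk, Matrix.cons_val_zero, Matrix.cons_val_one,
      Matrix.cons_val]
    fun_prop

lemma continuous_linL (l p r : ℂ) :
    Continuous fun y : Phase × ℝ => linL l y.2 p r (coords y.1) := by
  refine continuous_matrix fun i j => ?_
  rcases i with i | i <;> rcases j with j | j <;> fin_cases i <;> fin_cases j <;>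
  · simp only [linL, linφξ, linφm, linψξ, linψm, coords, Matrix.fromBlocks_apply₁₁,
      Matrix.fromBlocks_apply₁₂, Matrix.fromBlocks_apply₂₁, Matrix.fromBlocks_apply₂₂,
      Fin.zero_eta, Fin.mk_one, Fin.reduceFinMk, Matrix.of_apply, Matrix.cons_val_zero,
      Matrix.cons_val_one, Matrix.cons_val]
    fun_prop

lemma continuous_geom : Continuous geom := by
  unfold geom dotProduct
  fun_prop

lemma isClosed_related (a b lam : ℝ) : IsClosed {y : Phase × ℝ | Related a b lam y.1 y.2} := by
  have e : {y : Phase × ℝ | Related a b lam y.1 y.2} =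
      {y | geom y.1 = (a ^ 2, b ^ 2, 0)} ∩
      {y | fieldL lam y.2 (a ^ 2 + b ^ 2) (a ^ 2 - b ^ 2) (coords y.1) = 0} ∩
      {y | 4 * y.2 ^ 2 * intK lam y.1 = 4 * y.2 ^ 2 * (-2 * lam ^ 2 *
        (intH y.1 - lam ^ 2 / 2 - 2 * y.2) - lam ^ 4) + (a ^ 2 - b ^ 2) ^ 2} ∩
      {y | 4 * y.2 * intG a b lam y.1 = 4 * y.2 * (1 / 2 * (a ^ 2 + b ^ 2) *
        (intH y.1 + lam ^ 2 / 2) - lam ^ 2 * y.2 ^ 2) - (a ^ 2 - b ^ 2) ^ 2} ∩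
      {y | (y.2 : ℂ) * (linL lam y.2 (a ^ 2 + b ^ 2) (a ^ 2 - b ^ 2) (coords y.1) *
        linL lam y.2 (a ^ 2 + b ^ 2) (a ^ 2 - b ^ 2) (coords y.1)).trace =
        2 * (8 * lam ^ 2 * y.2 ^ 3 - (a ^ 2 - b ^ 2) ^ 2) *
        (2 * y.2 ^ 2 - 2 * (intH y.1 + lam ^ 2 / 2) * y.2 + (a ^ 2 + b ^ 2))} := by
    ext y
    constructor
    · rintro ⟨h1, h2, h3, h4, h5⟩
      exact ⟨⟨⟨⟨h1, h2⟩, h3⟩, h4⟩, h5⟩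
    · rintro ⟨⟨⟨⟨h1, h2⟩, h3⟩, h4⟩, h5⟩
      exact ⟨h1, h2, h3, h4, h5⟩
  rw [e]
  refine (((IsClosed.inter ?_ ?_).inter ?_).inter ?_).inter ?_
  · exact isClosed_eq (continuous_geom.comp continuous_fst) continuous_const
  · exact isClosed_eq (continuous_fieldL _ _ _) continuous_const
  · exact isClosed_eq (by fun_prop) (by fun_prop)
  · exact isClosed_eq (by fun_prop) (by fun_prop)
  · have hc := continuous_linL lam (a ^ 2 + b ^ 2) (a ^ 2 - b ^ 2)
    exact isClosed_eq (Continuous.mul (by fun_prop) (hc.mul hc).matrix_trace) (by fun_prop)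

/-- The relation for k is the cubic 16λ²s³ = 4κs² − r⁴. For |s| ≥ 1, dividing by s² bounds |s|, and
the bound is continuous in x. -/
lemma Related.abs_le {a b lam : ℝ} (hlam : lam ≠ 0) {x : Phase} {s : ℝ} (h : Related a b lam x s) :
    |s| ≤ 1 + (4 * |intK lam x + 2 * lam ^ 2 * (intH x - lam ^ 2 / 2) + lam ^ 4|
      + (a ^ 2 - b ^ 2) ^ 2) / (16 * lam ^ 2) := by
  have hl : 0 < 16 * lam ^ 2 := by positivity
  set κ := intK lam x + 2 * lam ^ 2 * (intH x - lam ^ 2 / 2) + lam ^ 4 with hκ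
  have h1 : 16 * lam ^ 2 * s ^ 3 = 4 * s ^ 2 * κ - (a ^ 2 - b ^ 2) ^ 2 := by
    rw [hκ]; linear_combination -h.k_eq
  rcases le_total |s| 1 with h2 | h2
  · have : 0 ≤ (4 * |κ| + (a ^ 2 - b ^ 2) ^ 2) / (16 * lam ^ 2) := by positivity
    linarith
  · have h3 : 16 * lam ^ 2 * |s| ^ 3 ≤ |s| ^ 2 * (4 * |κ| + (a ^ 2 - b ^ 2) ^ 2) := by
      calc 16 * lam ^ 2 * |s| ^ 3 = |16 * lam ^ 2 * s ^ 3| := by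
            rw [abs_mul, abs_pow, abs_of_pos hl]
        _ = |4 * s ^ 2 * κ - (a ^ 2 - b ^ 2) ^ 2| := by rw [h1]
        _ ≤ |4 * s ^ 2 * κ| + |(a ^ 2 - b ^ 2) ^ 2| := abs_sub _ _
        _ = |s| ^ 2 * (4 * |κ|) + (a ^ 2 - b ^ 2) ^ 2 := by
            rw [abs_mul, abs_mul, abs_of_nonneg (sq_nonneg (a ^ 2 - b ^ 2)), abs_pow]
            norm_num
            ring
        _ ≤ |s| ^ 2 * (4 * |κ|) + |s| ^ 2 * (a ^ 2 - b ^ 2) ^ 2 := by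
            have : 1 ≤ |s| ^ 2 := one_le_pow₀ h2
            nlinarith [sq_nonneg (a ^ 2 - b ^ 2)]
        _ = _ := by ring
    have h4 : 16 * lam ^ 2 * |s| ≤ 4 * |κ| + (a ^ 2 - b ^ 2) ^ 2 := by
      have h5 : 0 < |s| ^ 2 := by positivity
      refine le_of_mul_le_mul_left ?_ h5
      linarith [h3, show |s| ^ 2 * (16 * lam ^ 2 * |s|) = 16 * lam ^ 2 * |s| ^ 3 by ring]
    have : |s| ≤ (4 * |κ| + (a ^ 2 - b ^ 2) ^ 2) / (16 * lam ^ 2) := by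
      rw [le_div_iff₀ hl]; linarith
    linarith

/-- Along a sequence of generic points converging to x the parameters s are bounded; a convergent
subsequence supplies the value at x, since `Related` is closed in (x, s). -/
lemma exists_related {a b lam : ℝ} (hlam : lam ≠ 0) {x : Phase}
    (hx : x ∈ subsystem₂ a b lam) : ∃ s, Related a b lam x s := by
  obtain ⟨u, hu, hux⟩ := mem_closure_iff_seq_limit.1 hx
  choose s hs using fun n => exists_related_of_generic hlam (hu n)
  set f : Phase → ℝ := fun x => 1 + (4 * |intK lam x + 2 * lam ^ 2 * (intH x - lam ^ 2 / 2)
    + lam ^ 4| + (a ^ 2 - b ^ 2) ^ 2) / (16 * lam ^ 2) with hf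
  have hfc : Continuous f := by fun_prop
  obtain ⟨B, hB⟩ := ((hfc.tendsto x).comp hux).bddAbove_range
  have hsB : ∀ n, s n ∈ Metric.closedBall (0 : ℝ) B := fun n => by
    rw [mem_closedBall_zero_iff, Real.norm_eq_abs]
    exact ((hs n).abs_le hlam).trans (hB ⟨n, rfl⟩)
  obtain ⟨t, -, φ, hφ, ht⟩ := (isCompact_closedBall (0 : ℝ) B).tendsto_subseq hsB
  refine ⟨t, (isClosed_related a b lam).mem_of_tendsto
    ((hux.comp hφ.tendsto_atTop).prodMk_nhds ht) (Eventually.of_forall fun n => hs (φ n))⟩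

end

end

/-! ### Types of the points of `𝓜₂` -/

lemma sq_sub_sq_ne_zero {a b : ℝ} (hb : 0 < b) (hab : b < a) : a ^ 2 - b ^ 2 ≠ 0 := by
  have : 0 < a ^ 2 - b ^ 2 := by nlinarith
  exact this.ne'

/-- At s = 0 the relation for k would read 0 = r⁴. -/
lemma Related.ne_zero {a b lam : ℝ} (hb : 0 < b) (hab : b < a) {x : Phase} {s : ℝ}
    (h : Related a b lam x s) : s ≠ 0 := by
  rintro rfl
  have := h.k_eq
  simp only [ne_eq, OfNat.ofNat_ne_zero, not_false_eq_true, zero_pow, mul_zero, zero_mul,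
    zero_add] at this
  exact pow_ne_zero 2 (sq_sub_sq_ne_zero hb hab) this.symm

lemma Related.intJ_eq {a b lam : ℝ} (hb : 0 < b) (hab : b < a) {x : Phase} {s : ℝ}
    (h : Related a b lam x s) : intJ a b lam x = surf₂ a b lam (intH x, s) := by
  have hs := h.ne_zero hb hab
  simp only [intJ, surf₂, Prod.mk.injEq, true_and]
  constructor
  · have := h.k_eq
    field_simp
    linear_combination this
  · have := h.g_eq
    field_simp
    linear_combination 4 * this

/-- If s ≠ t, dividing the equalities of k and of g by s − t gives two relations; eliminating r⁴
leaves 4λ²st(s − t)² = 0. -/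
lemma surf₂_injective {a b lam : ℝ} (hlam : lam ≠ 0) {h h' s t : ℝ} (hs : s ≠ 0) (ht : t ≠ 0)
    (he : surf₂ a b lam (h, s) = surf₂ a b lam (h', t)) : h = h' ∧ s = t := by
  simp only [surf₂, Prod.mk.injEq] at he
  obtain ⟨rfl, hk, hg⟩ := he
  refine ⟨rfl, ?_⟩
  by_contra hne
  have hst : s - t ≠ 0 := sub_ne_zero.2 hne
  set r4 := (a ^ 2 - b ^ 2) ^ 2
  have h1 : 16 * lam ^ 2 * s ^ 2 * t ^ 2 = r4 * (s + t) := by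
    apply mul_left_cancel₀ hst
    field_simp at hk
    linear_combination hk
  have h2 : 4 * lam ^ 2 * s * t * (s + t) = r4 := by
    apply mul_left_cancel₀ hst
    field_simp at hg
    linear_combination -hg / 4
  have h3 : 4 * lam ^ 2 * s * t * (s - t) ^ 2 = 0 := by
    linear_combination (s + t) * h2 - h1
  have : 4 * lam ^ 2 * s * t * (s - t) ^ 2 ≠ 0 := by positivity
  exact this h3

/-- The linear functional `c₀ h + c₁ k + c₂ g`. -/
def valFunctional (c : Fin 3 → ℝ) : Val →ₗ[ℝ] ℝ where
  toFun P := c 0 * P.1 + c 1 * P.2.1 + c 2 * P.2.2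
  map_add' P Q := by simp only [Prod.fst_add, Prod.snd_add]; ring
  map_smul' t P := by
    simp only [Prod.smul_fst, Prod.smul_snd, smul_eq_mul, RingHom.id_apply]; ring

lemma valFunctional_apply (c : Fin 3 → ℝ) (P : Val) :
    valFunctional c P = c 0 * P.1 + c 1 * P.2.1 + c 2 * P.2.2 := rfl

/-- This turns critical combinations into linear functionals annihilating the image of dJ. A
functional with c₂ ≠ 0 bounds the rank by 2, and at rank 2 its kernel is that image. -/
lemma criticalAt_combo_iff (a b lam : ℝ) (c : Fin 3 → ℝ) (x : Phase) :
    CriticalAt (combo a b lam c) x ↔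
      (tangent x).map (fderiv ℝ (intJ a b lam) x).toLinearMap ≤
        LinearMap.ker (valFunctional c) := by
  rw [Submodule.map_le_iff_le_comap]
  refine forall₂_congr fun v _ => ?_
  rw [fderiv_combo, Submodule.mem_comap, LinearMap.mem_ker, valFunctional_apply]
  simp only [ContinuousLinearMap.coe_coe, fderiv_intJ]

lemma finrank_ker_valFunctional {c : Fin 3 → ℝ} (hc : c 2 ≠ 0) :
    Module.finrank ℝ (LinearMap.ker (valFunctional c)) = 2 := by
  have hs : Function.Surjective (valFunctional c) := fun t =>
    ⟨(0, 0, t / c 2), by rw [valFunctional_apply]; field_simp; ring⟩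
  have h := LinearMap.finrank_range_add_finrank_ker (valFunctional c)
  rw [LinearMap.range_eq_top.2 hs, finrank_top] at h
  simp only [Module.finrank_prod, Module.finrank_self] at h
  omega

lemma rankJ_le_two {a b lam : ℝ} {c : Fin 3 → ℝ} (hc : c 2 ≠ 0) {x : Phase}
    (h : CriticalAt (combo a b lam c) x) : rankJ a b lam x ≤ 2 := by
  rw [← finrank_ker_valFunctional hc]
  exact Submodule.finrank_mono ((criticalAt_combo_iff a b lam c x).1 h)

/-- At a point of rank 2 the critical integral is unique up to a factor. -/
lemma eq_smul_of_criticalAt {a b lam : ℝ} {c d : Fin 3 → ℝ} (hc : c 2 ≠ 0) {x : Phase}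
    (h : CriticalAt (combo a b lam c) x) (hr : rankJ a b lam x = 2)
    (hd : CriticalAt (combo a b lam d) x) : d = (d 2 / c 2) • c := by
  rw [criticalAt_combo_iff] at h hd
  have e := Submodule.eq_of_le_of_finrank_eq h (hr.trans (finrank_ker_valFunctional hc).symm)
  rw [e] at hd
  -- The vectors (c₂, 0, −c₀) and (0, c₂, −c₁) span the kernel of the functional c, because c₂ ≠ 0.
  have h1 : valFunctional d (c 2, 0, -c 0) = 0 := hd (by
    rw [LinearMap.mem_ker, valFunctional_apply]; ring)
  have h2 : valFunctional d (0, c 2, -c 1) = 0 := hd (by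
    rw [LinearMap.mem_ker, valFunctional_apply]; ring)
  rw [valFunctional_apply] at h1 h2
  ext i
  fin_cases i
  · simp only [Fin.zero_eta, Pi.smul_apply, smul_eq_mul]
    field_simp
    linear_combination h1
  · simp only [Fin.mk_one, Pi.smul_apply, smul_eq_mul]
    field_simp
    linear_combination h2
  · simp only [Fin.reduceFinMk, Pi.smul_apply, smul_eq_mul]
    field_simp

/-- A linear relation between the Hamiltonian vectors of H and K is a critical combination with no
G-term; being a multiple of c with c₂ ≠ 0, it is trivial. -/
lemma linearIndependent_reducedField {a b lam : ℝ} (hb : 0 < b) (hab : b < a)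
    {c : Fin 3 → ℝ} (hc : c 2 ≠ 0) {x : Phase} (hx : x ∈ phaseSpace a b)
    (h : CriticalAt (combo a b lam c) x) (hr : rankJ a b lam x = 2) :
    LinearIndependent ℝ ![reducedField lam intH x, reducedField lam (intK lam) x] := by
  rw [LinearIndependent.pair_iff]
  intro α β hαβ
  have h0 : reducedField lam (combo a b lam ![α, β, 0]) x = 0 := by
    rw [reducedField_combo]
    simpa using hαβ
  have e := eq_smul_of_criticalAt hc h hr (criticalAt_of_reducedField_eq_zero hb hab hx h0)
  have e0 := congrFun e 0
  have e1 := congrFun e 1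
  simp at e0 e1
  exact ⟨e0, e1⟩

lemma reducedField_combo_smul (a b lam t : ℝ) (c : Fin 3 → ℝ) :
    reducedField lam (combo a b lam (t • c)) = fun y => t • reducedField lam
        (combo a b lam c) y := by
  funext y
  rw [reducedField_combo, reducedField_combo]
  simp only [Pi.smul_apply, smul_eq_mul, smul_add, smul_smul]

lemma reducedLin_combo_smul (a b lam t : ℝ) (c : Fin 3 → ℝ) (x : Phase) :
    reducedLin lam (combo a b lam (t • c)) x = t • reducedLin lam (combo a b lam c) x := by
  have hd : DifferentiableAt ℝ (reducedField lam (combo a b lam c)) x :=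
    (contDiff_reducedField lam (contDiff_combo a b lam c)).differentiable (by simp) x
  unfold reducedLin
  rw [reducedField_combo_smul, fderiv_fun_const_smul hd]
  rfl

lemma coeffL_two (a b lam s : ℝ) : coeffL a b lam s 2 = 2 := rfl

lemma Related.reducedField_eq_zero {a b lam : ℝ} {x : Phase} {s : ℝ} (h : Related a b lam x s) :
    reducedField lam (combo a b lam (coeffL a b lam s)) x = 0 :=
  reducedField_eq_zero_of_fieldL h.field

lemma Related.criticalAt {a b lam : ℝ} (hb : 0 < b) (hab : b < a) {x : Phase} {s : ℝ}
    (h : Related a b lam x s) : CriticalAt (combo a b lam (coeffL a b lam s)) x :=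
  criticalAt_of_reducedField_eq_zero hb hab h.mem h.reducedField_eq_zero

lemma Related.trace {a b lam : ℝ} (hb : 0 < b) (hab : b < a) {x : Phase} {s : ℝ}
    (h : Related a b lam x s) :
    LinearMap.trace ℝ _ (reducedLin lam (combo a b lam (coeffL a b lam s)) x ∘ₗ
        reducedLin lam (combo a b lam (coeffL a b lam s)) x) = 2 * muSq a b lam (intH x) s := by
  have hs := h.ne_zero hb hab
  have h1 := trace_reducedLin a b lam s x
  have h2 := h.trace_eq
  rw [← neg_eq_iff_eq_neg] at h1
  rw [← h1] at h2
  generalize LinearMap.trace ℝ _ (reducedLin lam (combo a b lam (coeffL a b lam s)) x ∘ₗ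
        reducedLin lam (combo a b lam (coeffL a b lam s)) x) = T at h2
  have h3 : s * -T = 2 * (8 * lam ^ 2 * s ^ 3 - (a ^ 2 - b ^ 2) ^ 2) *
        (2 * s ^ 2 - 2 * (intH x + lam ^ 2 / 2) * s + (a ^ 2 + b ^ 2)) := by
    apply Complex.ofReal_injective
    push_cast
    exact h2
  rw [muSq]
  field_simp
  linear_combination -h3

lemma Related.hasExponentSq_smul_iff {a b lam : ℝ} (hb : 0 < b) (hab : b < a) {x : Phase} {s : ℝ}
    (h : Related a b lam x s) (hr : rankJ a b lam x = 2) (t C : ℝ) :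
    HasExponentSq lam (combo a b lam (t • coeffL a b lam s)) x C ↔
      C = t ^ 2 * muSq a b lam (intH x) s := by
  have h0 : reducedField lam (combo a b lam (t • coeffL a b lam s)) x = 0 := by
    rw [reducedField_combo_smul]
    simp only [h.reducedField_eq_zero, smul_zero]
  have hind := linearIndependent_reducedField hb hab (by rw [coeffL_two]; norm_num) h.mem
    (h.criticalAt hb hab) hr
  rw [hasExponentSq_iff hb hab (contDiff_combo a b lam _) h.mem h0,
    charpoly_reducedLin h.mem h0 hind, reducedLin_combo_smul, LinearMap.smul_comp,
    LinearMap.comp_smul, smul_smul, map_smul, h.trace hb hab]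
  have e : (t * t) • (2 * muSq a b lam (intH x) s) / 2 = t ^ 2 * muSq a b lam (intH x) s := by
    rw [smul_eq_mul]; ring
  rw [e]
  constructor
  · intro hC
    -- At X = 1 the polynomial X⁴(X² − C) takes the value 1 − C, which recovers C.
    have := congrArg (Polynomial.eval 1) hC
    simp only [Polynomial.eval_mul, Polynomial.eval_pow, Polynomial.eval_X, one_pow,
      Polynomial.eval_sub, Polynomial.eval_C, one_mul] at this
    linarith
  · rintro rfl
    rfl

lemma Related.hasExponentSq {a b lam : ℝ} (hb : 0 < b) (hab : b < a) {x : Phase} {s : ℝ}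
    (h : Related a b lam x s) (hr : rankJ a b lam x = 2) :
    HasExponentSq lam (combo a b lam (coeffL a b lam s)) x (muSq a b lam (intH x) s) := by
  have := (h.hasExponentSq_smul_iff hb hab hr 1 (muSq a b lam (intH x) s)).2 (by ring)
  rwa [one_smul] at this

lemma coeffL_ne_zero (a b lam s : ℝ) : coeffL a b lam s ≠ 0 := fun h => by
  have := congrFun h 2
  rw [coeffL_two] at this
  norm_num at this

/-- Squares of the characteristic exponents at a point of rank 2 are positive multiples of `μ²`. -/
lemma Related.exists_exponent_iff {a b lam : ℝ} (hb : 0 < b) (hab : b < a) {x : Phase} {s : ℝ}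
    (h : Related a b lam x s) (hr : rankJ a b lam x = 2) (P : ℝ → Prop)
    (hP : ∀ t y, 0 < t → P (t * y) → P y) :
    (∃ c : Fin 3 → ℝ, c ≠ 0 ∧ ∃ C, P C ∧ HasExponentSq lam (combo a b lam c) x C) ↔
      P (muSq a b lam (intH x) s) := by
  constructor
  · rintro ⟨c, hc, C, hC, hE⟩
    have e := eq_smul_of_criticalAt (by rw [coeffL_two]; norm_num) (h.criticalAt hb hab) hr hE.1
    rw [e, h.hasExponentSq_smul_iff hb hab hr] at hE
    rw [hE] at hC
    -- The factor is (c₂/2)², positive because c ≠ 0 is proportional to `coeffL`.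
    refine hP _ _ (by
      have : c 2 / coeffL a b lam s 2 ≠ 0 := fun h0 => hc (by rw [e, h0, zero_smul])
      positivity) hC
  · intro hμ
    exact ⟨_, coeffL_ne_zero a b lam s, _, hμ, h.hasExponentSq hb hab hr⟩

lemma Related.isCenter_iff {a b lam : ℝ} (hb : 0 < b) (hab : b < a) {x : Phase} {s : ℝ}
    (h : Related a b lam x s) (hr : rankJ a b lam x = 2) :
    IsCenter a b lam x ↔ muSq a b lam (intH x) s < 0 := by
  rw [← h.exists_exponent_iff hb hab hr (fun y => y < 0)
    (fun t y ht hy => by by_contra hn; exact absurd hy (not_lt.2 (mul_nonneg ht.le (not_lt.1 hn)))),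
    IsCenter, and_iff_right hr]

lemma Related.isSaddle_iff {a b lam : ℝ} (hb : 0 < b) (hab : b < a) {x : Phase} {s : ℝ}
    (h : Related a b lam x s) (hr : rankJ a b lam x = 2) :
    IsSaddle a b lam x ↔ 0 < muSq a b lam (intH x) s := by
  rw [← h.exists_exponent_iff hb hab hr (fun y => 0 < y)
    (fun t y ht hy => pos_of_mul_pos_right hy ht.le), IsSaddle, and_iff_right hr]

lemma Related.isDegenerate_iff {a b lam : ℝ} (hb : 0 < b) (hab : b < a) {x : Phase} {s : ℝ}
    (h : Related a b lam x s) (hr : rankJ a b lam x = 2) :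
    IsDegenerate a b lam x ↔ muSq a b lam (intH x) s = 0 := by
  rw [IsDegenerate, and_iff_right hr, h.exists_exponent_iff hb hab hr (fun y => y ≠ 0)
    (fun t y _ hy => right_ne_zero_of_mul hy), not_not]

/-! ### Derivatives of the parametrizations of `Π₁`, `Π₂` -/

section
open Filter

lemma hasDerivAt_sq (s : ℝ) : HasDerivAt (fun t : ℝ => t ^ 2) (2 * s) s := by
  simpa using hasDerivAt_pow 2 s

lemma hasDerivAt_div_sq (c : ℝ) {s : ℝ} (hs : s ≠ 0) :
    HasDerivAt (fun t : ℝ => c / (4 * t ^ 2)) (-(c / (2 * s ^ 3))) s := by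
  refine ((hasDerivAt_const s c).fun_div ((hasDerivAt_sq s).const_mul 4)
    (mul_ne_zero four_ne_zero (pow_ne_zero 2 hs))).congr_deriv ?_
  field_simp
  ring

lemma hasDerivAt_div_id (c : ℝ) {s : ℝ} (hs : s ≠ 0) :
    HasDerivAt (fun t : ℝ => c / (4 * t)) (-(c / (4 * s ^ 2))) s := by
  refine ((hasDerivAt_const s c).fun_div ((hasDerivAt_id' s).const_mul 4)
    (mul_ne_zero four_ne_zero hs)).congr_deriv ?_
  field_simp
  ring

/-- The coefficients are arranged to show ∂ₛ = φ·(0, 1, −s/2) with φ = 4λ² − r⁴/(2s³). The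
derivative of Π₁ below has the same shape with another scalar factor. -/
lemma hasFDerivAt_surf₂ (a b lam h : ℝ) {s : ℝ} (hs : s ≠ 0) :
    HasFDerivAt (surf₂ a b lam)
      ((ContinuousLinearMap.fst ℝ ℝ ℝ).prod
        ((-2 * lam ^ 2) • ContinuousLinearMap.fst ℝ ℝ ℝ
          + (4 * lam ^ 2 - (a ^ 2 - b ^ 2) ^ 2 / (2 * s ^ 3)) •
              ContinuousLinearMap.snd ℝ ℝ ℝ |>.prod
        (((a ^ 2 + b ^ 2) / 2) • ContinuousLinearMap.fst ℝ ℝ ℝ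
          + (-(s / 2) * (4 * lam ^ 2 - (a ^ 2 - b ^ 2) ^ 2 / (2 * s ^ 3))) •
            ContinuousLinearMap.snd ℝ ℝ ℝ))) (h, s) := by
  have h1 : HasFDerivAt (fun q : ℝ × ℝ => q.1) (ContinuousLinearMap.fst ℝ ℝ ℝ) (h, s) :=
    hasFDerivAt_fst
  have hsnd : HasFDerivAt (fun q : ℝ × ℝ => q.2) (ContinuousLinearMap.snd ℝ ℝ ℝ) (h, s) :=
    hasFDerivAt_snd
  have hφ : HasDerivAt (fun t : ℝ => 4 * lam ^ 2 * t + (a ^ 2 - b ^ 2) ^ 2 / (4 * t ^ 2))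
      (4 * lam ^ 2 - (a ^ 2 - b ^ 2) ^ 2 / (2 * s ^ 3)) s := by
    refine (((hasDerivAt_id' s).const_mul (4 * lam ^ 2)).fun_add
      (hasDerivAt_div_sq ((a ^ 2 - b ^ 2) ^ 2) hs)).congr_deriv ?_
    ring
  have hψ : HasDerivAt (fun t : ℝ => -lam ^ 2 * t ^ 2 - (a ^ 2 - b ^ 2) ^ 2 / (4 * t))
      (-(s / 2) * (4 * lam ^ 2 - (a ^ 2 - b ^ 2) ^ 2 / (2 * s ^ 3))) s := by
    refine (((hasDerivAt_sq s).const_mul (-lam ^ 2)).fun_sub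
      (hasDerivAt_div_id ((a ^ 2 - b ^ 2) ^ 2) hs)).congr_deriv ?_
    field_simp
    ring
  have hk := (h1.const_mul (-2 * lam ^ 2)).add (hφ.comp_hasFDerivAt (h, s) hsnd)
  have hg := ((h1.const_mul ((a ^ 2 + b ^ 2) / 2)).add
    (hψ.comp_hasFDerivAt (h, s) hsnd)).add_const ((a ^ 2 + b ^ 2) / 2 * (lam ^ 2 / 2))
  refine (h1.prodMk (hk.prodMk hg)).congr_of_eventuallyEq (Eventually.of_forall fun q => ?_)
  simp only [surf₂, Prod.mk.injEq, Pi.add_apply, Function.comp, true_and]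
  constructor <;> ring

lemma fderiv_surf₂ (a b lam h : ℝ) {s : ℝ} (hs : s ≠ 0) (v : ℝ × ℝ) :
    fderiv ℝ (surf₂ a b lam) (h, s) v =
      (v.1, -2 * lam ^ 2 * v.1 + (4 * lam ^ 2 - (a ^ 2 - b ^ 2) ^ 2 / (2 * s ^ 3)) * v.2,
        (a ^ 2 + b ^ 2) / 2 * v.1
          - s / 2 * ((4 * lam ^ 2 - (a ^ 2 - b ^ 2) ^ 2 / (2 * s ^ 3)) * v.2)) := by
  rw [(hasFDerivAt_surf₂ a b lam h hs).fderiv]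
  simp only [ContinuousLinearMap.prod_apply, add_apply,
    smul_apply, ContinuousLinearMap.coe_fst', ContinuousLinearMap.coe_snd',
    smul_eq_mul, Prod.mk.injEq, true_and]
  ring

lemma hasFDerivAt_surf₁ (a b lam h : ℝ) {s : ℝ} (hs : s ≠ 0) :
    HasFDerivAt (surf₁ a b lam)
      ((ContinuousLinearMap.fst ℝ ℝ ℝ).prod
        ((2 * (h - lam ^ 2 / 2) - 4 * s) • ContinuousLinearMap.fst ℝ ℝ ℝ
          + (-4 * (h - lam ^ 2 / 2) + 6 * s
            + ((a ^ 2 + b ^ 2) ^ 2 - (a ^ 2 - b ^ 2) ^ 2) / (2 * s ^ 3)) •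
            ContinuousLinearMap.snd ℝ ℝ ℝ |>.prod
        (s ^ 2 • ContinuousLinearMap.fst ℝ ℝ ℝ
          + (-(s / 2) * (-4 * (h - lam ^ 2 / 2) + 6 * s
            + ((a ^ 2 + b ^ 2) ^ 2 - (a ^ 2 - b ^ 2) ^ 2) / (2 * s ^ 3))) •
            ContinuousLinearMap.snd ℝ ℝ ℝ))) (h, s) := by
  have h1 : HasFDerivAt (fun q : ℝ × ℝ => q.1) (ContinuousLinearMap.fst ℝ ℝ ℝ) (h, s) :=
    hasFDerivAt_fst
  have h2 : HasFDerivAt (fun q : ℝ × ℝ => q.1 - lam ^ 2 / 2) (ContinuousLinearMap.fst ℝ ℝ ℝ)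
      (h, s) := h1.sub_const _
  have hsnd : HasFDerivAt (fun q : ℝ × ℝ => q.2) (ContinuousLinearMap.snd ℝ ℝ ℝ) (h, s) :=
    hasFDerivAt_snd
  set n := (a ^ 2 + b ^ 2) ^ 2 - (a ^ 2 - b ^ 2) ^ 2 with hn
  have hφ : HasDerivAt (fun t : ℝ => 3 * t ^ 2 - n / (4 * t ^ 2))
      (6 * s + n / (2 * s ^ 3)) s := by
    refine (((hasDerivAt_sq s).const_mul 3).fun_sub (hasDerivAt_div_sq n hs)).congr_deriv ?_
    ring
  have hψ : HasDerivAt (fun t : ℝ => -t ^ 3 + n / (4 * t))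
      (-3 * s ^ 2 - n / (4 * s ^ 2)) s := by
    refine ((hasDerivAt_pow 3 s).fun_neg.fun_add (hasDerivAt_div_id n hs)).congr_deriv ?_
    norm_num
    ring
  have hk := ((((h2.pow 2).sub ((h2.mul hsnd).const_mul 4)).add
    (hφ.comp_hasFDerivAt (h, s) hsnd))).add_const (a ^ 2 + b ^ 2)
  have hg := (h2.mul ((hasDerivAt_sq s).comp_hasFDerivAt (h, s) hsnd)).add (hψ.comp_hasFDerivAt
      (h, s) hsnd)
  refine ((h1.prodMk (hk.prodMk hg)).congr_of_eventuallyEq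
    (Eventually.of_forall fun q => ?_)).congr_fderiv ?_
  · simp only [surf₁, Prod.mk.injEq, Pi.add_apply, Pi.sub_apply, Pi.mul_apply,
      Function.comp, true_and]
    constructor <;> ring
  · ext <;> simp <;> field_simp <;> ring

lemma fderiv_surf₁ (a b lam h : ℝ) {s : ℝ} (hs : s ≠ 0) (v : ℝ × ℝ) :
    fderiv ℝ (surf₁ a b lam) (h, s) v =
      (v.1, (2 * (h - lam ^ 2 / 2) - 4 * s) * v.1 + (-4 * (h - lam ^ 2 / 2) + 6 * s
            + ((a ^ 2 + b ^ 2) ^ 2 - (a ^ 2 - b ^ 2) ^ 2) / (2 * s ^ 3)) * v.2,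
        s ^ 2 * v.1 - s / 2 * ((-4 * (h - lam ^ 2 / 2) + 6 * s
            + ((a ^ 2 + b ^ 2) ^ 2 - (a ^ 2 - b ^ 2) ^ 2) / (2 * s ^ 3)) * v.2)) := by
  rw [(hasFDerivAt_surf₁ a b lam h hs).fderiv]
  simp only [ContinuousLinearMap.prod_apply, add_apply,
    smul_apply, ContinuousLinearMap.coe_fst', ContinuousLinearMap.coe_snd',
    smul_eq_mul, Prod.mk.injEq, true_and]
  ring

end

/-! ### The curve of tangency -/

section
open Filter

lemma injective_fderiv_surf₂_iff (a b lam h : ℝ) {s : ℝ} (hs : s ≠ 0) :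
    Function.Injective (fderiv ℝ (surf₂ a b lam) (h, s)) ↔
      8 * lam ^ 2 * s ^ 3 - (a ^ 2 - b ^ 2) ^ 2 ≠ 0 := by
  have e : 4 * lam ^ 2 - (a ^ 2 - b ^ 2) ^ 2 / (2 * s ^ 3) =
      (8 * lam ^ 2 * s ^ 3 - (a ^ 2 - b ^ 2) ^ 2) / (2 * s ^ 3) := by
    field_simp
    ring
  rw [injective_iff_map_eq_zero]
  constructor
  · intro h0 h1
    have := h0 (0, 1) (by rw [fderiv_surf₂ a b lam h hs, e, h1]; simp)
    simp at this
  · intro h1 v hv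
    rw [fderiv_surf₂ a b lam h hs, e] at hv
    simp only [Prod.mk_eq_zero] at hv
    obtain ⟨hv1, hv2, -⟩ := hv
    rw [hv1, mul_zero, zero_add] at hv2
    exact Prod.ext hv1 ((mul_eq_zero.1 hv2).resolve_left (div_ne_zero h1 (by positivity)))

lemma injective_fderiv_surf₁_iff (a b lam h : ℝ) {s : ℝ} (hs : s ≠ 0) :
    Function.Injective (fderiv ℝ (surf₁ a b lam) (h, s)) ↔
      -4 * (h - lam ^ 2 / 2) + 6 * s
        + ((a ^ 2 + b ^ 2) ^ 2 - (a ^ 2 - b ^ 2) ^ 2) / (2 * s ^ 3) ≠ 0 := by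
  rw [injective_iff_map_eq_zero]
  constructor
  · intro h0 h1
    have := h0 (0, 1) (by rw [fderiv_surf₁ a b lam h hs, h1]; simp)
    simp at this
  · intro h1 v hv
    rw [fderiv_surf₁ a b lam h hs] at hv
    simp only [Prod.mk_eq_zero] at hv
    obtain ⟨hv1, hv2, -⟩ := hv
    rw [hv1, mul_zero, zero_add] at hv2
    exact Prod.ext hv1 ((mul_eq_zero.1 hv2).resolve_left h1)

/-- The curve on `Π₂` given by the vanishing of the second factor of `μ²`. -/
def discriminantCurve (a b lam : ℝ) : Set Val :=
  {P | ∃ h s : ℝ, s ≠ 0 ∧ surf₂ a b lam (h, s) = P ∧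
    2 * s ^ 2 - 2 * (h + lam ^ 2 / 2) * s + (a ^ 2 + b ^ 2) = 0}

lemma regularTangency_subset (a b lam : ℝ) :
    regularTangency a b lam ⊆ discriminantCurve a b lam := by
  rintro P ⟨⟨h, s⟩, ⟨h', t⟩, hs, ht, hP, hP', hi, -, hr⟩
  have hh : h = h' := congrArg Prod.fst (hP.trans hP'.symm)
  subst hh
  simp only at hs ht
  rw [injective_fderiv_surf₁_iff a b lam h hs] at hi
  set χ := -4 * (h - lam ^ 2 / 2) + 6 * s
        + ((a ^ 2 + b ^ 2) ^ 2 - (a ^ 2 - b ^ 2) ^ 2) / (2 * s ^ 3) with hχ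
  have key : ∀ v, ∃ w, fderiv ℝ (surf₂ a b lam) (h, t) w =
      fderiv ℝ (surf₁ a b lam) (h, s) v := fun v => by
    have : fderiv ℝ (surf₁ a b lam) (h, s) v ∈
        LinearMap.range (fderiv ℝ (surf₁ a b lam) (h, s)).toLinearMap := ⟨v, rfl⟩
    rw [hr] at this
    exact this
  -- The ∂ₛ-direction (0, 1, −s/2) of Π₁ has no h-component, so it must be proportional to the
  -- direction (0, 1, −t/2) of Π₂.
  have hst : s = t := by
    obtain ⟨w, hw⟩ := key (0, 1)
    rw [fderiv_surf₁ a b lam h hs, fderiv_surf₂ a b lam h ht, ← hχ] at hw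
    simp only [Prod.mk.injEq] at hw
    obtain ⟨h1, h2, h3⟩ := hw
    rw [h1] at h2 h3
    have : χ * (s - t) = 0 := by linear_combination 2 * h3 + t * h2
    exact sub_eq_zero.1 ((mul_eq_zero.1 this).resolve_left hi)
  subst hst
  refine ⟨h, s, hs, hP', ?_⟩
  -- The functional (k, g) ↦ 2g + sk kills both ∂ₛ-directions; applied to the ∂ₕ-vectors it gives
  -- the equation of the curve.
  obtain ⟨w, hw⟩ := key (1, 0)
  rw [fderiv_surf₁ a b lam h hs, fderiv_surf₂ a b lam h ht, ← hχ] at hw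
  simp only [Prod.mk.injEq] at hw
  obtain ⟨h1, h2, h3⟩ := hw
  rw [h1] at h2 h3
  linear_combination 2 * h3 + s * h2

lemma continuousAt_surf₂ (a b lam h : ℝ) {s : ℝ} (hs : s ≠ 0) :
    ContinuousAt (surf₂ a b lam) (h, s) := (hasFDerivAt_surf₂ a b lam h hs).continuousAt

/-- The quadratic equation gives |s| ≤ |h + λ²/2|, so s is bounded along convergent sequences, and
p² > 0 prevents a limit s = 0. -/
lemma isClosed_discriminantCurve {a b lam : ℝ} (hb : 0 < b) :
    IsClosed (discriminantCurve a b lam) := by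
  refine isSeqClosed_iff_isClosed.1 fun P Q hP hPQ => ?_
  choose h s hs he hd using hP
  have hh : Tendsto h atTop (𝓝 Q.1) := by
    have : h = fun n => (P n).1 := funext fun n => congrArg Prod.fst (he n)
    rw [this]
    exact (continuous_fst.tendsto Q).comp hPQ
  obtain ⟨B, hB⟩ := (hh.abs).bddAbove_range
  have hsB : ∀ n, s n ∈ Metric.closedBall (0 : ℝ) (B + lam ^ 2 / 2) := fun n => by
    rw [mem_closedBall_zero_iff, Real.norm_eq_abs]
    have h1 : |h n| ≤ B := hB ⟨n, rfl⟩
    have h2 : |s n| * |s n| ≤ |h n + lam ^ 2 / 2| * |s n| := by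
      have h3 : s n * s n ≤ (h n + lam ^ 2 / 2) * s n := by nlinarith [hd n, sq_nonneg a]
      rw [← abs_mul, ← abs_mul, abs_of_nonneg (mul_self_nonneg _)]
      exact h3.trans (le_abs_self _)
    have h4 : |s n| ≤ |h n + lam ^ 2 / 2| := le_of_mul_le_mul_right h2 (abs_pos.2 (hs n))
    have h5 := abs_add_le (h n) (lam ^ 2 / 2)
    rw [abs_of_nonneg (by positivity : 0 ≤ lam ^ 2 / 2)] at h5
    linarith
  obtain ⟨t, -, φ, hφ, ht⟩ := (isCompact_closedBall (0 : ℝ) _).tendsto_subseq hsB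
  have hhφ := hh.comp hφ.tendsto_atTop
  have hdt : 2 * t ^ 2 - 2 * (Q.1 + lam ^ 2 / 2) * t + (a ^ 2 + b ^ 2) = 0 := by
    have hc : Continuous fun y : ℝ × ℝ =>
      2 * y.2 ^ 2 - 2 * (y.1 + lam ^ 2 / 2) * y.2 + (a ^ 2 + b ^ 2) := by fun_prop
    have := (hc.tendsto (Q.1, t)).comp (hhφ.prodMk_nhds ht)
    refine tendsto_nhds_unique this (tendsto_const_nhds.congr fun n => (hd (φ n)).symm)
  have ht0 : t ≠ 0 := by
    rintro rfl
    have : 0 < a ^ 2 + b ^ 2 := by positivity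
    linarith
  refine ⟨Q.1, t, ht0, ?_, hdt⟩
  refine tendsto_nhds_unique ((continuousAt_surf₂ a b lam Q.1 ht0).tendsto.comp
    (hhφ.prodMk_nhds ht)) ((hPQ.comp hφ.tendsto_atTop).congr fun n => (he (φ n)).symm)

lemma polynomial_eventually_ne {p : Polynomial ℝ} (hp : p ≠ 0) (x : ℝ) :
    ∀ᶠ y in 𝓝[≠] x, p.eval y ≠ 0 := by
  have hf : {y | p.eval y = 0}.Finite := by
    refine (p.roots.toFinset.finite_toSet).subset fun y hy => ?_
    simpa [hp] using hy
  have hm : ({y | p.eval y = 0} \ {x})ᶜ ∈ 𝓝 x :=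
    (hf.subset Set.sdiff_subset).isClosed.isOpen_compl.mem_nhds (by simp)
  filter_upwards [nhdsWithin_le_nhds hm, self_mem_nhdsWithin] with y hy hyx h0
  exact hy ⟨h0, hyx⟩

/-- On the curve both parametrizations with the same (h, s) give the same point, and `h₂`, `h₁` say
that the scalar factors of ∂ₛ on Π₂ and Π₁ are non-zero: the polynomials are these factors times
2s³. -/
lemma mem_regularTangency {a b lam h s : ℝ} (hs : s ≠ 0)
    (hd : 2 * s ^ 2 - 2 * (h + lam ^ 2 / 2) * s + (a ^ 2 + b ^ 2) = 0)
    (h₂ : 8 * lam ^ 2 * s ^ 3 - (a ^ 2 - b ^ 2) ^ 2 ≠ 0)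
    (h₁ : 4 * s ^ 4 + 8 * lam ^ 2 * s ^ 3 - 4 * (a ^ 2 + b ^ 2) * s ^ 2
      + ((a ^ 2 + b ^ 2) ^ 2 - (a ^ 2 - b ^ 2) ^ 2) ≠ 0) :
    surf₂ a b lam (h, s) ∈ regularTangency a b lam := by
  have hh : h = s + (a ^ 2 + b ^ 2) / (2 * s) - lam ^ 2 / 2 := by
    field_simp
    linear_combination -hd
  set p := a ^ 2 + b ^ 2 with hp
  set n := (a ^ 2 - b ^ 2) ^ 2 with hn
  obtain ⟨χ, hχ⟩ : ∃ χ, χ = -4 * (h - lam ^ 2 / 2) + 6 * s + (p ^ 2 - n) / (2 * s ^ 3) := ⟨_, rfl⟩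
  obtain ⟨φ, hφ⟩ : ∃ φ, φ = 4 * lam ^ 2 - n / (2 * s ^ 3) := ⟨_, rfl⟩
  have hφ0 : φ ≠ 0 := by
    have : φ = (8 * lam ^ 2 * s ^ 3 - n) / (2 * s ^ 3) := by rw [hφ]; field_simp; ring
    rw [this]
    exact div_ne_zero h₂ (by positivity)
  have hχ0 : χ ≠ 0 := by
    have : χ = (4 * s ^ 4 + 8 * lam ^ 2 * s ^ 3 - 4 * p * s ^ 2 + (p ^ 2 - n)) / (2 * s ^ 3) := by
      rw [hχ, hh]; field_simp; ring
    rw [this]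
    exact div_ne_zero h₁ (by positivity)
  refine ⟨(h, s), (h, s), hs, hs, ?_, rfl, ?_, ?_, ?_⟩
  · simp only [surf₁, surf₂, ← hp, ← hn, Prod.mk.injEq, true_and]
    rw [hh]
    constructor <;> field_simp <;> ring
  · rw [injective_fderiv_surf₁_iff a b lam h hs, ← hp, ← hn, ← hχ]
    exact hχ0
  · rw [injective_fderiv_surf₂_iff a b lam h hs]
    exact h₂
  · apply le_antisymm
    · rintro _ ⟨v, rfl⟩
      refine ⟨(v.1, ((2 * (h - lam ^ 2 / 2) - 4 * s + 2 * lam ^ 2) * v.1 + χ * v.2) / φ), ?_⟩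
      simp only [ContinuousLinearMap.coe_coe]
      rw [fderiv_surf₁ a b lam h hs, fderiv_surf₂ a b lam h hs, ← hp, ← hn, ← hχ, ← hφ,
        mul_div_cancel₀ _ hφ0]
      simp only [Prod.mk.injEq, true_and]
      exact ⟨by ring, by linear_combination v.1 / 2 * hd⟩
    · rintro _ ⟨v, rfl⟩
      refine ⟨(v.1, (-(2 * (h - lam ^ 2 / 2) - 4 * s + 2 * lam ^ 2) * v.1 + φ * v.2) / χ), ?_⟩
      simp only [ContinuousLinearMap.coe_coe]
      rw [fderiv_surf₁ a b lam h hs, fderiv_surf₂ a b lam h hs, ← hp, ← hn, ← hχ, ← hφ,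
        mul_div_cancel₀ _ hχ0]
      simp only [Prod.mk.injEq, true_and]
      exact ⟨by ring, by linear_combination -v.1 / 2 * hd⟩

lemma tangencyCurve_eq {a b lam : ℝ} (hb : 0 < b) (hab : b < a) :
    tangencyCurve a b lam = discriminantCurve a b lam := by
  apply Set.Subset.antisymm
  · exact closure_minimal (regularTangency_subset a b lam) (isClosed_discriminantCurve hb)
  rintro P ⟨h, s, hs, rfl, hd⟩
  have ha : 0 < a := hb.trans hab
  -- The curve solved for h as a function of s. A given point is approached along it, avoiding the
  -- finitely many s at which one surface is not immersed.
  set η : ℝ → ℝ := fun t => t + (a ^ 2 + b ^ 2) / (2 * t) - lam ^ 2 / 2 with hη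
  have hηs : η s = h := by
    simp only [hη]
    field_simp
    linear_combination hd
  have hηc : ContinuousAt η s := by
    simp only [hη]
    have : 2 * s ≠ 0 := by positivity
    fun_prop (disch := assumption)
  have ht : Tendsto (fun t => surf₂ a b lam (η t, t)) (𝓝[≠] s) (𝓝 (surf₂ a b lam (h, s))) := by
    have h1 : ContinuousAt (fun t => (η t, t)) s := hηc.prodMk continuousAt_id
    have h2 : ContinuousAt (surf₂ a b lam) (η s, s) := continuousAt_surf₂ a b lam _ hs
    have h3 := h2.tendsto.comp h1.tendsto
    rw [hηs] at h3
    exact h3.mono_left nhdsWithin_le_nhds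
  refine mem_closure_of_tendsto ht ?_
  -- Both excluded polynomials are non-zero because of their constant terms, −r⁴ and p⁴ − r⁴ =
  -- 4a²b².
  have e₁ := polynomial_eventually_ne (p := Polynomial.C (8 * lam ^ 2) * Polynomial.X ^ 3
    - Polynomial.C ((a ^ 2 - b ^ 2) ^ 2)) (fun h0 => by
      have := congrArg (Polynomial.eval 0) h0
      simp at this
      exact sq_sub_sq_ne_zero hb hab this) s
  have e₂ := polynomial_eventually_ne (p := Polynomial.C 4 * Polynomial.X ^ 4
    + Polynomial.C (8 * lam ^ 2) * Polynomial.X ^ 3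
    - Polynomial.C (4 * (a ^ 2 + b ^ 2)) * Polynomial.X ^ 2
    + Polynomial.C ((a ^ 2 + b ^ 2) ^ 2 - (a ^ 2 - b ^ 2) ^ 2)) (fun h0 => by
      have := congrArg (Polynomial.eval 0) h0
      simp only [Polynomial.eval_add, Polynomial.eval_sub, Polynomial.eval_mul, Polynomial.eval_C,
        Polynomial.eval_pow, Polynomial.eval_X, Polynomial.eval_zero] at this
      have h4 : 4 * (a ^ 2 * b ^ 2) = 0 := by linear_combination this
      have : 4 * (a ^ 2 * b ^ 2) ≠ 0 := by positivity
      exact this h4) s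
  have e₃ : ∀ᶠ t in 𝓝[≠] s, t ≠ 0 := nhdsWithin_le_nhds (isOpen_ne.mem_nhds hs)
  filter_upwards [e₁, e₂, e₃] with t h1 h2 h3
  simp only [Polynomial.eval_add, Polynomial.eval_sub, Polynomial.eval_mul, Polynomial.eval_C,
    Polynomial.eval_pow, Polynomial.eval_X] at h1 h2
  refine mem_regularTangency h3 ?_ h1 h2
  simp only [hη]
  field_simp
  ring

end

/-! ### The cuspidal edge -/

section
open Filter

/-- The inverse function theorem: an analytic map with injective derivative is a local
diffeomorphism. -/
lemma exists_local_diffeomorph {E : Type*} [NormedAddCommGroup E] [NormedSpace ℝ E]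
    [FiniteDimensional ℝ E] {f : E → E} {q : E} {f' : E →L[ℝ] E} (hf : ContDiffAt ℝ ω f q)
    (hf' : HasFDerivAt f f' q) (hi : ∀ v, f' v = 0 → v = 0) :
    ∃ Φ : OpenPartialHomeomorph E E, q ∈ Φ.source ∧ (Φ : E → E) = f ∧
      ContDiffOn ℝ ∞ Φ Φ.source ∧ ContDiffOn ℝ ∞ Φ.symm Φ.target := by
  have : CompleteSpace E := FiniteDimensional.complete ℝ E
  set e : E ≃L[ℝ] E := (LinearEquiv.ofInjectiveEndo f'.toLinearMap
    ((injective_iff_map_eq_zero _).2 hi)).toContinuousLinearEquiv with he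
  have hfe : HasFDerivAt f (e : E →L[ℝ] E) q := by
    refine hf'.congr_fderiv ?_
    ext v
    rfl
  set Φ := hf.toOpenPartialHomeomorph f hfe (by simp) with hΦ
  have hq : q ∈ Φ.source := hf.mem_toOpenPartialHomeomorph_source hfe (by simp)
  -- Analyticity at a point extends to a neighbourhood, whereas smoothness of order ∞ at a point
  -- gives only neighbourhoods depending on the order; hence the hypothesis with `ω`.
  have hn : (ω : WithTop ℕ∞) ≠ ∞ := by simp
  refine ⟨Φ.restrContDiff ℝ ω hn, ?_, rfl, ?_, ?_⟩
  · exact ⟨hq, hf, hf.to_localInverse hfe (by simp)⟩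
  · exact (Φ.contDiffOn_restrContDiff_source ℝ hn).of_le le_top
  · exact (Φ.contDiffOn_restrContDiff_target ℝ hn).of_le le_top

/-- The derivatives of a diffeomorphism and of its inverse are inverse to each other. -/
lemma fderiv_symm_fderiv {E : Type*} [NormedAddCommGroup E] [NormedSpace ℝ E]
    (Φ : OpenPartialHomeomorph E E) {q : E} (hq : q ∈ Φ.source)
    (h1 : ContDiffOn ℝ ∞ Φ Φ.source) (h2 : ContDiffOn ℝ ∞ Φ.symm Φ.target) (v : E) :
    fderiv ℝ Φ.symm (Φ q) (fderiv ℝ Φ q v) = v := by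
  have d1 : DifferentiableAt ℝ Φ q :=
    (h1.contDiffAt (Φ.open_source.mem_nhds hq)).differentiableAt (by simp)
  have d2 : DifferentiableAt ℝ Φ.symm (Φ q) :=
    (h2.contDiffAt (Φ.open_target.mem_nhds (Φ.map_source hq))).differentiableAt (by simp)
  have h3 : HasFDerivAt (Φ.symm ∘ Φ)
      ((fderiv ℝ Φ.symm (Φ q)).comp (fderiv ℝ Φ q)) q :=
    d2.hasFDerivAt.comp q d1.hasFDerivAt
  have h4 : HasFDerivAt (Φ.symm ∘ Φ) (ContinuousLinearMap.id ℝ E) q :=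
    (hasFDerivAt_id q).congr_of_eventuallyEq (Φ.eventually_left_inverse hq)
  exact congrArg (fun L => L v) (h3.unique h4)

lemma hasFDerivAt_cusp_model :
    HasFDerivAt (fun y : ℝ × ℝ => ((y.1, y.2 ^ 2, y.2 ^ 3) : Val))
      ((ContinuousLinearMap.fst ℝ ℝ ℝ).prod 0) 0 := by
  have h1 : HasFDerivAt (fun q : ℝ × ℝ => q.1) (ContinuousLinearMap.fst ℝ ℝ ℝ) 0 :=
    hasFDerivAt_fst
  have h2 : HasFDerivAt (fun q : ℝ × ℝ => q.2) (ContinuousLinearMap.snd ℝ ℝ ℝ) 0 :=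
    hasFDerivAt_snd
  refine (h1.prodMk ((h2.pow 2).prodMk (h2.pow 3))).congr_fderiv ?_
  ext <;> simp

/-- A germ equivalent to a cuspidal edge is not immersive. -/
lemma IsCuspidalEdgeAt.not_injective {f : ℝ × ℝ → Val} {q : ℝ × ℝ} (h : IsCuspidalEdgeAt f q)
    (hf : DifferentiableAt ℝ f q) : ¬ Function.Injective (fderiv ℝ f q) := by
  obtain ⟨Φ, Ψ, hq, hfq, h0, h1, h2, h3, h4, he⟩ := h
  have dΦ : DifferentiableAt ℝ Φ q :=
    (h1.contDiffAt (Φ.open_source.mem_nhds hq)).differentiableAt (by simp)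
  have dΨ : DifferentiableAt ℝ Ψ (f q) :=
    (h3.contDiffAt (Ψ.open_source.mem_nhds hfq)).differentiableAt (by simp)
  have hm := hasFDerivAt_cusp_model
  rw [← h0] at hm
  have e1 := hm.comp q dΦ.hasFDerivAt
  have e2 := (dΨ.hasFDerivAt.comp q hf.hasFDerivAt).congr_of_eventuallyEq
    (f₁ := (fun y : ℝ × ℝ => ((y.1, y.2 ^ 2, y.2 ^ 3) : Val)) ∘ Φ) (he.mono fun y hy => hy.symm)
  have e3 := e1.unique e2
  have hs := fderiv_symm_fderiv Φ.symm (q := Φ q) (Φ.map_source hq) h2 h1 (0, 1)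
  rw [OpenPartialHomeomorph.symm_symm, Φ.left_inv hq] at hs
  -- The derivative of the model kills (0, 1); its preimage w under dΦ is a non-zero kernel vector
  -- of df.
  set w := fderiv ℝ Φ.symm (Φ q) (0, 1) with hw
  have hw0 : w ≠ 0 := by
    intro hw0
    rw [hw0, map_zero] at hs
    exact zero_ne_one (congrArg Prod.snd hs)
  have e4 : fderiv ℝ Ψ (f q) (fderiv ℝ f q w) = 0 := by
    have h5 : ((ContinuousLinearMap.fst ℝ ℝ ℝ).prod (0 : ℝ × ℝ →L[ℝ] ℝ × ℝ)) (fderiv ℝ Φ q w) =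
        fderiv ℝ Ψ (f q) (fderiv ℝ f q w) := congrArg (fun L => L w) e3
    rw [← h5, hs]
    rfl
  have e5 : fderiv ℝ f q w = 0 := by
    rw [← fderiv_symm_fderiv Ψ hfq h3 h4 (fderiv ℝ f q w), e4, map_zero]
  exact fun hi => hw0 ((injective_iff_map_eq_zero _).1 hi w e5)

/-- The source coordinates that straighten the cuspidal edge of `Π₂`. -/
def cuspSource (h₀ s₀ : ℝ) (q : ℝ × ℝ) : ℝ × ℝ :=
  (q.1 - h₀, (q.2 / s₀ - s₀ ^ 2 / q.2 ^ 2) / 3)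

/-- The first symmetric function of the double-root cubic associated with a point. -/
def cuspX (lam s₀ : ℝ) (P : Val) : ℝ := (P.2.1 + 2 * lam ^ 2 * P.1) / (2 * lam ^ 2 * s₀)

/-- The second symmetric function of the double-root cubic associated with a point. -/
def cuspY (a b lam s₀ : ℝ) (P : Val) : ℝ :=
  ((a ^ 2 + b ^ 2) / 2 * (P.1 + lam ^ 2 / 2) - P.2.2) / (lam ^ 2 * s₀ ^ 2)

/-- The target coordinates that straighten the cuspidal edge of `Π₂`. -/
def cuspTarget (a b lam h₀ s₀ : ℝ) (P : Val) : Val :=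
  (P.1 - h₀, -(cuspY a b lam s₀ P - cuspX lam s₀ P ^ 2 / 3) / 3,
    (cuspX lam s₀ P * cuspY a b lam s₀ P / 3 - 2 * cuspX lam s₀ P ^ 3 / 27 - 1) / 2)

/-- With u = s/s₀, the values of `cuspX` and `cuspY` on Π₂ are the first two elementary symmetric
functions of u, u, u⁻², whose product is 1. -/
lemma cuspX_surf₂ {a b lam : ℝ} (hlam : lam ≠ 0) {s₀ : ℝ} (hs₀ : s₀ ≠ 0)
    (hc : 8 * lam ^ 2 * s₀ ^ 3 = (a ^ 2 - b ^ 2) ^ 2) (h : ℝ) {s : ℝ} (hs : s ≠ 0) :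
    cuspX lam s₀ (surf₂ a b lam (h, s)) = 2 * (s / s₀) + s₀ ^ 2 / s ^ 2 := by
  simp only [cuspX, surf₂, ← hc]
  field_simp
  ring

lemma cuspY_surf₂ {a b lam : ℝ} (hlam : lam ≠ 0) {s₀ : ℝ} (hs₀ : s₀ ≠ 0)
    (hc : 8 * lam ^ 2 * s₀ ^ 3 = (a ^ 2 - b ^ 2) ^ 2) (h : ℝ) {s : ℝ} (hs : s ≠ 0) :
    cuspY a b lam s₀ (surf₂ a b lam (h, s)) = (s / s₀) ^ 2 + 2 * (s₀ / s) := by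
  simp only [cuspY, surf₂, ← hc]
  field_simp
  ring

/-- Shifting the cubic with roots u, u, u⁻² to zero sum of roots turns it into (t − v)²(t + 2v) = t³
− 3v²t + 2v³ with v = (u − u⁻²)/3. The normalized coefficients of this depressed cubic are v² and
v³. -/
lemma cuspTarget_surf₂ {a b lam : ℝ} (hlam : lam ≠ 0) {s₀ : ℝ} (hs₀ : s₀ ≠ 0)
    (hc : 8 * lam ^ 2 * s₀ ^ 3 = (a ^ 2 - b ^ 2) ^ 2) (h₀ h : ℝ) {s : ℝ} (hs : s ≠ 0) :
    cuspTarget a b lam h₀ s₀ (surf₂ a b lam (h, s)) =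
      ((cuspSource h₀ s₀ (h, s)).1, (cuspSource h₀ s₀ (h, s)).2 ^ 2,
        (cuspSource h₀ s₀ (h, s)).2 ^ 3) := by
  simp only [cuspTarget, cuspX_surf₂ hlam hs₀ hc h hs, cuspY_surf₂ hlam hs₀ hc h hs, cuspSource,
    Prod.mk.injEq]
  refine ⟨rfl, ?_, ?_⟩
  · field_simp
    ring
  · field_simp
    ring

lemma hasFDerivAt_cuspSource (h₀ : ℝ) {s₀ : ℝ} (hs₀ : s₀ ≠ 0) :
    HasFDerivAt (cuspSource h₀ s₀)
      ((ContinuousLinearMap.fst ℝ ℝ ℝ).prod ((1 / s₀) • ContinuousLinearMap.snd ℝ ℝ ℝ))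
      (h₀, s₀) := by
  have h1 : HasFDerivAt (fun q : ℝ × ℝ => q.1 - h₀) (ContinuousLinearMap.fst ℝ ℝ ℝ) (h₀, s₀) :=
    hasFDerivAt_fst.sub_const _
  have h2 : HasFDerivAt (fun q : ℝ × ℝ => q.2) (ContinuousLinearMap.snd ℝ ℝ ℝ) (h₀, s₀) :=
    hasFDerivAt_snd
  have h3 : HasDerivAt (fun t : ℝ => (t / s₀ - s₀ ^ 2 / t ^ 2) / 3) (1 / s₀) s₀ := by
    refine ((((hasDerivAt_id' s₀).div_const s₀).fun_sub ((hasDerivAt_const s₀ (s₀ ^ 2)).fun_div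
      (hasDerivAt_sq s₀) (pow_ne_zero 2 hs₀))).div_const 3).congr_deriv ?_
    field_simp
    ring
  have h4 := HasDerivAt.comp_hasFDerivAt (f := fun q : ℝ × ℝ => q.2) (h₀, s₀) h3 h2
  exact h1.prodMk h4

lemma contDiffAt_cuspSource (h₀ : ℝ) {s₀ : ℝ} (hs₀ : s₀ ≠ 0) :
    ContDiffAt ℝ ω (cuspSource h₀ s₀) (h₀, s₀) := by
  have h : s₀ ^ 2 ≠ 0 := pow_ne_zero 2 hs₀
  have h2 : ContDiffAt ℝ ω (fun q : ℝ × ℝ => q.2) (h₀, s₀) := contDiffAt_snd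
  have h1 : ContDiffAt ℝ ω (fun q : ℝ × ℝ => q.1) (h₀, s₀) := contDiffAt_fst
  exact (h1.sub contDiffAt_const).prodMk
    (((h2.div_const s₀).sub (contDiffAt_const.div (h2.pow 2) h)).div_const 3)

lemma contDiff_cuspX (lam s₀ : ℝ) : ContDiff ℝ ω (cuspX lam s₀) := by
  unfold cuspX
  fun_prop

lemma contDiff_cuspY (a b lam s₀ : ℝ) : ContDiff ℝ ω (cuspY a b lam s₀) := by
  unfold cuspY
  fun_prop

lemma contDiff_cuspTarget (a b lam h₀ s₀ : ℝ) : ContDiff ℝ ω (cuspTarget a b lam h₀ s₀) := by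
  have h1 := contDiff_cuspX lam s₀
  have h2 := contDiff_cuspY a b lam s₀
  unfold cuspTarget
  fun_prop

/-- The differential of `cuspX`. -/
def cuspX' (lam s₀ : ℝ) : Val →L[ℝ] ℝ :=
  (1 / (2 * lam ^ 2 * s₀)) • ((ContinuousLinearMap.fst ℝ ℝ ℝ).comp (ContinuousLinearMap.snd ℝ ℝ
      (ℝ × ℝ))
    + (2 * lam ^ 2) • ContinuousLinearMap.fst ℝ ℝ (ℝ × ℝ))

/-- The differential of `cuspY`. -/
def cuspY' (a b lam s₀ : ℝ) : Val →L[ℝ] ℝ :=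
  (1 / (lam ^ 2 * s₀ ^ 2)) • (((a ^ 2 + b ^ 2) / 2) • ContinuousLinearMap.fst ℝ ℝ (ℝ × ℝ)
    - (ContinuousLinearMap.snd ℝ ℝ ℝ).comp (ContinuousLinearMap.snd ℝ ℝ (ℝ × ℝ)))

lemma hasFDerivAt_cuspX (lam s₀ : ℝ) (P : Val) : HasFDerivAt (cuspX lam s₀) (cuspX' lam s₀) P := by
  have e : cuspX lam s₀ = cuspX' lam s₀ := by
    funext P
    simp [cuspX, cuspX', div_eq_inv_mul, mul_add]
  rw [e]
  exact (cuspX' lam s₀).hasFDerivAt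

lemma hasFDerivAt_cuspY (a b lam s₀ : ℝ) (P : Val) :
    HasFDerivAt (cuspY a b lam s₀) (cuspY' a b lam s₀) P := by
  have e : cuspY a b lam s₀ = fun P => cuspY' a b lam s₀ P +
      (a ^ 2 + b ^ 2) / 2 * (lam ^ 2 / 2) / (lam ^ 2 * s₀ ^ 2) := by
    funext P
    simp only [cuspY, cuspY', smul_apply, sub_apply, ContinuousLinearMap.comp_apply,
      ContinuousLinearMap.coe_fst', ContinuousLinearMap.coe_snd', smul_eq_mul]
    ring
  rw [e]
  exact (cuspY' a b lam s₀).hasFDerivAt.add_const _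

/-- The values 3, 3 belong to the triple root u = 1. There the linear parts (2dX − dY)/3 and (dY −
dX)/2 are independent, which makes the target map a local diffeomorphism. -/
lemma hasFDerivAt_cuspTarget (a b lam h₀ s₀ : ℝ) {P : Val} (hX : cuspX lam s₀ P = 3)
    (hY : cuspY a b lam s₀ P = 3) :
    HasFDerivAt (cuspTarget a b lam h₀ s₀)
      ((ContinuousLinearMap.fst ℝ ℝ (ℝ × ℝ)).prod
        ((1 / 3 : ℝ) • ((2 : ℝ) • cuspX' lam s₀ - cuspY' a b lam s₀) |>.prod
        ((1 / 2 : ℝ) • (cuspY' a b lam s₀ - cuspX' lam s₀)))) P := by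
  have h1 : HasFDerivAt (fun q : Val => q.1 - h₀) (ContinuousLinearMap.fst ℝ ℝ (ℝ × ℝ)) P :=
    hasFDerivAt_fst.sub_const _
  have hx := hasFDerivAt_cuspX lam s₀ P
  have hy := hasFDerivAt_cuspY a b lam s₀ P
  have h2 := (hy.fun_sub ((hx.pow 2).const_mul (1 / 3))).const_mul (-(1 / 3))
  have h3 := ((((hx.fun_mul hy).const_mul (1 / 3)).fun_sub
    ((hx.pow 3).const_mul (2 / 27))).sub_const 1).const_mul (1 / 2)
  refine ((h1.prodMk (h2.prodMk h3)).congr_of_eventuallyEq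
    (Eventually.of_forall fun q => ?_)).congr_fderiv ?_
  · simp only [cuspTarget, Prod.mk.injEq, true_and]
    constructor <;> ring
  · rw [hX, hY]
    refine ContinuousLinearMap.ext fun v => ?_
    simp only [ContinuousLinearMap.prod_apply, smul_apply, sub_apply, add_apply, smul_eq_mul,
      Prod.mk.injEq, true_and, nsmul_eq_mul]
    norm_num
    constructor <;> ring

lemma isCuspidalEdgeAt_surf₂ {a b lam : ℝ} (hlam : lam ≠ 0) {s₀ : ℝ} (hs₀ : s₀ ≠ 0)
    (hc : 8 * lam ^ 2 * s₀ ^ 3 = (a ^ 2 - b ^ 2) ^ 2) (h₀ : ℝ) :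
    IsCuspidalEdgeAt (surf₂ a b lam) (h₀, s₀) := by
  obtain ⟨Φ, hΦ1, hΦ2, hΦ3, hΦ4⟩ := exists_local_diffeomorph (contDiffAt_cuspSource h₀ hs₀)
    (hasFDerivAt_cuspSource h₀ hs₀) (fun v hv => by
      simp only [ContinuousLinearMap.prod_apply, smul_apply, ContinuousLinearMap.coe_fst',
        ContinuousLinearMap.coe_snd', smul_eq_mul, Prod.mk_eq_zero] at hv
      exact Prod.ext hv.1 ((mul_eq_zero.1 hv.2).resolve_left (one_div_ne_zero hs₀)))
  have hX : cuspX lam s₀ (surf₂ a b lam (h₀, s₀)) = 3 := by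
    rw [cuspX_surf₂ hlam hs₀ hc h₀ hs₀]
    field_simp
    norm_num
  have hY : cuspY a b lam s₀ (surf₂ a b lam (h₀, s₀)) = 3 := by
    rw [cuspY_surf₂ hlam hs₀ hc h₀ hs₀]
    field_simp
    norm_num
  obtain ⟨Ψ, hΨ1, hΨ2, hΨ3, hΨ4⟩ := exists_local_diffeomorph
    (contDiff_cuspTarget a b lam h₀ s₀).contDiffAt
    (hasFDerivAt_cuspTarget a b lam h₀ s₀ hX hY) (fun v hv => by
      simp only [ContinuousLinearMap.prod_apply, smul_apply, sub_apply,
        ContinuousLinearMap.coe_fst', smul_eq_mul, Prod.mk_eq_zero] at hv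
      obtain ⟨h1, h2, h3⟩ := hv
      have hx : cuspX' lam s₀ v = 0 := by linarith
      have hy : cuspY' a b lam s₀ v = 0 := by linarith
      simp only [cuspX', cuspY', smul_apply, sub_apply, add_apply, smul_eq_mul,
        ContinuousLinearMap.comp_apply, ContinuousLinearMap.coe_fst', ContinuousLinearMap.coe_snd',
        h1, mul_zero, add_zero, zero_sub] at hx hy
      have h4 : v.2.1 = 0 := (mul_eq_zero.1 hx).resolve_left (by positivity)
      have h5 : -v.2.2 = 0 := (mul_eq_zero.1 hy).resolve_left (by positivity)
      exact Prod.ext h1 (Prod.ext h4 (neg_eq_zero.1 h5)))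
  refine ⟨Φ, Ψ, hΦ1, hΨ1, ?_, hΦ3, hΦ4, hΨ3, hΨ4, ?_⟩
  · rw [hΦ2, cuspSource]
    field_simp
    simp
  · have : ∀ᶠ y : ℝ × ℝ in 𝓝 (h₀, s₀), y.2 ≠ 0 :=
      continuous_snd.continuousAt.eventually_ne hs₀
    filter_upwards [this] with y hy
    rw [hΦ2, hΨ2]
    exact cuspTarget_surf₂ hlam hs₀ hc h₀ y.1 hy

/-- A cuspidal edge is never immersive, which forces 8λ²s³ = r⁴; conversely every such s admits the
explicit normal form. -/
lemma cuspidalEdge₂_eq {a b lam : ℝ} (hlam : lam ≠ 0) :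
    cuspidalEdge₂ a b lam = {P | ∃ h s : ℝ, s ≠ 0 ∧ surf₂ a b lam (h, s) = P ∧
      8 * lam ^ 2 * s ^ 3 - (a ^ 2 - b ^ 2) ^ 2 = 0} := by
  ext P
  constructor
  · rintro ⟨⟨h, s⟩, hs, rfl, hc⟩
    refine ⟨h, s, hs, rfl, ?_⟩
    have := hc.not_injective (hasFDerivAt_surf₂ a b lam h hs).differentiableAt
    rwa [injective_fderiv_surf₂_iff a b lam h hs, not_not] at this
  · rintro ⟨h, s, hs, rfl, hc⟩
    exact ⟨(h, s), hs, rfl, isCuspidalEdgeAt_surf₂ hlam hs (sub_eq_zero.1 hc) h⟩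

lemma setOf_muSq_eq_zero {a b lam : ℝ} (hb : 0 < b) (hab : b < a) (hlam : lam ≠ 0) :
    {P : Val | ∃ h s : ℝ, s ≠ 0 ∧ surf₂ a b lam (h, s) = P ∧ muSq a b lam h s = 0} =
      cuspidalEdge₂ a b lam ∪ tangencyCurve a b lam := by
  have key : ∀ h s : ℝ, s ≠ 0 → (muSq a b lam h s = 0 ↔
      8 * lam ^ 2 * s ^ 3 - (a ^ 2 - b ^ 2) ^ 2 = 0 ∨
      2 * s ^ 2 - 2 * (h + lam ^ 2 / 2) * s + (a ^ 2 + b ^ 2) = 0) := fun h s hs => by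
    rw [muSq, mul_eq_zero, mul_eq_zero, neg_eq_zero, or_iff_right (one_div_ne_zero hs)]
  rw [cuspidalEdge₂_eq hlam, tangencyCurve_eq hb hab]
  ext P
  constructor
  · rintro ⟨h, s, hs, hP, hμ⟩
    rcases (key h s hs).1 hμ with h0 | h0
    · exact Or.inl ⟨h, s, hs, hP, h0⟩
    · exact Or.inr ⟨h, s, hs, hP, h0⟩
  · rintro (⟨h, s, hs, hP, h0⟩ | ⟨h, s, hs, hP, h0⟩)
    · exact ⟨h, s, hs, hP, (key h s hs).2 (Or.inl h0)⟩
    · exact ⟨h, s, hs, hP, (key h s hs).2 (Or.inr h0)⟩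

end

end KowalevskiGyrostat

end

/-! ### The main theorem -/

open KowalevskiGyrostat in
theorem mainTheorem2 (a b lam : ℝ) (hb : 0 < b) (hab : b < a) (hlam : lam ≠ 0) :
    (∀ x ∈ subsystem₂ a b lam,
      rankJ a b lam x ≤ 2 ∧
      (∃! s : ℝ, s ≠ 0 ∧ intJ a b lam x = surf₂ a b lam (intH x, s)) ∧
      (rankJ a b lam x = 2 →
        (∀ s : ℝ, s ≠ 0 → intJ a b lam x = surf₂ a b lam (intH x, s) →
          HasExponentSq lam (combo a b lam (coeffL a b lam s)) x (muSq a b lam (intH x) s) ∧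
          (IsCenter a b lam x ↔ muSq a b lam (intH x) s < 0) ∧
          (IsSaddle a b lam x ↔ 0 < muSq a b lam (intH x) s) ∧
          (IsDegenerate a b lam x ↔ muSq a b lam (intH x) s = 0)) ∧
        (IsDegenerate a b lam x ↔
          intJ a b lam x ∈ cuspidalEdge₂ a b lam ∪ tangencyCurve a b lam))) ∧
    {P : Val | ∃ h s : ℝ, s ≠ 0 ∧ surf₂ a b lam (h, s) = P ∧ muSq a b lam h s = 0} =
      cuspidalEdge₂ a b lam ∪ tangencyCurve a b lam := by
  refine ⟨fun x hx => ?_, setOf_muSq_eq_zero hb hab hlam⟩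
  obtain ⟨s, h⟩ := exists_related hlam hx
  have hs := h.ne_zero hb hab
  have hJ := h.intJ_eq hb hab
  have huniq : ∀ t, t ≠ 0 → intJ a b lam x = surf₂ a b lam (intH x, t) → t = s :=
    fun t ht htJ => (surf₂_injective hlam ht hs (htJ.symm.trans hJ)).2
  refine ⟨rankJ_le_two (by rw [coeffL_two]; norm_num) (h.criticalAt hb hab),
    ⟨s, ⟨hs, hJ⟩, fun t ht => huniq t ht.1 ht.2⟩, fun hr => ⟨fun t ht htJ => ?_, ?_⟩⟩
  · obtain rfl := huniq t ht htJ
    exact ⟨h.hasExponentSq hb hab hr, h.isCenter_iff hb hab hr, h.isSaddle_iff hb hab hr,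
      h.isDegenerate_iff hb hab hr⟩
  · rw [h.isDegenerate_iff hb hab hr, ← setOf_muSq_eq_zero hb hab hlam]
    constructor
    · exact fun hμ => ⟨intH x, s, hs, hJ.symm, hμ⟩
    · rintro ⟨h', t, ht, htJ, hμ⟩
      -- Membership in the locus μ² = 0 provides some parameters (h', t) of the point J(x);
      -- injectivity of the parametrization identifies them with (H(x), s).
      obtain ⟨rfl, rfl⟩ := surf₂_injective hlam ht hs (htJ.trans hJ)
      exact hμ
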